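/- Let $F/\mathbb{Q}_p$ be a finite extension with uniformizer $\pi$ and residue field $\mathbb{F}_q$, let $k/\mathbb{F}_q$ be a finite extension and $\Gamma=\mathcal{O}_F^\times$. Let $\Phi(t)\in\mathcal{O}_F[[t]]$ be a Lubin--Tate series ($\Phi\equiv\pi t$ modulo $t^2$, $\Phi\equiv t^q$ modulo $\pi$) whose coefficient of $t^2$ is divisible by $\pi^2$ (this forces $q>2$, and for $q>2$ it holds for $\Phi=\pi t+t^q$); let $[\gamma]_\Phi(t)$ be the series of multiplication by $\gamma\in\Gamma$ on the corresponding Lubin--Tate group. Let $D$ be a finite set (the case of interest is $|D|>1$), $k[[t_\bullet]]=k[[t_d]]_{d\in D}$, $t_D=\prod_d t_d$, $k((t_\bullet))=k[[t_\bullet]][t_D^{-1}]$. Let $\varphi_d$ be the $k$-algebra endomorphism of these rings with $t_d\mapsto t_d^q$ and $t_{d'}\mapsto t_{d'}$ for $d'\ne d$, and let $\gamma=(\gamma_d)_d\in\Gamma_\bullet=\Gamma^D$ act $k$-linearly by $t_d\mapsto[\gamma_d]_\Phi(t_d)$. Fix a $\psi$-operator on $k[[t_\bullet]]$: surjective additive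 maps $\psi_d$ ($d\in D$) with $\psi_d(\varphi_d(a)x)=a\psi_d(x)$ which commute with $\Gamma_\bullet$ and with $\varphi_{d'}$ for $d'\neq d$. An étale $(\varphi_\bullet,\Gamma_\bullet)$-module is a finitely generated $k((t_\bullet))$-module $\mathbf D$ with commuting semilinear operators $\varphi_d$ and a commuting semilinear action of $\Gamma_\bullet$ such that all linearizations $\mathrm{id}\otimes\varphi_d:k((t_\bullet))\otimes_{\varphi_d,k((t_\bullet))}\mathbf D\to\mathbf D$ are bijective; $\psi_d$ on $\mathbf D$ is $(\mathrm{id}\otimes\varphi_d)^{-1}$ followed by $a\otimes x\mapsto\psi_d(a)x$, where $\psi_d$ is extended to $k((t_\bullet))$ by $\psi_d(\varphi_d(a)x)=a\psi_d(x)$. Put $\psi_D=\prod_d\psi_d$. A lattice in $\mathbf D$ is a finitely generated $k[[t_\bullet]]$-submodule that generates $\mathbf D$ over $k((t_\bullet))$. $\mathbf D^\sharp$ denotes the unique lattice (if there is one) with $\psi_D(\mathbf D^\sharp)=\mathbf D^\sharp$ such that for each $x\in\mathbf D$ some $\psi_D^n(x)$ lies in $\mathbf D^\sharp$, and $\mathbf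 D^\natural$ denotes the intersection of all lattices contained in $\mathbf D^\sharp$ and stable under all $\psi_d$. Fix $c_d\in k^\times$ and $m_d\in\mathbb{Z}/(q-1)\mathbb{Z}$ for $d\in D$. Let $B=\bigoplus_{C\subset D}k\,e_C$, with $t_d e_C=e_{C\cup\{d\}}$ if $d\notin C$ and $t_d e_C=0$ if $d\in C$, and let $\gamma\in\Gamma_\bullet$ act on $e_C$ by the scalar $\prod_{d\in C}\bar\gamma_d^{\,m_d+1}\prod_{d\notin C}\bar\gamma_d^{\,m_d}$, where $\bar\gamma_d\in k^\times$ is the reduction of $\gamma_d$. For an upward-closed family $\mathcal D$ of nonempty subsets of $D$ let $B_{\mathcal D}=B/\sum_{C\in\mathcal D}k\,e_C$, and let $\Delta_{\mathcal D}$ be the quotient of $k[[t_\bullet]][\varphi_\bullet]\otimes_{k[[t_\bullet]]}B_{\mathcal D}$ by the $k[[t_\bullet]][\varphi_\bullet]$-submodule generated by the elements $t_d^{q-1}\varphi_d\otimes e_\emptyset-1\otimes c_de_\emptyset$, $d\in D$. Let $\Delta_{\mathcal D}^*=\mathrm{Hom}_k(\Delta_{\mathcal D},k)$, with $(a\ell)(x)=\ell(ax)$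 for $a\in k[[t_\bullet]]$, and $\mathbf D_{\mathcal D}=\Delta_{\mathcal D}^*\otimes_{k[[t_\bullet]]}k((t_\bullet))$. Then: 1. For each such $\mathcal D$ there is a unique $\Gamma_\bullet$-action on $\Delta_{\mathcal D}$ that is semilinear over $k[[t_\bullet]]$, commutes with the $\varphi_d$ and extends the given action on the $e_C$. $\Delta_{\mathcal D}$ is finitely generated over $k[[t_\bullet]][\varphi_\bullet]$, it is torsion over each $k[[t_d]]$, the space $\{x\in\Delta_{\mathcal D}\mid t_dx=0\ \forall d\}$ is finite dimensional over $k$, and $\Delta_{\mathcal D}=k[[t_\bullet]]\varphi_d(\Delta_{\mathcal D})$ for each $d$. 2. The map $\Delta_{\mathcal D}^*\to\mathbf D_{\mathcal D}$ is injective, $\mathbf D_{\mathcal D}$ is free of rank one over $k((t_\bullet))$, and it has a unique structure of étale $(\varphi_\bullet,\Gamma_\bullet)$-module such that on $\Delta_{\mathcal D}^*$ one has $(\gamma\ell)(x)=\ell(\gamma^{-1}x)$ and $\psi_d(\ell)=\ell\circ\varphi_d$. 3. For $\mathcal D\subset\mathcal D'$ the projection $B_{\mathcal D}\to B_{\mathcal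 D'}$ induces an injection $\Delta_{\mathcal D'}^*\to\Delta_{\mathcal D}^*$ and an isomorphism $\mathbf D_{\mathcal D'}\cong\mathbf D_{\mathcal D}$ of étale $(\varphi_\bullet,\Gamma_\bullet)$-modules. Thus all $\mathcal D$ give the same module $\mathbf D:=\mathbf D_\emptyset$. 4. Inside $\mathbf D$ the $\Delta_{\mathcal D}^*$ are $\Gamma_\bullet$-stable lattices with $\psi_d(\Delta_{\mathcal D}^*)=\Delta_{\mathcal D}^*$ for all $d$, and $\Delta_{\mathcal D}^*\ne\Delta_{\mathcal D'}^*$ whenever $\mathcal D\neq\mathcal D'$. 5. $\mathbf D^\sharp$ exists and equals $\Delta_{\emptyset}^*$ (the case $\mathcal D=\emptyset$), and $\mathbf D^\natural=\Delta_{\mathcal D_0}^*$ for $\mathcal D_0=\{C\subset D\mid C\ne\emptyset\}$. -/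

import Mathlib

namespace PsiLattice

open scoped TensorProduct

noncomputable section

/-! ### The rings `k[[t_•]]`, `k((t_•))` and the operators `φ_d` -/

/-- The power series ring `k[[t_•]]` in variables `t_d`, `d ∈ D`. -/
abbrev PS (k D : Type*) [Field k] : Type _ := MvPowerSeries D k

/-- `t_D = ∏ t_d`. -/
def tD (k D : Type*) [Field k] [Fintype D] : PS k D := ∏ d, MvPowerSeries.X d

lemma tD_ne_zero (k D : Type*) [Field k] [Fintype D] : tD k D ≠ 0 :=
  Finset.prod_ne_zero_iff.mpr fun i _ h => by
    have := congrArg (MvPowerSeries.coeff (Finsupp.single i 1)) h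
    simp at this

/-- The Laurent ring `k((t_•)) = k[[t_•]][t_D⁻¹]`. -/
abbrev LS (k D : Type*) [Field k] [Fintype D] : Type _ := Localization.Away (tD k D)

/-- The free commutative monoid on the symbols `φ_d`, `d ∈ D` (written multiplicatively); the
parameter `q` records that it acts on `k[[t_•]]` through `φ_d(t_d) = t_d ^ q`. -/
def PhiMon (_q : ℕ) (D : Type*) : Type _ := Multiplicative (D → ℕ)

instance (q : ℕ) (D : Type*) : CommMonoid (PhiMon q D) :=
  inferInstanceAs (CommMonoid (Multiplicative (D → ℕ)))

/-- The exponents of an element of `PhiMon q D`. -/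
def PhiMon.exp {q : ℕ} {D : Type*} (n : PhiMon q D) : D → ℕ := Multiplicative.toAdd n

/-- The generator `φ_d`. -/
def PhiMon.phi (q : ℕ) {D : Type*} [DecidableEq D] (d : D) : PhiMon q D :=
  Multiplicative.ofAdd (Pi.single d 1)

lemma PhiMon.exp_one {q : ℕ} {D : Type*} : (1 : PhiMon q D).exp = 0 := rfl

lemma PhiMon.exp_mul {q : ℕ} {D : Type*} (m n : PhiMon q D) :
    (m * n).exp = m.exp + n.exp := rfl

section Frobenius

variable {k D : Type*} [Field k] [Fintype D] {q : ℕ} [NeZero q]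

lemma hasSubst_frob (n : PhiMon q D) :
    MvPowerSeries.HasSubst (fun d => (MvPowerSeries.X d : PS k D) ^ q ^ n.exp d) :=
  MvPowerSeries.hasSubst_of_constantCoeff_zero fun d => by
    simp [NeZero.ne q]

/-- The element `∏ φ_d ^ (n_d)` acts on `k[[t_•]]` as the `k`-algebra endomorphism
`t_d ↦ t_d ^ (q ^ n_d)`. -/
def frob (n : PhiMon q D) : PS k D →ₐ[k] PS k D :=
  MvPowerSeries.substAlgHom (hasSubst_frob n)

lemma frob_X (n : PhiMon q D) (d : D) :
    frob n (MvPowerSeries.X d : PS k D) = MvPowerSeries.X d ^ q ^ n.exp d :=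
  MvPowerSeries.substAlgHom_X _ _

instance : MulSemiringAction (PhiMon q D) (PS k D) where
  smul n f := frob n f
  one_smul f := by
    change frob 1 f = f
    have h : (fun d => (MvPowerSeries.X d : PS k D) ^ q ^ (1 : PhiMon q D).exp d)
        = MvPowerSeries.X := by
      funext d; simp [PhiMon.exp_one]
    rw [frob, MvPowerSeries.substAlgHom_apply, h, MvPowerSeries.subst_self]; rfl
  mul_smul m n f := by
    change frob (m * n) f = frob m (frob n f)
    rw [frob, frob, frob, MvPowerSeries.substAlgHom_comp_substAlgHom_apply,
      MvPowerSeries.substAlgHom_apply, MvPowerSeries.substAlgHom_apply]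
    congr 1
    funext d
    change _ = frob m ((MvPowerSeries.X d : PS k D) ^ q ^ n.exp d)
    rw [map_pow, frob_X, ← pow_mul, ← pow_add, PhiMon.exp_mul, Pi.add_apply]
  smul_zero n := map_zero (frob n)
  smul_add n := map_add (frob n)
  smul_one n := map_one (frob n)
  smul_mul n := map_mul (frob n)

lemma smul_def (n : PhiMon q D) (f : PS k D) : n • f = frob n f := rfl

lemma smul_X (n : PhiMon q D) (d : D) :
    n • (MvPowerSeries.X d : PS k D) = MvPowerSeries.X d ^ q ^ n.exp d := frob_X n d

lemma smul_C (n : PhiMon q D) (a : k) :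
    n • (MvPowerSeries.C a : PS k D) = MvPowerSeries.C a := by
  rw [smul_def]; exact (frob (k := k) n).commutes a

/-- `φ_d` sends `t_D` to a multiple of a power of `t_D` dividing a power of `t_D`. -/
lemma isUnit_frob_tD (n : PhiMon q D) :
    IsUnit (((algebraMap (PS k D) (LS k D)).comp (frob n).toRingHom) (tD k D)) := by
  have ht : IsUnit (algebraMap (PS k D) (LS k D) (tD k D)) :=
    IsLocalization.Away.algebraMap_isUnit _
  have hX : ∀ d : D, IsUnit (algebraMap (PS k D) (LS k D) (MvPowerSeries.X d)) := by
    intro d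
    refine isUnit_of_dvd_unit (map_dvd _ ?_) ht
    exact Finset.dvd_prod_of_mem _ (Finset.mem_univ d)
  have : ((algebraMap (PS k D) (LS k D)).comp (frob n).toRingHom) (tD k D)
      = ∏ d, algebraMap (PS k D) (LS k D) (MvPowerSeries.X d) ^ q ^ n.exp d := by
    change algebraMap (PS k D) (LS k D) (frob n (∏ d, MvPowerSeries.X d)) = _
    rw [map_prod, map_prod]
    exact Finset.prod_congr rfl fun d _ => by rw [frob_X, map_pow]
  rw [this]
  exact Finset.prod_induction _ _ (fun _ _ => IsUnit.mul) isUnit_one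
    (fun d _ => (hX d).pow _)

/-- The endomorphism `φ_d` of `k((t_•))`. -/
def phiLS (k : Type*) [Field k] (q : ℕ) [NeZero q] [DecidableEq D] (d : D) :
    LS k D →+* LS k D :=
  IsLocalization.Away.lift (tD k D) (isUnit_frob_tD (PhiMon.phi q d))

lemma phiLS_algebraMap [DecidableEq D] (d : D) (f : PS k D) :
    phiLS k q d (algebraMap (PS k D) (LS k D) f)
      = algebraMap (PS k D) (LS k D) (PhiMon.phi q d • f) :=
  IsLocalization.Away.lift_eq _ _ _

end Frobenius

/-! ### The action of `Γ_•` through the Lubin-Tate formal group -/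

section Gamma

/-- `Φ` is a Lubin-Tate series for `π` and `q`: `Φ(t) ≡ π t` modulo `t²` and `Φ(t) ≡ t ^ q`
modulo `π`. -/
structure IsLubinTate {O : Type*} [CommRing O] (q : ℕ) (π : O) (Φ : PowerSeries O) : Prop where
  coeff_zero : PowerSeries.coeff 0 Φ = 0
  coeff_one : PowerSeries.coeff 1 Φ = π
  dvd : ∀ n, π ∣ PowerSeries.coeff n (Φ - PowerSeries.X ^ q)

/-- The characterization of multiplication by `a` in the Lubin-Tate formal group of `Φ`:
`f(t) ≡ a t` modulo `t²` and `f(Φ(t)) = Φ(f(t))`. -/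
structure IsMulSeries {O : Type*} [CommRing O] (Φ : PowerSeries O) (a : O)
    (f : PowerSeries O) : Prop where
  coeff_zero : PowerSeries.coeff 0 f = 0
  coeff_one : PowerSeries.coeff 1 f = a
  comm : f.subst Φ = Φ.subst f

open Classical in
/-- The series `[a]_Φ(t)`, i.e. the unique series with `IsMulSeries Φ a` (which exists whenever
`Φ` is a Lubin-Tate series over the ring of integers of a local field; the second branch is
never used in that case). -/
def mulSeries {O : Type*} [CommRing O] (Φ : PowerSeries O) (a : O) : PowerSeries O :=
  if h : ∃ f, IsMulSeries Φ a f then h.choose else PowerSeries.C a * PowerSeries.X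

lemma mulSeries_spec {O : Type*} [CommRing O] {Φ : PowerSeries O} {a : O}
    (h : ∃ f, IsMulSeries Φ a f) : IsMulSeries Φ a (mulSeries Φ a) := by
  rw [mulSeries, dif_pos h]; exact h.choose_spec

lemma coeff_zero_mulSeries {O : Type*} [CommRing O] (Φ : PowerSeries O) (a : O) :
    PowerSeries.coeff 0 (mulSeries Φ a) = 0 := by
  by_cases h : ∃ f, IsMulSeries Φ a f
  · exact (mulSeries_spec h).coeff_zero
  · rw [mulSeries, dif_neg h]; simp

lemma coeff_one_mulSeries {O : Type*} [CommRing O] (Φ : PowerSeries O) (a : O) :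
    PowerSeries.coeff 1 (mulSeries Φ a) = a := by
  by_cases h : ∃ f, IsMulSeries Φ a f
  · exact (mulSeries_spec h).coeff_one
  · rw [mulSeries, dif_neg h]
    simp

variable {O k D : Type*} [CommRing O] [Field k]

/-- The reduction of `[a]_Φ` to `k`, as a power series in the variable `t_d`. -/
def mulSeriesAt (Φ : PowerSeries O) (red : O →+* k) (a : O) (d : D) : PS k D :=
  ((mulSeries Φ a).map red).subst (MvPowerSeries.X d : PS k D)

lemma mulSeriesAt_eq (Φ : PowerSeries O) (red : O →+* k) (a : O) (d : D) :
    ∃ g : PS k D, mulSeriesAt Φ red a d = MvPowerSeries.X d * g ∧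
      MvPowerSeries.constantCoeff g = red a := by
  have hX : PowerSeries.HasSubst (MvPowerSeries.X d : PS k D) := PowerSeries.HasSubst.X d
  obtain ⟨g, hg⟩ : (PowerSeries.X : PowerSeries k) ∣ (mulSeries Φ a).map red := by
    rw [PowerSeries.X_dvd_iff, ← PowerSeries.coeff_zero_eq_constantCoeff_apply,
      PowerSeries.coeff_map, coeff_zero_mulSeries, map_zero]
  refine ⟨g.subst (MvPowerSeries.X d : PS k D), ?_, ?_⟩
  · rw [mulSeriesAt, hg, PowerSeries.subst_mul hX, PowerSeries.subst_X hX]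
  · have h1 : PowerSeries.coeff 0 g = red a := by
      rw [← coeff_one_mulSeries Φ a, ← PowerSeries.coeff_map, hg,
        show (1 : ℕ) = 0 + 1 from rfl, PowerSeries.coeff_succ_X_mul]
    rw [← h1, ← MvPowerSeries.coeff_zero_eq_constantCoeff_apply]
    classical
    rw [PowerSeries.coeff_subst_single]
    simp

variable [Fintype D]

lemma hasSubst_gamma (Φ : PowerSeries O) (red : O →+* k) (γ : D → Oˣ) :
    MvPowerSeries.HasSubst (fun d => mulSeriesAt Φ red (γ d : O) d) :=
  MvPowerSeries.hasSubst_of_constantCoeff_zero fun d => by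
    obtain ⟨g, hg, -⟩ := mulSeriesAt_eq Φ red (γ d : O) d
    rw [hg]; simp

/-- `γ ∈ Γ_• = ∏_d Γ` acts on `k[[t_•]]` as the `k`-algebra endomorphism with
`t_d ↦ [γ_d]_Φ(t_d)`. -/
def gammaPS (Φ : PowerSeries O) (red : O →+* k) (γ : D → Oˣ) : PS k D →ₐ[k] PS k D :=
  MvPowerSeries.substAlgHom (hasSubst_gamma Φ red γ)

lemma gammaPS_X (Φ : PowerSeries O) (red : O →+* k) (γ : D → Oˣ) (d : D) :
    gammaPS Φ red γ (MvPowerSeries.X d : PS k D) = mulSeriesAt Φ red (γ d : O) d :=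
  MvPowerSeries.substAlgHom_X _ _

lemma isUnit_gamma_tD (Φ : PowerSeries O) (red : O →+* k) (γ : D → Oˣ) :
    IsUnit (((algebraMap (PS k D) (LS k D)).comp (gammaPS Φ red γ).toRingHom) (tD k D)) := by
  have ht : IsUnit (algebraMap (PS k D) (LS k D) (tD k D)) :=
    IsLocalization.Away.algebraMap_isUnit _
  have hX : ∀ d : D, IsUnit (algebraMap (PS k D) (LS k D) (MvPowerSeries.X d)) := by
    intro d
    refine isUnit_of_dvd_unit (map_dvd _ ?_) ht
    exact Finset.dvd_prod_of_mem _ (Finset.mem_univ d)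
  have : ((algebraMap (PS k D) (LS k D)).comp (gammaPS Φ red γ).toRingHom) (tD k D)
      = ∏ d, algebraMap (PS k D) (LS k D) (mulSeriesAt Φ red (γ d : O) d) := by
    change algebraMap (PS k D) (LS k D) (gammaPS Φ red γ (∏ d, MvPowerSeries.X d)) = _
    rw [map_prod, map_prod]
    exact Finset.prod_congr rfl fun d _ => by rw [gammaPS_X]
  rw [this]
  refine Finset.prod_induction _ _ (fun _ _ => IsUnit.mul) isUnit_one (fun d _ => ?_)
  obtain ⟨g, hg, hg0⟩ := mulSeriesAt_eq (D := D) Φ red (γ d : O) d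
  rw [hg, map_mul]
  refine (hX d).mul (IsUnit.map _ ?_)
  rw [MvPowerSeries.isUnit_iff_constantCoeff, hg0]
  exact (γ d).isUnit.map red

/-- The endomorphism of `k((t_•))` given by `γ ∈ Γ_•`. -/
def gammaLS (Φ : PowerSeries O) (red : O →+* k) (γ : D → Oˣ) : LS k D →+* LS k D :=
  IsLocalization.Away.lift (tD k D) (isUnit_gamma_tD Φ red γ)

end Gamma

/-! ### `ψ`-operators -/

section Psi

variable {O : Type*} (k D : Type*) [CommRing O] [Field k] [Fintype D] [DecidableEq D]

/-- A `ψ`-operator on `k[[t_•]]`: additive maps `ψ_d` with `ψ_d(φ_d(a) x) = a ψ_d(x)`, commuting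
with the `φ_{d'}` for `d' ≠ d` and with `Γ_•`. -/
structure PsiOperator (q : ℕ) [NeZero q] (Φ : PowerSeries O) (red : O →+* k) where
  psi : D → PS k D →+ PS k D
  psi_phi_mul : ∀ d (a x : PS k D), psi d ((PhiMon.phi q d • a) * x) = a * psi d x
  psi_phi : ∀ d d' (x : PS k D), d ≠ d' →
    psi d (PhiMon.phi q d' • x) = PhiMon.phi q d' • psi d x
  psi_gamma : ∀ d (γ : D → Oˣ) (x : PS k D),
    psi d (gammaPS Φ red γ x) = gammaPS Φ red γ (psi d x)

variable {D}

/-- `k[[t_•]]`, regarded as an algebra over `k[[t_•]]` via `φ_d`. -/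
def PhiPS (_q : ℕ) (_d : D) : Type _ := PS k D

/-- `k((t_•))`, regarded as an algebra over `k((t_•))` via `φ_d`. -/
def PhiLS (_q : ℕ) (_d : D) : Type _ := LS k D

variable (q : ℕ) [NeZero q] (d : D)

instance : CommRing (PhiPS k q d) := inferInstanceAs (CommRing (PS k D))

instance : CommRing (PhiLS k q d) := inferInstanceAs (CommRing (LS k D))

instance : Algebra (PS k D) (PhiPS k q d) :=
  RingHom.toAlgebra (frob (PhiMon.phi q d) : PS k D →ₐ[k] PS k D).toRingHom

instance : Algebra (LS k D) (PhiLS k q d) := RingHom.toAlgebra (phiLS k q d)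

instance : Algebra (PS k D) (PhiLS k q d) :=
  RingHom.toAlgebra ((phiLS k q d).comp (algebraMap (PS k D) (LS k D)))

instance : IsScalarTower (PS k D) (LS k D) (PhiLS k q d) :=
  IsScalarTower.of_algebraMap_eq fun _ => rfl

/-- The identification of elements of `k((t_•))` with elements of its twisted copy. -/
def toPhiLS : LS k D ≃+* PhiLS k q d := RingEquiv.refl _

/-- The inclusion `k[[t_•]] → k((t_•))`, linear for the structures twisted by `φ_d`. -/
def phiIncl : PhiPS k q d →ₗ[PS k D] PhiLS k q d where
  toFun f := algebraMap (PS k D) (LS k D) f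
  map_add' := map_add (algebraMap (PS k D) (LS k D))
  map_smul' a f := by
    have h : algebraMap (PS k D) (LS k D) ((frob (PhiMon.phi q d) a : PS k D) * (show PS k D from f))
      = phiLS k q d (algebraMap (PS k D) (LS k D) a)
        * algebraMap (PS k D) (LS k D) (show PS k D from f) := by
      rw [phiLS_algebraMap, map_mul, smul_def]
    exact h

lemma isUnit_algebraMap_phiLS (x : Submonoid.powers (tD k D)) :
    IsUnit (algebraMap (PS k D) (PhiLS k q d) x) := by
  have h : IsUnit ((phiLS k q d) (algebraMap (PS k D) (LS k D) x)) :=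
    (IsLocalization.map_units (LS k D) x).map _
  exact h

lemma tD_pow_dvd (n : ℕ) : tD k D ^ n ∣ PhiMon.phi q d • (tD k D ^ n) := by
  have h : tD k D ∣ PhiMon.phi q d • tD k D := by
    change (∏ i, MvPowerSeries.X i : PS k D) ∣ frob (PhiMon.phi q d) (∏ i, MvPowerSeries.X i)
    rw [map_prod]
    refine Finset.prod_dvd_prod_of_dvd _ _ fun i _ => ?_
    rw [frob_X]
    exact dvd_pow_self _ (pow_ne_zero _ (NeZero.ne q))
  rw [smul_pow']
  exact pow_dvd_pow_of_dvd h n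

instance : IsLocalizedModule (Submonoid.powers (tD k D)) (phiIncl k q d) where
  map_units x := by
    obtain ⟨u, hu⟩ := isUnit_algebraMap_phiLS k q d x
    rw [Module.End.isUnit_iff]
    have : ∀ y : PhiLS k q d, algebraMap (PS k D) (Module.End (PS k D) (PhiLS k q d)) x y
        = u * y := fun y => by
      rw [Module.algebraMap_end_apply, Algebra.smul_def, hu]
    exact ⟨fun a b hab => by rw [this, this] at hab; exact u.mul_right_inj.mp hab,
      fun b => ⟨↑u⁻¹ * b, by rw [this, ← mul_assoc, Units.mul_inv, one_mul]⟩⟩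
  surj y := by
    obtain ⟨⟨f, s⟩, hs⟩ := IsLocalization.surj (Submonoid.powers (tD k D))
      ((toPhiLS k q d).symm y)
    obtain ⟨n, hn⟩ := s.2
    obtain ⟨g, hg⟩ := tD_pow_dvd k q d n
    refine ⟨(show PS k D from g * f, s), ?_⟩
    have h1 : phiLS k q d (algebraMap (PS k D) (LS k D) s) * (toPhiLS k q d).symm y
        = algebraMap (PS k D) (LS k D) (g * f) := by
      rw [phiLS_algebraMap, map_mul, ← hs, ← hn]
      change algebraMap (PS k D) (LS k D) (PhiMon.phi q d • (tD k D ^ n)) * _ = _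
      rw [hg, map_mul]
      change _ = _ * (_ * algebraMap (PS k D) (LS k D) (tD k D ^ n))
      ring
    exact h1
  exists_of_eq {x y} h := by
    refine ⟨1, ?_⟩
    have h' : algebraMap (PS k D) (LS k D) x = algebraMap (PS k D) (LS k D) y := h
    have hinj : Function.Injective (algebraMap (PS k D) (LS k D)) :=
      IsLocalization.injective (M := Submonoid.powers (tD k D)) _
        (powers_le_nonZeroDivisors_of_noZeroDivisors (tD_ne_zero k D))
    rw [hinj h']

variable {k q} {Φ : PowerSeries O} {red : O →+* k}

/-- `ψ_d` as a `k[[t_•]]`-linear map for the structure twisted by `φ_d` on the source. -/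
def PsiOperator.linPS (Ψ : PsiOperator k D q Φ red) (d : D) : PhiPS k q d →ₗ[PS k D] PS k D where
  toFun := Ψ.psi d
  map_add' := map_add (Ψ.psi d)
  map_smul' a f := Ψ.psi_phi_mul d a f

/-- The unique extension of `ψ_d` to `k((t_•))` with `ψ_d(φ_d(a) x) = a ψ_d(x)`. -/
def PsiOperator.linLS (Ψ : PsiOperator k D q Φ red) (d : D) : PhiLS k q d →ₗ[LS k D] LS k D :=
  (IsLocalizedModule.map (Submonoid.powers (tD k D)) (phiIncl k q d)
    (Algebra.linearMap (PS k D) (LS k D)) (Ψ.linPS d)).extendScalarsOfIsLocalization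
      (Submonoid.powers (tD k D)) (LS k D)

lemma PsiOperator.linLS_algebraMap (Ψ : PsiOperator k D q Φ red) (d : D) (f : PS k D) :
    Ψ.linLS d (toPhiLS k q d (algebraMap (PS k D) (LS k D) f))
      = algebraMap (PS k D) (LS k D) (Ψ.psi d f) :=
  IsLocalizedModule.map_apply (Submonoid.powers (tD k D)) (phiIncl k q d)
    (Algebra.linearMap (PS k D) (LS k D)) (Ψ.linPS d) f

end Psi

/-! ### Étale `(φ_•, Γ_•)`-modules, lattices, `D^♯` and `D^♮` -/

section PhiGamma

variable {O k D : Type*} [CommRing O] [Field k] [Fintype D] [DecidableEq D]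

/-- The linearized structure map `id ⊗ f : k((t_•)) ⊗_{φ_d, k((t_•))} M → M`, `a ⊗ x ↦ a f(x)`,
of a `φ_d`-semilinear map `f`. -/
def linearization (q : ℕ) [NeZero q] (d : D) {M : Type*} [AddCommGroup M] [Module (LS k D) M]
    (f : M →ₛₗ[phiLS k q d] M) : PhiLS k q d ⊗[LS k D] M →+ M :=
  TensorProduct.liftAddHom
    { toFun := fun a =>
        { toFun := fun x => (toPhiLS k q d).symm a • f x
          map_zero' := by simp
          map_add' := fun x y => by simp }
      map_zero' := by ext; simp
      map_add' := fun a b => by ext; simp [add_smul] }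
    (fun r a x => by
      have h : (toPhiLS k q d).symm (r • a) = phiLS k q d r * (toPhiLS k q d).symm a := rfl
      simp [h, mul_smul, smul_comm (phiLS k q d r)])

/-- The structure of an étale `(φ_•, Γ_•)`-module on a `k((t_•))`-module `M`: commuting semilinear
operators `φ_d` and a commuting semilinear action of `Γ_• = ∏_d Γ`, such that `M` is finitely
generated and the linearizations of the `φ_d` are bijective. -/
@[ext]
structure EtalePhiGamma (D : Type*) [Fintype D] [DecidableEq D] (q : ℕ) [NeZero q]
    (Φ : PowerSeries O) (red : O →+* k)
    (M : Type*) [AddCommGroup M] [Module (LS k D) M] where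
  /-- the operators `φ_d` -/
  phi : ∀ d : D, M →ₛₗ[phiLS k q d] M
  /-- the action of `Γ_•` -/
  gam : (D → Oˣ) →* AddMonoid.End M
  phi_comm : ∀ d d' x, phi d (phi d' x) = phi d' (phi d x)
  phi_gam : ∀ d γ x, phi d (gam γ x) = gam γ (phi d x)
  gam_smul : ∀ γ (a : LS k D) x, gam γ (a • x) = gammaLS Φ red γ a • gam γ x
  finite : Module.Finite (LS k D) M
  etale : ∀ d, Function.Bijective (linearization q d (phi d))

namespace EtalePhiGamma

variable {q : ℕ} [NeZero q] {Φ : PowerSeries O} {red : O →+* k}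
  {M : Type*} [AddCommGroup M] [Module (LS k D) M]

/-- `ψ_d` on an étale module: the inverse of `id ⊗ φ_d`, followed by `a ⊗ x ↦ ψ_d(a) x`. -/
def psi (P : EtalePhiGamma D q Φ red M) (Ψ : PsiOperator k D q Φ red) (d : D) :
    AddMonoid.End M :=
  ((TensorProduct.lid (LS k D) M).toLinearMap.comp
      ((Ψ.linLS d).rTensor M)).toAddMonoidHom.comp
    (AddEquiv.ofBijective (linearization q d (P.phi d)) (P.etale d)).symm.toAddMonoidHom

lemma psi_smul_phi (P : EtalePhiGamma D q Φ red M) (Ψ : PsiOperator k D q Φ red) (d : D)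
    (a : LS k D) (x : M) :
    P.psi Ψ d (a • P.phi d x) = Ψ.linLS d (toPhiLS k q d a) • x := by
  have h : (AddEquiv.ofBijective (linearization q d (P.phi d)) (P.etale d)).symm
      (a • P.phi d x) = toPhiLS k q d a ⊗ₜ[LS k D] x := by
    rw [AddEquiv.symm_apply_eq]; rfl
  change TensorProduct.lid (LS k D) M ((Ψ.linLS d).rTensor M
    ((AddEquiv.ofBijective (linearization q d (P.phi d)) (P.etale d)).symm (a • P.phi d x))) = _
  rw [h, LinearMap.rTensor_tmul, TensorProduct.lid_tmul]

/-- `ψ_D = ∏_d ψ_d` (the `ψ_d` commute, so the order of the composition is irrelevant). -/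
def psiD (P : EtalePhiGamma D q Φ red M) (Ψ : PsiOperator k D q Φ red) : AddMonoid.End M :=
  ((Finset.univ : Finset D).toList.map (P.psi Ψ)).prod

end EtalePhiGamma

variable {M : Type*} [AddCommGroup M] [Module (LS k D) M] [Module (PS k D) M]

/-- A lattice in `M`: a finitely generated `k[[t_•]]`-submodule generating `M` over
`k((t_•))`. -/
structure IsLattice (E : Submodule (PS k D) M) : Prop where
  fg : E.FG
  span_eq_top : Submodule.span (LS k D) (E : Set M) = ⊤

variable {q : ℕ} [NeZero q] {Φ : PowerSeries O} {red : O →+* k}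

/-- The properties characterizing `D^♯` among the `k[[t_•]]`-submodules. -/
structure IsSharpCandidate (P : EtalePhiGamma D q Φ red M) (Ψ : PsiOperator k D q Φ red)
    (E : Submodule (PS k D) M) : Prop where
  isLattice : IsLattice E
  psiD_image : P.psiD Ψ '' (E : Set M) = E
  absorbs : ∀ x : M, ∃ n : ℕ, (P.psiD Ψ ^ n) x ∈ E

/-- `S` is `D^♯`, the unique lattice with `ψ_D(D^♯) = D^♯` and such that each `x` satisfies
`ψ_D^n(x) ∈ D^♯` for some `n`. -/
def IsDSharp (P : EtalePhiGamma D q Φ red M) (Ψ : PsiOperator k D q Φ red)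
    (S : Submodule (PS k D) M) : Prop :=
  IsSharpCandidate P Ψ S ∧ ∀ S', IsSharpCandidate P Ψ S' → S' = S

/-- `N` is `D^♮`, the intersection of all lattices contained in `D^♯` and stable under all
`ψ_d`. -/
def IsDNatural (P : EtalePhiGamma D q Φ red M) (Ψ : PsiOperator k D q Φ red)
    (N : Submodule (PS k D) M) : Prop :=
  ∃ S, IsDSharp P Ψ S ∧
    N = sInf {E | IsLattice E ∧ E ≤ S ∧ ∀ d, ∀ x ∈ E, P.psi Ψ d x ∈ E}

end PhiGamma

/-! ### The module `B` and the modules `Δ_𝒟` -/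

section B

/-- `B = ⊕_{C ⊆ D} k e_C`. -/
def BMod (k D : Type*) : Type _ := Finset D → k

variable {k D : Type*} [Field k]

instance : AddCommGroup (BMod k D) := inferInstanceAs (AddCommGroup (Finset D → k))

variable [DecidableEq D]

/-- The basis vector `e_C`. -/
def BMod.e (k : Type*) [Field k] (C : Finset D) : BMod k D := Pi.single C (1 : k)

/-- The exponent of the monomial `∏_{d ∈ S} t_d`. -/
def sqfree (S : Finset D) : D →₀ ℕ := Finsupp.indicator S (fun _ _ => 1)

lemma sqfree_apply (S : Finset D) (d : D) : sqfree S d = if d ∈ S then 1 else 0 := by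
  simp [sqfree, Finsupp.indicator_apply]

lemma support_sqfree (S : Finset D) : (sqfree S).support = S := by
  ext d; simp [sqfree_apply]

lemma sqfree_support_of_le {S : Finset D} {x : D →₀ ℕ} (h : x ≤ sqfree S) :
    sqfree x.support = x := by
  ext d
  have := h d
  rw [sqfree_apply] at this
  simp only [sqfree_apply, Finsupp.mem_support_iff]
  split_ifs at this ⊢ <;> omega

lemma coeff_sqfree_mul (S : Finset D) (f g : PS k D) :
    MvPowerSeries.coeff (sqfree S) (f * g)
      = ∑ U ∈ S.powerset, MvPowerSeries.coeff (sqfree U) f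
          * MvPowerSeries.coeff (sqfree (S \ U)) g := by
  rw [MvPowerSeries.coeff_mul]
  refine Finset.sum_nbij' (fun p => p.1.support) (fun U => (sqfree U, sqfree (S \ U)))
    ?_ ?_ ?_ ?_ ?_
  · rintro ⟨x, y⟩ h
    rw [Finset.HasAntidiagonal.mem_antidiagonal] at h
    dsimp only at h ⊢
    rw [Finset.mem_powerset, ← support_sqfree S, ← h]
    exact Finsupp.support_mono (le_self_add)
  · intro U hU
    rw [Finset.mem_powerset] at hU
    rw [Finset.HasAntidiagonal.mem_antidiagonal]
    ext d
    have := @hU d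
    simp only [Finsupp.add_apply, sqfree_apply, Finset.mem_sdiff]
    by_cases h1 : d ∈ U <;> by_cases h2 : d ∈ S <;> simp_all
  · rintro ⟨x, y⟩ h
    rw [Finset.HasAntidiagonal.mem_antidiagonal] at h
    dsimp only at h ⊢
    have hx : sqfree x.support = x := sqfree_support_of_le (S := S) (h ▸ le_self_add)
    rw [Prod.mk.injEq]
    refine ⟨hx, ?_⟩
    ext d
    have h1 := DFunLike.congr_fun h d
    have h2 := DFunLike.congr_fun hx d
    simp only [Finsupp.add_apply, sqfree_apply, Finset.mem_sdiff, Finsupp.mem_support_iff] at h1 h2 ⊢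
    split_ifs at h1 h2 ⊢ <;> first | omega | simp_all
  · intro U _
    exact support_sqfree U
  · rintro ⟨x, y⟩ h
    rw [Finset.HasAntidiagonal.mem_antidiagonal] at h
    dsimp only at h ⊢
    have hx : sqfree x.support = x := sqfree_support_of_le (S := S) (h ▸ le_self_add)
    have hy : sqfree (S \ x.support) = y := by
      ext d
      have h1 := DFunLike.congr_fun h d
      have h2 := DFunLike.congr_fun hx d
      simp only [Finsupp.add_apply, sqfree_apply, Finset.mem_sdiff, Finsupp.mem_support_iff] at h1 h2 ⊢
      split_ifs at h1 h2 ⊢ <;> first | omega | simp_all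
    rw [hx, hy]

/-- The action of `k[[t_•]]` on `B`: the monomial `∏_{d ∈ S} t_d` maps `e_C` to `e_{C ∪ S}` if
`S ∩ C = ∅`, and all other monomials as well as all pairs with `S ∩ C ≠ ∅` act by zero. -/
instance : Module (PS k D) (BMod k D) where
  smul f b := fun C => ∑ S ∈ C.powerset, MvPowerSeries.coeff (sqfree S) f * b (C \ S)
  one_smul b := by
    funext C
    change ∑ S ∈ C.powerset, MvPowerSeries.coeff (sqfree S) (1 : PS k D) * b (C \ S) = b C
    rw [Finset.sum_eq_single ∅]
    · have : sqfree (∅ : Finset D) = 0 := by ext; simp [sqfree_apply]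
      simp [this]
    · intro S _ hS
      have : sqfree S ≠ 0 := fun h => hS (by rw [← support_sqfree S, h]; rfl)
      rw [MvPowerSeries.coeff_one, if_neg this, zero_mul]
    · simp
  mul_smul f g b := by
    funext C
    change ∑ S ∈ C.powerset, MvPowerSeries.coeff (sqfree S) (f * g) * b (C \ S)
      = ∑ U ∈ C.powerset, MvPowerSeries.coeff (sqfree U) f
        * ∑ V ∈ (C \ U).powerset, MvPowerSeries.coeff (sqfree V) g * b ((C \ U) \ V)
    simp_rw [coeff_sqfree_mul, Finset.sum_mul, Finset.mul_sum]
    rw [Finset.sum_sigma', Finset.sum_sigma']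
    refine Finset.sum_bij' (fun p _ => ⟨p.2, p.1 \ p.2⟩) (fun p _ => ⟨p.1 ∪ p.2, p.1⟩)
      ?_ ?_ ?_ ?_ ?_
    · rintro ⟨S, U⟩ h
      simp only [Finset.mem_sigma, Finset.mem_powerset] at h ⊢
      exact ⟨h.2.trans h.1, Finset.sdiff_subset_sdiff h.1 subset_rfl⟩
    · rintro ⟨U, V⟩ h
      simp only [Finset.mem_sigma, Finset.mem_powerset] at h ⊢
      exact ⟨Finset.union_subset h.1 (h.2.trans Finset.sdiff_subset),
        Finset.subset_union_left⟩
    · rintro ⟨S, U⟩ h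
      simp only [Finset.mem_sigma, Finset.mem_powerset] at h
      simp [Finset.union_sdiff_of_subset h.2]
    · rintro ⟨U, V⟩ h
      simp only [Finset.mem_sigma, Finset.mem_powerset] at h
      have : Disjoint U V := (Finset.disjoint_sdiff (s := U) (t := C)).mono_right h.2
      simp [Finset.union_sdiff_cancel_left this]
    · rintro ⟨S, U⟩ h
      simp only [Finset.mem_sigma, Finset.mem_powerset] at h
      dsimp only
      rw [mul_assoc, Finset.sdiff_sdiff_left', ← Finset.sdiff_union_distrib,
        Finset.union_sdiff_of_subset h.2]
  smul_zero f := by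
    funext C
    change ∑ S ∈ C.powerset, MvPowerSeries.coeff (sqfree S) f * (0 : k) = 0
    simp
  smul_add f a b := by
    funext C
    change ∑ S ∈ C.powerset, MvPowerSeries.coeff (sqfree S) f * (a (C \ S) + b (C \ S)) = _
    simp_rw [mul_add, Finset.sum_add_distrib]
    rfl
  add_smul f g a := by
    funext C
    change ∑ S ∈ C.powerset, MvPowerSeries.coeff (sqfree S) (f + g) * a (C \ S) = _
    simp_rw [map_add, add_mul, Finset.sum_add_distrib]
    rfl
  zero_smul a := by
    funext C
    change ∑ S ∈ C.powerset, MvPowerSeries.coeff (sqfree S) (0 : PS k D) * a (C \ S) = 0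
    simp

lemma BMod.X_smul_e (d : D) (C : Finset D) :
    (MvPowerSeries.X d : PS k D) • BMod.e k C = if d ∈ C then 0 else BMod.e k (insert d C) := by
  have key : ∀ S : Finset D, MvPowerSeries.coeff (sqfree S) (MvPowerSeries.X d : PS k D)
      = if S = {d} then 1 else 0 := by
    intro S
    rw [MvPowerSeries.coeff_X]
    congr 1
    rw [eq_iff_iff]
    constructor
    · intro h
      rw [← support_sqfree S, h]; simp
    · rintro rfl
      ext i
      simp [sqfree_apply, Finsupp.single_apply, eq_comm]
  funext C'
  change ∑ S ∈ C'.powerset, MvPowerSeries.coeff (sqfree S) (MvPowerSeries.X d : PS k D)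
    * (Pi.single C (1 : k) : Finset D → k) (C' \ S) = _
  simp_rw [key, ite_mul, one_mul, zero_mul, Finset.sum_ite_eq', Finset.mem_powerset,
    Finset.singleton_subset_iff]
  by_cases hd : d ∈ C
  · rw [if_pos hd]
    have : C' \ {d} ≠ C := fun h => by rw [← h] at hd; simp at hd
    simp only [Pi.single_apply, if_neg this, ite_self]
    rfl
  · rw [if_neg hd]
    simp only [BMod.e, Pi.single_apply]
    by_cases h : d ∈ C'
    · rw [if_pos h]
      congr 1
      rw [eq_iff_iff]
      constructor
      · intro h'; rw [← h', ← Finset.erase_eq, Finset.insert_erase h]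
      · intro h'; rw [h', ← Finset.erase_eq, Finset.erase_insert hd]
    · rw [if_neg h, if_neg]
      rintro rfl
      exact h (Finset.mem_insert_self _ _)

end B

section Balanced

variable {A R : Type*} [Ring A] [CommRing R] (ι : R →+* A)

/-- The relations `a r ⊗ b = a ⊗ r b` defining `A ⊗_R B` for a (noncommutative) ring `A` with a
ring homomorphism `R → A`. -/
def balancedRel (B : Type*) [AddCommGroup B] [Module R B] : Submodule A (A ⊗[ℤ] B) :=
  Submodule.span A {x | ∃ (a : A) (r : R) (b : B), x = (a * ι r) ⊗ₜ[ℤ] b - a ⊗ₜ[ℤ] (r • b)}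

/-- The left `A`-module `A ⊗_R B`, where `A` is a right `R`-module via `R → A`. -/
def Balanced (B : Type*) [AddCommGroup B] [Module R B] : Type _ := (A ⊗[ℤ] B) ⧸ balancedRel ι B

variable {B B' : Type*} [AddCommGroup B] [Module R B] [AddCommGroup B'] [Module R B']

instance : AddCommGroup (Balanced ι B) :=
  inferInstanceAs (AddCommGroup ((A ⊗[ℤ] B) ⧸ balancedRel ι B))

instance : Module A (Balanced ι B) :=
  inferInstanceAs (Module A ((A ⊗[ℤ] B) ⧸ balancedRel ι B))

/-- The class of `a ⊗ b`. -/
def Balanced.tmul (a : A) (b : B) : Balanced ι B := (balancedRel ι B).mkQ (a ⊗ₜ[ℤ] b)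

/-- The map `id ⊗ f : A ⊗_R B → A ⊗_R B'`. -/
def Balanced.map (f : B →ₗ[R] B') : Balanced ι B →ₗ[A] Balanced ι B' :=
  (balancedRel ι B).mapQ (balancedRel ι B')
    (TensorProduct.AlgebraTensorModule.map LinearMap.id f.toAddMonoidHom.toIntLinearMap) (by
      rw [balancedRel, Submodule.span_le]
      rintro _ ⟨a, r, b, rfl⟩
      refine Submodule.subset_span ⟨a, r, f b, ?_⟩
      simp)

lemma Balanced.map_tmul (f : B →ₗ[R] B') (a : A) (b : B) :
    Balanced.map ι f (Balanced.tmul ι a b) = Balanced.tmul ι a (f b) := rfl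

/-- The quotient of an `A`-module by the submodule generated by a family of elements. -/
def QuotSpan (A : Type*) [Ring A] {N I : Type*} [AddCommGroup N] [Module A N] (r : I → N) :
    Type _ := N ⧸ Submodule.span A (Set.range r)

section QuotSpan

variable {N N' I : Type*} [AddCommGroup N] [Module A N] [AddCommGroup N'] [Module A N']
  (r : I → N) (r' : I → N')

instance : AddCommGroup (QuotSpan A r) :=
  inferInstanceAs (AddCommGroup (N ⧸ Submodule.span A (Set.range r)))

instance : Module A (QuotSpan A r) :=
  inferInstanceAs (Module A (N ⧸ Submodule.span A (Set.range r)))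

/-- The projection to the quotient. -/
def QuotSpan.mk : N →ₗ[A] QuotSpan A r := (Submodule.span A (Set.range r)).mkQ

/-- The map of quotients induced by a map that respects the generators. -/
def QuotSpan.map (f : N →ₗ[A] N') (h : ∀ i, f (r i) = r' i) : QuotSpan A r →ₗ[A] QuotSpan A r' :=
  Submodule.mapQ _ _ f (by
    rw [Submodule.span_le]
    rintro _ ⟨i, rfl⟩
    exact Submodule.subset_span ⟨i, (h i).symm⟩)

lemma QuotSpan.map_mk (f : N →ₗ[A] N') (h : ∀ i, f (r i) = r' i) (x : N) :
    QuotSpan.map r r' f h (QuotSpan.mk r x) = QuotSpan.mk r' (f x) := rfl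

end QuotSpan

end Balanced

section Delta

/-- A set `𝒟` of nonempty subsets of `D` that is closed under passing to larger subsets. -/
@[ext]
structure Family (D : Type*) where
  carrier : Set (Finset D)
  upper : ∀ C ∈ carrier, ∀ C', C ⊆ C' → C' ∈ carrier
  empty_notMem : ∅ ∉ carrier

/-- The empty family. -/
def Family.bot (D : Type*) : Family D := ⟨∅, by simp, by simp⟩

/-- The family of all nonempty subsets. -/
def Family.top (D : Type*) : Family D :=
  ⟨{C | C.Nonempty}, fun _ h _ h' => Finset.Nonempty.mono h' h, by simp⟩

variable {k D : Type*} [Field k] [Fintype D] [DecidableEq D]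

/-- `B_𝒟 = B / ∑_{C ∈ 𝒟} k e_C`; as `𝒟` is closed under passing to larger subsets, the
`k`-span of the `e_C`, `C ∈ 𝒟`, coincides with their `k[[t_•]]`-span. -/
abbrev BD (k : Type*) [Field k] (𝒟 : Family D) : Type _ :=
  BMod k D ⧸ Submodule.span (PS k D) (BMod.e k '' 𝒟.carrier)

/-- The projection `B_𝒟 → B_𝒟'` for `𝒟 ⊆ 𝒟'`. -/
def BD.proj {𝒟 𝒟' : Family D} (h : 𝒟.carrier ⊆ 𝒟'.carrier) :
    BD k 𝒟 →ₗ[PS k D] BD k 𝒟' :=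
  Submodule.factor (Submodule.span_mono (Set.image_mono h))

variable (q : ℕ) [NeZero q]

/-- The twisted polynomial ring `k[[t_•]][φ_•]`, with `φ_d f = φ_d(f) φ_d` for `f ∈ k[[t_•]]`. -/
abbrev Tw (k D : Type*) [Field k] [Fintype D] : Type _ := SkewMonoidAlgebra (PS k D) (PhiMon q D)

/-- The inclusion `k[[t_•]] → k[[t_•]][φ_•]`. -/
def Tw.incl (k D : Type*) [Field k] [Fintype D] : PS k D →+* Tw q k D where
  toFun f := SkewMonoidAlgebra.single 1 f
  map_one' := rfl
  map_mul' f g := by simp [SkewMonoidAlgebra.single_mul_single]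
  map_zero' := by simp
  map_add' f g := by simp [SkewMonoidAlgebra.single_add]

/-- The element `φ_d` of `k[[t_•]][φ_•]`. -/
def Tw.phi (k : Type*) [Field k] (d : D) : Tw q k D :=
  SkewMonoidAlgebra.single (PhiMon.phi q d) 1

lemma Tw.phi_mul_incl (d : D) (f : PS k D) :
    Tw.phi q k d * Tw.incl q k D f = Tw.incl q k D (PhiMon.phi q d • f) * Tw.phi q k d := by
  simp [Tw.phi, Tw.incl, SkewMonoidAlgebra.single_mul_single]

/-- `k[[t_•]][φ_•] ⊗_{k[[t_•]]} B_𝒟`. -/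
abbrev IndB (k : Type*) [Field k] (𝒟 : Family D) : Type _ := Balanced (Tw.incl q k D) (BD k 𝒟)

/-- The class of `a ⊗ e_C`. -/
def IndB.tmulE (𝒟 : Family D) (a : Tw q k D) (C : Finset D) : IndB q k 𝒟 :=
  Balanced.tmul _ a (Submodule.Quotient.mk (BMod.e k C))

/-- The element `t_d^(q-1) φ_d ⊗ e_∅ - 1 ⊗ c_d e_∅`. -/
def deltaRelation (c : D → kˣ) (𝒟 : Family D) (d : D) : IndB q k 𝒟 :=
  IndB.tmulE q 𝒟 (Tw.incl q k D (MvPowerSeries.X d ^ (q - 1)) * Tw.phi q k d) ∅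
    - IndB.tmulE q 𝒟 (Tw.incl q k D (MvPowerSeries.C (c d : k))) ∅

/-- The `k[[t_•]][φ_•]`-module `Δ_𝒟 = Δ_𝒟(c_•)`: the quotient of
`k[[t_•]][φ_•] ⊗_{k[[t_•]]} B_𝒟` by the `k[[t_•]][φ_•]`-submodule generated by the elements
`t_d^(q-1) φ_d ⊗ e_∅ - 1 ⊗ c_d e_∅`. -/
def Delta (c : D → kˣ) (𝒟 : Family D) : Type _ := QuotSpan (Tw q k D) (deltaRelation q c 𝒟)

variable (c : D → kˣ) (𝒟 : Family D)

instance : AddCommGroup (Delta q c 𝒟) :=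
  inferInstanceAs (AddCommGroup (QuotSpan (Tw q k D) (deltaRelation q c 𝒟)))

instance : Module (Tw q k D) (Delta q c 𝒟) :=
  inferInstanceAs (Module (Tw q k D) (QuotSpan (Tw q k D) (deltaRelation q c 𝒟)))

instance : Module (PS k D) (Delta q c 𝒟) := Module.compHom _ (Tw.incl q k D)

instance : Module k (Delta q c 𝒟) := Module.compHom _ (MvPowerSeries.C : k →+* PS k D)

lemma Delta.smul_eq (f : PS k D) (x : Delta q c 𝒟) : f • x = Tw.incl q k D f • x := rfl

lemma Delta.smul_eq' (a : k) (x : Delta q c 𝒟) : a • x = (MvPowerSeries.C a : PS k D) • x := rfl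

/-- The class of `1 ⊗ e_C` in `Δ_𝒟`. -/
def Delta.e (C : Finset D) : Delta q c 𝒟 :=
  QuotSpan.mk (A := Tw q k D) (deltaRelation q c 𝒟) (IndB.tmulE q 𝒟 1 C)

/-- The operator `φ_d` on `Δ_𝒟`. -/
def Delta.phi (d : D) : Delta q c 𝒟 →ₗ[k] Delta q c 𝒟 where
  toFun x := Tw.phi q k d • x
  map_add' := smul_add _
  map_smul' a x := by
    rw [RingHom.id_apply, Delta.smul_eq', Delta.smul_eq', Delta.smul_eq, Delta.smul_eq,
      ← mul_smul, ← mul_smul, Tw.phi_mul_incl, smul_C]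

variable {𝒟}

lemma BD.proj_mk {𝒟' : Family D} (h : 𝒟.carrier ⊆ 𝒟'.carrier) (b : BMod k D) :
    BD.proj h (Submodule.Quotient.mk b : BD k 𝒟) = (Submodule.Quotient.mk b : BD k 𝒟') := rfl

lemma IndB.map_tmulE {𝒟' : Family D} (h : 𝒟.carrier ⊆ 𝒟'.carrier) (a : Tw q k D)
    (C : Finset D) : Balanced.map (Tw.incl q k D) (BD.proj h) (IndB.tmulE q 𝒟 a C)
      = IndB.tmulE q 𝒟' a C := by
  rw [IndB.tmulE, Balanced.map_tmul, BD.proj_mk, IndB.tmulE]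

lemma map_deltaRelation {𝒟' : Family D} (h : 𝒟.carrier ⊆ 𝒟'.carrier) (d : D) :
    Balanced.map (Tw.incl q k D) (BD.proj h) (deltaRelation q c 𝒟 d)
      = deltaRelation q c 𝒟' d := by
  rw [deltaRelation, map_sub, IndB.map_tmulE, IndB.map_tmulE, deltaRelation]

/-- The projection `Δ_𝒟 → Δ_𝒟'` induced by `B_𝒟 → B_𝒟'` for `𝒟 ⊆ 𝒟'`. -/
def Delta.proj {𝒟' : Family D} (h : 𝒟.carrier ⊆ 𝒟'.carrier) :
    Delta q c 𝒟 →ₗ[Tw q k D] Delta q c 𝒟' :=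
  QuotSpan.map _ _ (Balanced.map (Tw.incl q k D) (BD.proj h)) (map_deltaRelation q c h)

lemma Delta.proj_e {𝒟' : Family D} (h : 𝒟.carrier ⊆ 𝒟'.carrier) (C : Finset D) :
    Delta.proj q c h (Delta.e q c 𝒟 C) = Delta.e q c 𝒟' C :=
  (QuotSpan.map_mk (A := Tw q k D) (deltaRelation q c 𝒟) (deltaRelation q c 𝒟') _
    (map_deltaRelation q c h) _).trans
    (congrArg (QuotSpan.mk (A := Tw q k D) (deltaRelation q c 𝒟')) (IndB.map_tmulE q h 1 C))

variable (𝒟)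

/-- A `k[[t_•]]`-module `N` is admissible if it is torsion over `k[[t_d]]` for every `d`, and if
`{x ∈ N | t_d x = 0 for all d}` is finite dimensional over `k`. -/
structure IsAdmissible (k D : Type*) [Field k] (N : Type*) [AddCommGroup N] [Module (PS k D) N] [Module k N] : Prop where
  torsion : ∀ (d : D) (x : N), ∃ f : PowerSeries k, f ≠ 0 ∧
    (f.subst (MvPowerSeries.X d : PS k D)) • x = 0
  finite : ∃ V : Submodule k N, FiniteDimensional k V ∧
    ∀ x : N, (∀ d : D, (MvPowerSeries.X d : PS k D) • x = 0) → x ∈ V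

/-- The dual `Δ_𝒟^* = Hom_k(Δ_𝒟, k)`. -/
def DeltaDual : Type _ := Module.Dual k (Delta q c 𝒟)

instance : AddCommGroup (DeltaDual q c 𝒟) :=
  inferInstanceAs (AddCommGroup (Module.Dual k (Delta q c 𝒟)))

variable {q c 𝒟}

/-- The linear form underlying an element of `Δ_𝒟^*`. -/
def DeltaDual.toDual (l : DeltaDual q c 𝒟) : Delta q c 𝒟 →ₗ[k] k := l

/-- A linear form, as an element of `Δ_𝒟^*`. -/
def DeltaDual.ofDual (l : Delta q c 𝒟 →ₗ[k] k) : DeltaDual q c 𝒟 := l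

/-- Multiplication by `f ∈ k[[t_•]]` on `Δ_𝒟` as a `k`-linear map. -/
def Delta.mulLeft (f : PS k D) : Delta q c 𝒟 →ₗ[k] Delta q c 𝒟 where
  toFun x := f • x
  map_add' := smul_add _
  map_smul' a x := by
    rw [RingHom.id_apply, Delta.smul_eq', Delta.smul_eq', smul_comm]

/-- The action of `k[[t_•]]` on `Δ_𝒟^*` given by `(f l)(x) = l(f x)`. -/
instance : Module (PS k D) (DeltaDual q c 𝒟) where
  smul f l := .ofDual (l.toDual ∘ₗ Delta.mulLeft f)
  one_smul l := LinearMap.ext fun x => congrArg l.toDual (one_smul _ x)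
  mul_smul f g l := LinearMap.ext fun x => congrArg l.toDual (by
    change (f * g) • x = g • f • x
    rw [mul_comm, mul_smul])
  smul_zero f := LinearMap.ext fun x => rfl
  smul_add f l l' := LinearMap.ext fun x => rfl
  add_smul f g l := LinearMap.ext fun x => (congrArg l.toDual (add_smul f g x)).trans
    (map_add l.toDual _ _)
  zero_smul l := LinearMap.ext fun x => (congrArg l.toDual (zero_smul _ x)).trans
    (map_zero l.toDual)

/-- The `k[[t_•]]`-linear map `Δ_𝒟'^* → Δ_𝒟^*` dual to the projection `Δ_𝒟 → Δ_𝒟'`. -/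
def DeltaDual.incl {𝒟' : Family D} (h : 𝒟.carrier ⊆ 𝒟'.carrier) :
    DeltaDual q c 𝒟' →ₗ[PS k D] DeltaDual q c 𝒟 where
  toFun l := .ofDual
    { toFun := fun x => l.toDual (Delta.proj q c h x)
      map_add' := fun x y => by rw [map_add, map_add]
      map_smul' := fun a x => by
        rw [RingHom.id_apply, ← map_smul, Delta.smul_eq', Delta.smul_eq', Delta.smul_eq,
          Delta.smul_eq, map_smul] }
  map_add' l l' := LinearMap.ext fun x => rfl
  map_smul' f l := LinearMap.ext fun x => congrArg l.toDual (by
    change f • Delta.proj q c h x = Delta.proj q c h (f • x)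
    rw [Delta.smul_eq, Delta.smul_eq, map_smul])

variable (q c 𝒟)

/-- `D_𝒟 = Δ_𝒟^* ⊗_{k[[t_•]]} k((t_•))` (with the tensor factors interchanged). -/
abbrev DD : Type _ := LS k D ⊗[PS k D] DeltaDual q c 𝒟

/-- The natural map `Δ_𝒟^* → D_𝒟`. -/
def DD.of : DeltaDual q c 𝒟 →ₗ[PS k D] DD q c 𝒟 := TensorProduct.mk (PS k D) (LS k D) _ 1

/-- The map `D_𝒟' → D_𝒟` obtained from `Δ_𝒟'^* → Δ_𝒟^*` by base change. -/
def DD.map {𝒟 𝒟' : Family D} (h : 𝒟.carrier ⊆ 𝒟'.carrier) :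
    DD q c 𝒟' →ₗ[LS k D] DD q c 𝒟 :=
  (DeltaDual.incl h).baseChange (LS k D)

/-- `Δ_𝒟^*` as a `k[[t_•]]`-submodule of `D = D_∅`. -/
def DD.lattice : Submodule (PS k D) (DD q c (Family.bot D)) :=
  LinearMap.range (DD.of q c (Family.bot D) ∘ₗ
    DeltaDual.incl (𝒟 := Family.bot D) (𝒟' := 𝒟) (Set.empty_subset _))

variable {O : Type*} [CommRing O] (Φ : PowerSeries O) (red : O →+* k)

/-- The scalar by which `γ ∈ Γ_•` acts on `e_C`: the product over `d` of `γ_d ^ (m_d + 1)` if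
`d ∈ C`, and of `γ_d ^ m_d` if `d ∉ C`, where `γ_d ∈ Γ` is mapped to `kˣ`. -/
def gammaScalar (m : D → ZMod (q - 1)) (γ : D → Oˣ) (C : Finset D) : k :=
  ∏ d, red (γ d : O) ^ ((m d).val + if d ∈ C then 1 else 0)

/-- `ρ` is the action of `Γ_•` that makes `Δ_𝒟` a `k[[t_•]][φ_•, Γ_•]`-module: it is semilinear
over `k[[t_•]]`, commutes with the `φ_d`, and extends the given action on the `e_C`. -/
structure IsGammaAction (m : D → ZMod (q - 1))
    (ρ : (D → Oˣ) →* Module.End k (Delta q c 𝒟)) : Prop where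
  smul : ∀ γ (f : PS k D) x, ρ γ (f • x) = gammaPS Φ red γ f • ρ γ x
  phi : ∀ γ d x, ρ γ (Delta.phi q c 𝒟 d x) = Delta.phi q c 𝒟 d (ρ γ x)
  e : ∀ γ C, ρ γ (Delta.e q c 𝒟 C) = gammaScalar q red m γ C • Delta.e q c 𝒟 C

variable {q c 𝒟 Φ red}

/-- `P` is the étale `(φ_•, Γ_•)`-module structure on `D_𝒟` attached to `Δ_𝒟`: the action of
`Γ_•` is given on `Δ_𝒟^*` by `(γ l)(x) = l(γ⁻¹ x)`, and `ψ_d` is given on `Δ_𝒟^*` by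
`l ↦ l ∘ φ_d`. -/
structure IsAttached (Ψ : PsiOperator k D q Φ red)
    (ρ : (D → Oˣ) →* Module.End k (Delta q c 𝒟))
    (P : EtalePhiGamma D q Φ red (DD q c 𝒟)) : Prop where
  gam : ∀ γ (l : DeltaDual q c 𝒟),
    P.gam γ (DD.of q c 𝒟 l) = DD.of q c 𝒟 (.ofDual (l.toDual ∘ₗ ρ γ⁻¹))
  psi : ∀ d (l : DeltaDual q c 𝒟),
    P.psi Ψ d (DD.of q c 𝒟 l) = DD.of q c 𝒟 (.ofDual (l.toDual ∘ₗ Delta.phi q c 𝒟 d))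

end Delta

section LocalField

open ValuativeRel

/-- The map from the ring of integers of `F` through its residue field to the extension `k`. -/
def residueMap (F k : Type*) [Field F] [ValuativeRel F] [TopologicalSpace F]
    [IsNonarchimedeanLocalField F] [Field k] [Algebra 𝓀[F] k] : 𝒪[F] →+* k :=
  (algebraMap 𝓀[F] k).comp (IsLocalRing.residue 𝒪[F])

end LocalField

end

end PsiLattice

namespace PsiLattice

open scoped TensorProduct

noncomputable section

/-! ### Lubin-Tate series -/

section LubinTate

open PowerSeries

variable {O : Type*} [CommRing O]

/-! Everything becomes explicit in a monomial basis of Δ_𝒟. Because t_d^(q-1) φ_d e_∅ = c_d e_∅, the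
element x_i = c^(-n) t^(q^n - i) φ^n e_∅ depends only on i ∈ ℕ^D, not on the choice of n with i ≤
q^n (`Delta.smul_phiEnd_mul`). These elements behave like inverse monomials: t^j x_i is x_(i-j) if j
≤ i and 0 otherwise, and φ^n x_i = c^n x_(q^n i) (`Delta.mon_smul_x`, `Delta.X_pow_smul_x_eq_zero`,
`Delta.phiEnd_x`). Moreover e_C = x_(1-C), and x_i = 0 as soon as {d | i_d = 0} lies in 𝒟. There are
no further relations: the universal property `Delta.exists_lift` yields a map from Δ_𝒟 to linear
forms on the ideal `famIdeal k 𝒟` which sends x_i to "coefficient at i" (`Delta.exists_dual`).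

Dually, l ↦ ∑ l(x_i) t^i identifies Δ_𝒟^* with this ideal, and l ↦ l ∘ φ_d becomes c_d times the
standard ψ-operator `psiCan`. All these ideals contain t_D, so they agree after inverting t_D, and
monomials distinguish them.

For Γ_•, the condition on the t²-coefficient of Φ kills the t²-coefficient of [γ]_Φ in k. Hence
γ(t_d) ≡ γ_d t_d modulo t_d³ and γ(t_d)^(q-1) ≡ t_d^(q-1) modulo t_d^(q+1). As t_d² e_∅ = 0, the
defining relations are preserved, and the universal property provides the action.

For the étale structure, a surjective ψ_d differs from `psiCan` by a unit u_d of k((t_•)) which the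
other φ_(d') fix (`PsiOperator.exists_unit`). The operator x ↦ φ_d(x) u_d then has the required ψ_d.
Its commutation with Γ_•, and the uniqueness of the structure, come from the nondegeneracy statement
`eq_zero_of_psiCan_mul_eq_zero`.

In these coordinates ψ_D reduces poles along t_D and fixes the line through 1. This forces D^♯ =
k[[t_•]]. Since ψ_D^N maps t_D^(q^N) to a nonzero scalar multiple of t_D, every ψ-stable lattice in
D^♯ contains t_D, and D^♮ = t_D k[[t_•]]. -/

lemma X_pow_dvd_subst_sub {n : ℕ} {f g : PowerSeries O} (hf : constantCoeff f = 0)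
    (hg : constantCoeff g = 0) (h : PowerSeries.X ^ n ∣ f - g) (F : PowerSeries O) :
    PowerSeries.X ^ n ∣ F.subst f - F.subst g := by
  rw [PowerSeries.X_pow_dvd_iff]
  intro m hm
  rw [map_sub, coeff_subst' (HasSubst.of_constantCoeff_zero' hf),
    coeff_subst' (HasSubst.of_constantCoeff_zero' hg), sub_eq_zero]
  refine finsum_congr fun d => ?_
  congr 1
  rw [← sub_eq_zero, ← map_sub]
  exact (PowerSeries.X_pow_dvd_iff.mp (h.trans (sub_dvd_pow_sub_pow f g d))) m hm

/-- With F = a₀ + a₁X + X²A, only the linear term contributes in degree n: as f and g have no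
constant term, f²A(f) - g²A(g) gains a factor X over f - g. -/
lemma coeff_subst_sub {n : ℕ} {f g : PowerSeries O} (hf : constantCoeff f = 0)
    (hg : constantCoeff g = 0) (h : PowerSeries.X ^ n ∣ f - g) (F : PowerSeries O) :
    coeff n (F.subst f - F.subst g) = coeff 1 F * coeff n (f - g) := by
  have hf' := HasSubst.of_constantCoeff_zero' hf
  have hg' := HasSubst.of_constantCoeff_zero' hg
  obtain ⟨A, hA⟩ : ∃ A : PowerSeries O,
      F = C (constantCoeff F) + PowerSeries.X * (C (coeff 1 F) + PowerSeries.X * A) := by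
    refine ⟨PowerSeries.mk fun m => coeff (m + 2) F, ?_⟩
    ext m
    rcases m with _ | _ | m
    · simp
    · simp [PowerSeries.coeff_succ_X_mul]
    · simp [PowerSeries.coeff_succ_X_mul]
  have key : ∀ f : PowerSeries O, HasSubst f →
      F.subst f = C (constantCoeff F) + (f * C (coeff 1 F) + f ^ 2 * A.subst f) := by
    intro f hf
    conv_lhs => rw [hA]
    rw [subst_add hf, subst_mul hf, subst_add hf, subst_mul hf, subst_X hf]
    have e : ∀ a : O, (C a : PowerSeries O).subst f = C a := fun a => subst_C a
    rw [e, e]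
    ring
  have hX : ∀ {f : PowerSeries O}, constantCoeff f = 0 → PowerSeries.X ∣ f :=
    fun hf => PowerSeries.X_dvd_iff.mpr hf
  have h1 : PowerSeries.X ^ (n + 1) ∣ f ^ 2 * A.subst f - g ^ 2 * A.subst g := by
    have : f ^ 2 * A.subst f - g ^ 2 * A.subst g
        = (f - g) * (f + g) * A.subst f + (A.subst f - A.subst g) * g * g := by ring
    rw [this, pow_succ]
    refine dvd_add (Dvd.dvd.mul_right (mul_dvd_mul h (dvd_add (hX hf) (hX hg))) _)
      (Dvd.dvd.mul_right (mul_dvd_mul (X_pow_dvd_subst_sub hf hg h A) (hX hg)) _)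
  rw [key f hf', key g hg']
  have h2 : C (constantCoeff F) + (f * C (coeff 1 F) + f ^ 2 * A.subst f)
      - (C (constantCoeff F) + (g * C (coeff 1 F) + g ^ 2 * A.subst g))
      = (f - g) * C (coeff 1 F) + (f ^ 2 * A.subst f - g ^ 2 * A.subst g) := by ring
  rw [h2, map_add, PowerSeries.coeff_mul_C,
    PowerSeries.X_pow_dvd_iff.mp h1 n (Nat.lt_succ_self n), add_zero, mul_comm]

/-- If f - g = X^n u and F = X w, the difference after substitution is X^n w^n u(F), with lowest
coefficient w(0)^n u(0). -/
lemma coeff_sub_subst {n : ℕ} {f g F : PowerSeries O} (hF : constantCoeff F = 0)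
    (h : PowerSeries.X ^ n ∣ f - g) :
    coeff n (f.subst F - g.subst F) = coeff 1 F ^ n * coeff n (f - g) := by
  have hF' := HasSubst.of_constantCoeff_zero' hF
  obtain ⟨u, hu⟩ := h
  obtain ⟨w, rfl⟩ : PowerSeries.X ∣ F := PowerSeries.X_dvd_iff.mpr hF
  rw [← subst_sub hF', hu, subst_mul hF', subst_pow hF', subst_X hF', mul_pow, mul_assoc]
  have h1 : ∀ v : PowerSeries O, coeff n (PowerSeries.X ^ n * v) = constantCoeff v := by
    intro v
    have := PowerSeries.coeff_X_pow_mul v n 0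
    rwa [zero_add, PowerSeries.coeff_zero_eq_constantCoeff_apply] at this
  have h2 : constantCoeff (u.subst (PowerSeries.X * w)) = constantCoeff u := by
    have : PowerSeries.X ∣ u - C (constantCoeff u) := by
      rw [PowerSeries.X_dvd_iff]; simp
    obtain ⟨v, hv⟩ := this
    rw [sub_eq_iff_eq_add] at hv
    conv_lhs => rw [hv]
    rw [subst_add hF', subst_mul hF', subst_X hF']
    have e : ∀ a : O, (C a : PowerSeries O).subst (PowerSeries.X * w) = C a := fun a => subst_C a
    rw [e]
    simp
  have h3 : coeff 1 (PowerSeries.X * w) = constantCoeff w := by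
    rw [show (1 : ℕ) = 0 + 1 from rfl, PowerSeries.coeff_succ_X_mul,
      PowerSeries.coeff_zero_eq_constantCoeff_apply]
  rw [h1, h1, map_mul, map_pow, h2, h3]

/-- The defect of commutation of `f` with `Φ`. -/
def commDefect (Φ f : PowerSeries O) : PowerSeries O := f.subst Φ - Φ.subst f

variable {Φ : PowerSeries O}

lemma X_pow_dvd_commDefect_sub (hΦ : constantCoeff Φ = 0) {n : ℕ} {f g : PowerSeries O}
    (hf : constantCoeff f = 0) (hg : constantCoeff g = 0) (h : PowerSeries.X ^ n ∣ f - g) :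
    PowerSeries.X ^ n ∣ commDefect Φ f - commDefect Φ g := by
  have hΦ' := HasSubst.of_constantCoeff_zero' hΦ
  have e : commDefect Φ f - commDefect Φ g
      = (f - g).subst Φ - (Φ.subst f - Φ.subst g) := by
    rw [subst_sub hΦ', commDefect, commDefect]; ring
  rw [e]
  refine dvd_sub ?_ (X_pow_dvd_subst_sub hf hg h Φ)
  obtain ⟨u, hu⟩ := h
  rw [hu, subst_mul hΦ', subst_pow hΦ', subst_X hΦ']
  exact Dvd.dvd.mul_right (pow_dvd_pow_of_dvd (PowerSeries.X_dvd_iff.mpr hΦ) n) _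

/-- The engine of the successive approximation: with π = `coeff 1 Φ`, a change of f in degree n
moves the defect in degree n by the factor π^n - π, which for n ≥ 2 is -π times the factor 1 -
π^(n-1). -/
lemma coeff_commDefect_sub (hΦ : constantCoeff Φ = 0) {n : ℕ} {f g : PowerSeries O}
    (hf : constantCoeff f = 0) (hg : constantCoeff g = 0) (h : PowerSeries.X ^ n ∣ f - g) :
    coeff n (commDefect Φ f) - coeff n (commDefect Φ g)
      = (coeff 1 Φ ^ n - coeff 1 Φ) * (coeff n f - coeff n g) := by
  have h1 := coeff_subst_sub hf hg h Φ
  have h2 := coeff_sub_subst hΦ h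
  simp only [map_sub, commDefect] at h1 h2 ⊢
  linear_combination h2 - h1

lemma isMulSeries_iff {a : O} {f : PowerSeries O} :
    IsMulSeries Φ a f ↔ constantCoeff f = 0 ∧ coeff 1 f = a ∧ commDefect Φ f = 0 := by
  rw [commDefect, sub_eq_zero]
  rw [← PowerSeries.coeff_zero_eq_constantCoeff_apply]
  exact ⟨fun h => ⟨h.coeff_zero, h.coeff_one, h.comm⟩, fun h => ⟨h.1, h.2.1, h.2.2⟩⟩

lemma X_pow_succ_dvd_iff {n : ℕ} {f : PowerSeries O} (h : PowerSeries.X ^ n ∣ f) :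
    PowerSeries.X ^ (n + 1) ∣ f ↔ coeff n f = 0 := by
  rw [PowerSeries.X_pow_dvd_iff] at h ⊢
  refine ⟨fun h' => h' n (Nat.lt_succ_self n), fun h' m hm => ?_⟩
  rcases Nat.lt_succ_iff_lt_or_eq.mp hm with hm | rfl
  · exact h m hm
  · exact h'

lemma X_sq_dvd_sub {a : O} {f g : PowerSeries O} (hf : constantCoeff f = 0)
    (hf1 : coeff 1 f = a) (hg : constantCoeff g = 0) (hg1 : coeff 1 g = a) :
    PowerSeries.X ^ 2 ∣ f - g := by
  rw [PowerSeries.X_pow_dvd_iff]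
  intro m hm
  interval_cases m
  · simp [hf, hg]
  · simp [hf1, hg1]

/-- The ring homomorphism `r : O → κ` has the features of the projection of a discrete valuation
ring with uniformizer `π` to its residue field with `q` elements which the theory of Lubin-Tate
series needs. -/
structure IsLubinTateBase {O κ : Type*} [CommRing O] [Field κ] (q : ℕ) (π : O)
    (r : O →+* κ) : Prop where
  isUnit : ∀ n, n ≠ 0 → IsUnit (1 - π ^ n)
  regular : IsLeftRegular π
  map_eq_zero : ∀ x, r x = 0 ↔ π ∣ x
  card : Nat.card κ = q
  finite : Finite κ

lemma subst_X_pow_card {κ : Type*} [Field κ] [Finite κ] (f : PowerSeries κ) :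
    f.subst (PowerSeries.X ^ Nat.card κ : PowerSeries κ) = f ^ Nat.card κ := by
  have := Fintype.ofFinite κ
  obtain ⟨p, hp, n, hprime, hcard⟩ := FiniteField.card' κ
  have : ExpChar κ p := ExpChar.prime hprime
  rw [Nat.card_eq_fintype_card, hcard]
  have h := MvPowerSeries.map_iterateFrobenius_expand p hprime.ne_zero f n
  have h1 : iterateFrobenius κ p n = RingHom.id κ := by
    ext x
    rw [iterateFrobenius_def, ← hcard, FiniteField.pow_card, RingHom.id_apply]
  rw [h1, MvPowerSeries.map_id, RingHom.id_apply] at h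
  exact (PowerSeries.expand_apply (p ^ (n : ℕ)) (pow_ne_zero n hprime.ne_zero) f).symm.trans h

/-- The identity f(X^q) = f(X)^q holds over the field κ with q elements, where Frobenius fixes all
coefficients. It is transported along `j`, so S itself may be larger. -/
lemma map_subst_pow_card {κ S : Type*} [Field κ] [Finite κ] [CommRing S] (j : κ →+* S)
    (f : PowerSeries κ) {τ : Type*} {a : MvPowerSeries τ S} (ha : HasSubst a) :
    (f.map j).subst (a ^ Nat.card κ) = (f.map j).subst a ^ Nat.card κ := by
  have hq : Nat.card κ ≠ 0 := Nat.card_pos.ne'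
  have hX : HasSubst (PowerSeries.X ^ Nat.card κ : PowerSeries κ) := HasSubst.X_pow hq
  have hX' : HasSubst (PowerSeries.X ^ Nat.card κ : PowerSeries S) := HasSubst.X_pow hq
  have h1 : (f.map j).subst (PowerSeries.X ^ Nat.card κ : PowerSeries S)
      = f.map j ^ Nat.card κ := by
    rw [← map_pow, ← subst_X_pow_card f, ← PowerSeries.expand_apply _ hq,
      ← PowerSeries.expand_apply _ hq, PowerSeries.map_expand]
  have h2 : (PowerSeries.X ^ Nat.card κ : PowerSeries S).subst a = a ^ Nat.card κ := by
    rw [subst_pow ha, subst_X ha]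
  rw [← subst_pow ha, ← h1, subst_comp_subst_apply hX' ha, h2]

variable {κ : Type*} [Field κ] {q : ℕ} {π : O} {r : O →+* κ}

lemma IsLubinTate.constantCoeff (hΦ : IsLubinTate q π Φ) : PowerSeries.constantCoeff Φ = 0 := by
  rw [← PowerSeries.coeff_zero_eq_constantCoeff_apply, hΦ.coeff_zero]

/-! ### Existence, uniqueness and multiplicativity of the series [a]_Φ. -/

section

variable (hO : IsLubinTateBase q π r) (hΦ : IsLubinTate q π Φ)
include hO hΦ

lemma map_isLubinTate : Φ.map r = PowerSeries.X ^ q := by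
  ext n
  have h := (hO.map_eq_zero _).mpr (hΦ.dvd n)
  rw [map_sub, map_sub, sub_eq_zero] at h
  rw [PowerSeries.coeff_map, h, PowerSeries.coeff_X_pow, PowerSeries.coeff_X_pow]
  split_ifs <;> simp

/-- Modulo π the series Φ is X^q, and both composites reduce to the same series f(X^q) = f^q. -/
lemma dvd_coeff_commDefect {f : PowerSeries O} (hf : PowerSeries.constantCoeff f = 0) (n : ℕ) :
    π ∣ coeff n (commDefect Φ f) := by
  have := hO.finite
  rw [← hO.map_eq_zero, ← PowerSeries.coeff_map, commDefect, map_sub]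
  have hf' := HasSubst.of_constantCoeff_zero' hf
  have hm : HasSubst (f.map r) := HasSubst.of_constantCoeff_zero' (by
    rw [← PowerSeries.coeff_zero_eq_constantCoeff_apply] at hf ⊢
    rw [PowerSeries.coeff_map, hf, map_zero])
  have h1 : PowerSeries.map r (f.subst Φ) = (f.map r).subst (Φ.map r) :=
    map_subst (HasSubst.of_constantCoeff_zero' hΦ.constantCoeff) f
  have h2 : PowerSeries.map r (Φ.subst f) = (Φ.map r).subst (f.map r) :=
    map_subst hf' Φ
  rw [h1, h2, map_isLubinTate hO hΦ, ← hO.card, subst_X_pow_card, subst_pow hm, subst_X hm,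
    sub_self, map_zero]

/-- Both defects vanish, so in the first degree n ≥ 2 in question the difference of coefficients is
annihilated by π(1 - π^(n-1)), a regular element times a unit. -/
lemma isMulSeries_unique {a : O} {f g : PowerSeries O} (hf : IsMulSeries Φ a f)
    (hg : IsMulSeries Φ a g) : f = g := by
  rw [isMulSeries_iff] at hf hg
  have key : ∀ n, PowerSeries.X ^ (n + 2) ∣ f - g := by
    intro n
    induction n with
    | zero => exact X_sq_dvd_sub hf.1 hf.2.1 hg.1 hg.2.1
    | succ n ih =>
      rw [show n + 1 + 2 = n + 2 + 1 from rfl, X_pow_succ_dvd_iff ih]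
      have h := coeff_commDefect_sub hΦ.constantCoeff hf.1 hg.1 ih
      rw [hf.2.2, hg.2.2, sub_self, hΦ.coeff_one] at h
      have h1 : π * ((1 - π ^ (n + 1)) * (coeff (n + 2) f - coeff (n + 2) g)) = π * 0 := by
        linear_combination h
      rw [map_sub]
      exact (hO.isUnit (n + 1) n.succ_ne_zero).mul_right_eq_zero.mp (hO.regular h1)
  ext n
  have := PowerSeries.X_pow_dvd_iff.mp (key n) n (by omega)
  rwa [map_sub, sub_eq_zero] at this

lemma exists_isMulSeries (a : O) : ∃ f, IsMulSeries Φ a f := by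
  let P : ℕ → PowerSeries O → Prop := fun n f => PowerSeries.constantCoeff f = 0 ∧
    coeff 1 f = a ∧ PowerSeries.X ^ (n + 2) ∣ commDefect Φ f
  have step : ∀ n (f : {f // P n f}), ∃ g : {g // P (n + 1) g},
      PowerSeries.X ^ (n + 2) ∣ g.1 - f.1 := by
    rintro n ⟨f, hf0, hf1, hf⟩
    obtain ⟨z, hz⟩ := dvd_coeff_commDefect hO hΦ hf0 (n + 2)
    obtain ⟨u, hu⟩ := hO.isUnit (n + 1) n.succ_ne_zero
    -- The defect has coefficient π z in degree n + 2, and adding w X^(n+2) changes it by (π^(n+2) -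
    -- π) w = -π u w, where u = 1 - π^(n+1). Hence w = u⁻¹ z.
    let g := f + C (↑u⁻¹ * z) * PowerSeries.X ^ (n + 2)
    have hg0 : PowerSeries.constantCoeff g = 0 := by simp [g, hf0]
    have hgf : PowerSeries.X ^ (n + 2) ∣ g - f := ⟨C (↑u⁻¹ * z), by simp only [g]; ring⟩
    refine ⟨⟨g, hg0, ?_, ?_⟩, hgf⟩
    · rw [map_add, PowerSeries.coeff_C_mul, PowerSeries.coeff_X_pow, if_neg (by omega), mul_zero,
        add_zero, hf1]
    · have h1 : PowerSeries.X ^ (n + 2) ∣ commDefect Φ g := by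
        have := X_pow_dvd_commDefect_sub hΦ.constantCoeff hg0 hf0 hgf
        exact (dvd_sub_left hf).mp this
      rw [show n + 1 + 2 = n + 2 + 1 from rfl, X_pow_succ_dvd_iff h1]
      have h := coeff_commDefect_sub hΦ.constantCoeff hg0 hf0 hgf
      have hc : coeff (n + 2) g = coeff (n + 2) f + ↑u⁻¹ * z := by
        rw [map_add, PowerSeries.coeff_C_mul, PowerSeries.coeff_X_pow, if_pos rfl, mul_one]
      rw [hc, hΦ.coeff_one, hz] at h
      have hu' : (1 - π ^ (n + 1)) * (↑u⁻¹ * z) = z := by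
        rw [← hu, ← mul_assoc, Units.mul_inv, one_mul]
      linear_combination h - π * hu'
  choose s hs using step
  have h0 : P 0 (C a * PowerSeries.X) := by
    refine ⟨by simp, by simp, ?_⟩
    rw [zero_add, PowerSeries.X_pow_dvd_iff]
    have hd := coeff_commDefect_sub (Φ := Φ) (n := 1) (f := C a * PowerSeries.X) (g := 0)
      hΦ.constantCoeff (by simp) (by simp) ⟨C a, by ring⟩
    have hd0 := X_pow_dvd_commDefect_sub (Φ := Φ) (n := 1) (f := C a * PowerSeries.X) (g := 0)
      hΦ.constantCoeff (by simp) (by simp) ⟨C a, by ring⟩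
    have hz : commDefect Φ 0 = 0 := by
      have hΦ' := HasSubst.of_constantCoeff_zero' hΦ.constantCoeff
      have e1 : (0 : PowerSeries O).subst Φ = 0 := by
        rw [← PowerSeries.coe_substAlgHom hΦ', map_zero]
      have e2 : Φ.subst (0 : PowerSeries O) = 0 :=
        subst_zero_of_constantCoeff_zero hΦ.constantCoeff
      rw [commDefect, e1, e2, sub_self]
    rw [hz, sub_zero] at hd0
    rw [hz, map_zero, sub_zero, pow_one, sub_self, zero_mul] at hd
    intro m hm
    interval_cases m
    · exact PowerSeries.X_pow_dvd_iff.mp hd0 0 one_pos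
    · exact hd
  let G : ∀ n, {f // P n f} := fun n => Nat.rec ⟨_, h0⟩ s n
  have hG : ∀ n, PowerSeries.X ^ (n + 2) ∣ (G (n + 1)).1 - (G n).1 := fun n => hs n (G n)
  have hG' : ∀ n m, PowerSeries.X ^ (n + 2) ∣ (G (n + m)).1 - (G n).1 := by
    intro n m
    induction m with
    | zero => simp
    | succ m ih =>
      have := dvd_add ((pow_dvd_pow PowerSeries.X (show n + 2 ≤ n + m + 2 by omega)).trans
        (hG (n + m))) ih
      rwa [sub_add_sub_cancel] at this
  -- The approximations from stage n on agree modulo X^(n+2), so the diagonal coefficients define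
  -- their limit.
  let f : PowerSeries O := PowerSeries.mk fun n => coeff n (G n).1
  have hf : ∀ n, PowerSeries.X ^ (n + 2) ∣ f - (G n).1 := by
    intro n
    rw [PowerSeries.X_pow_dvd_iff]
    intro m hm
    rw [map_sub, PowerSeries.coeff_mk, sub_eq_zero]
    rcases le_total m n with h | h
    · obtain ⟨l, rfl⟩ := Nat.exists_eq_add_of_le h
      have := PowerSeries.X_pow_dvd_iff.mp (hG' m l) m (by omega)
      rw [map_sub, sub_eq_zero] at this
      exact this.symm
    · obtain ⟨l, rfl⟩ := Nat.exists_eq_add_of_le h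
      have := PowerSeries.X_pow_dvd_iff.mp (hG' n l) (n + l) (by omega)
      rwa [map_sub, sub_eq_zero] at this
  have hf0 : PowerSeries.constantCoeff f = 0 := by
    have := PowerSeries.X_pow_dvd_iff.mp (hf 0) 0 (by omega)
    rw [map_sub, sub_eq_zero, PowerSeries.coeff_zero_eq_constantCoeff_apply,
      PowerSeries.coeff_zero_eq_constantCoeff_apply] at this
    rw [this]
    exact (G 0).2.1
  refine ⟨f, isMulSeries_iff.mpr ⟨hf0, ?_, ?_⟩⟩
  · have := PowerSeries.X_pow_dvd_iff.mp (hf 0) 1 (by omega)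
    rw [map_sub, sub_eq_zero] at this
    rw [this]
    exact (G 0).2.2.1
  · ext n
    have h1 := X_pow_dvd_commDefect_sub hΦ.constantCoeff hf0 (G n).2.1 (hf n)
    have h2 := (dvd_sub_left (G n).2.2.2).mp h1
    rw [PowerSeries.X_pow_dvd_iff.mp h2 n (by omega), map_zero]

lemma isMulSeries_mulSeries (a : O) : IsMulSeries Φ a (mulSeries Φ a) :=
  mulSeries_spec (exists_isMulSeries hO hΦ a)

lemma mulSeries_one : mulSeries Φ (1 : O) = PowerSeries.X := by
  refine isMulSeries_unique hO hΦ (isMulSeries_mulSeries hO hΦ 1) ⟨by simp, by simp, ?_⟩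
  have h1 : Φ.subst (PowerSeries.X : PowerSeries O) = Φ := X_subst Φ
  rw [subst_X (HasSubst.of_constantCoeff_zero' hΦ.constantCoeff), h1]

lemma mulSeries_mul (a b : O) : mulSeries Φ (a * b) = (mulSeries Φ a).subst (mulSeries Φ b) := by
  have ha := isMulSeries_mulSeries hO hΦ a
  have hb := isMulSeries_mulSeries hO hΦ b
  have ha0 := (isMulSeries_iff.mp ha).1
  have hb0 := (isMulSeries_iff.mp hb).1
  have ha' := HasSubst.of_constantCoeff_zero' ha0
  have hb' := HasSubst.of_constantCoeff_zero' hb0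
  have hΦ' := HasSubst.of_constantCoeff_zero' hΦ.constantCoeff
  have h0 : (0 : PowerSeries O).subst (mulSeries Φ b) = 0 := by
    rw [← PowerSeries.coe_substAlgHom hb', map_zero]
  have hX : ∀ {f : PowerSeries O}, PowerSeries.constantCoeff f = 0 →
      PowerSeries.X ^ 1 ∣ f - 0 := fun hf => by
    rw [pow_one, sub_zero]
    exact PowerSeries.X_dvd_iff.mpr hf
  refine isMulSeries_unique hO hΦ (isMulSeries_mulSeries hO hΦ _) (isMulSeries_iff.mpr
    ⟨?_, ?_, ?_⟩)
  · have := PowerSeries.X_dvd_iff.mpr ha0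
    obtain ⟨u, hu⟩ := this
    rw [hu, subst_mul hb', subst_X hb', map_mul, hb0, zero_mul]
  · have h := coeff_sub_subst hb0 (hX ha0)
    rw [h0, sub_zero, sub_zero, coeff_one_mulSeries, coeff_one_mulSeries, pow_one] at h
    rw [h, mul_comm]
  · rw [commDefect, sub_eq_zero, subst_comp_subst_apply hb' hΦ', hb.comm,
      ← subst_comp_subst_apply hΦ' hb', ha.comm, subst_comp_subst_apply ha' hb']

/-- Compare [a] with the linear series aX, whose defect in degree 2 is (a - a²) times the
t²-coefficient of Φ, hence divisible by π². Dividing (π² - π) · coeff₂[a] by π shows that π divides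
coeff₂[a]. -/
lemma map_coeff_two_mulSeries (h2 : π ^ 2 ∣ coeff 2 Φ) (a : O) :
    r (coeff 2 (mulSeries Φ a)) = 0 := by
  have ha := isMulSeries_iff.mp (isMulSeries_mulSeries hO hΦ a)
  have hd := coeff_commDefect_sub (Φ := Φ) (n := 2) hΦ.constantCoeff (g := C a * PowerSeries.X)
    ha.1 (by simp) (X_sq_dvd_sub ha.1 ha.2.1 (by simp) (by simp))
  have hs : Φ.subst (C a * PowerSeries.X : PowerSeries O) = PowerSeries.rescale a Φ := by
    rw [PowerSeries.rescale_eq_subst, PowerSeries.smul_eq_C_mul]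
  have hs' : (C a * PowerSeries.X : PowerSeries O).subst Φ = C a * Φ := by
    have hΦ' := HasSubst.of_constantCoeff_zero' hΦ.constantCoeff
    have e : (C a : PowerSeries O).subst Φ = C a := subst_C a
    rw [subst_mul hΦ', subst_X hΦ', e]
  obtain ⟨z, hz⟩ := h2
  have e1 : coeff 2 (commDefect Φ (C a * PowerSeries.X)) = a * (π ^ 2 * z) - a ^ 2 * (π ^ 2 * z) := by
    rw [commDefect, hs, hs', map_sub, PowerSeries.coeff_C_mul, PowerSeries.coeff_rescale, hz]
  have e2 : coeff 2 (C a * PowerSeries.X : PowerSeries O) = 0 := by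
    rw [PowerSeries.coeff_C_mul, PowerSeries.coeff_X, if_neg (by decide), mul_zero]
  rw [ha.2.2, e1, e2, hΦ.coeff_one, map_zero] at hd
  rw [hO.map_eq_zero]
  obtain ⟨u, hu⟩ := hO.isUnit 1 one_ne_zero
  have h3 : π * ((1 - π ^ 1) * coeff 2 (mulSeries Φ a)) = π * (π * (a * z - a ^ 2 * z)) := by
    linear_combination hd
  have h4 := hO.regular h3
  rw [← hu] at h4
  exact (Units.dvd_mul_left (u := u)).mp ⟨_, h4⟩

end

end LubinTate

/-! ### The action of `Γ_•` on power series -/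

section GammaPS

variable {O κ k D : Type*} [CommRing O] [Field κ] [Field k] [Fintype D] {q : ℕ}
  {π : O} {r : O →+* κ} {Φ : PowerSeries O} {j : κ →+* k}

lemma substAlgHom_substAlgHom_eq {σ τ υ R : Type*} [CommRing R] {a : σ → MvPowerSeries τ R}
    {b : τ → MvPowerSeries υ R} {c : σ → MvPowerSeries υ R} (ha : MvPowerSeries.HasSubst a)
    (hb : MvPowerSeries.HasSubst b) (hc : MvPowerSeries.HasSubst c)
    (h : ∀ s, MvPowerSeries.substAlgHom (R := R) hb (a s) = c s) (f : MvPowerSeries σ R) :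
    MvPowerSeries.substAlgHom (R := R) hb (MvPowerSeries.substAlgHom (R := R) ha f)
      = MvPowerSeries.substAlgHom (R := R) hc f := by
  rw [MvPowerSeries.substAlgHom_comp_substAlgHom_apply, MvPowerSeries.substAlgHom_apply,
    MvPowerSeries.substAlgHom_apply]
  congr 1
  exact funext h

lemma substAlgHom_powerSeries_subst {τ υ R : Type*} [CommRing R] {a : MvPowerSeries τ R}
    {b : τ → MvPowerSeries υ R} (ha : PowerSeries.HasSubst a)
    (hb : MvPowerSeries.HasSubst b) (f : PowerSeries R) :
    MvPowerSeries.substAlgHom (R := R) hb (f.subst a)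
      = f.subst (MvPowerSeries.substAlgHom (R := R) hb a) := by
  rw [PowerSeries.subst_def, PowerSeries.subst_def, MvPowerSeries.substAlgHom_apply,
    MvPowerSeries.substAlgHom_apply, MvPowerSeries.subst_comp_subst_apply ha.const hb]

lemma gammaPS_mulSeriesAt (Φ : PowerSeries O) (red : O →+* k) (γ : D → Oˣ) (a : O) (d : D) :
    gammaPS Φ red γ (mulSeriesAt Φ red a d)
      = ((mulSeries Φ a).map red).subst (mulSeriesAt Φ red (γ d : O) d) := by
  rw [mulSeriesAt, gammaPS, substAlgHom_powerSeries_subst (PowerSeries.HasSubst.X d),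
    MvPowerSeries.substAlgHom_X]

lemma gammaPS_C (Φ : PowerSeries O) (red : O →+* k) (γ : D → Oˣ) (a : k) :
    gammaPS Φ red γ (MvPowerSeries.C a : PS k D) = MvPowerSeries.C a :=
  (gammaPS Φ red γ).commutes a

section

variable (hO : IsLubinTateBase q π r) (hΦ : IsLubinTate q π Φ)
include hO hΦ

lemma gammaPS_one (f : PS k D) : gammaPS Φ (j.comp r) 1 f = f := by
  have h : (fun d => mulSeriesAt Φ (j.comp r) (((1 : D → Oˣ) d : Oˣ) : O) d)
      = (MvPowerSeries.X : D → PS k D) := by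
    funext d
    rw [mulSeriesAt, Pi.one_apply, Units.val_one, mulSeries_one hO hΦ, PowerSeries.map_X,
      PowerSeries.subst_X (PowerSeries.HasSubst.X d)]
  rw [gammaPS, MvPowerSeries.substAlgHom_apply, h, MvPowerSeries.subst_self]; rfl

/-- Applying γ to [δ](t) gives [δ]([γ](t)), a composition in the opposite order. Commutativity of
multiplication in O repairs this. -/
lemma gammaPS_mul (γ δ : D → Oˣ) (f : PS k D) :
    gammaPS Φ (j.comp r) (γ * δ) f = gammaPS Φ (j.comp r) γ (gammaPS Φ (j.comp r) δ f) := by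
  refine (substAlgHom_substAlgHom_eq _ _ _ (fun d => ?_) f).symm
  refine (gammaPS_mulSeriesAt Φ (j.comp r) γ _ d).trans ?_
  have hγ : PowerSeries.HasSubst (mulSeries Φ (γ d : O)) :=
    PowerSeries.HasSubst.of_constantCoeff_zero' (by
      rw [← PowerSeries.coeff_zero_eq_constantCoeff_apply, coeff_zero_mulSeries])
  have hγ' : PowerSeries.HasSubst ((mulSeries Φ (γ d : O)).map (j.comp r)) :=
    PowerSeries.HasSubst.of_constantCoeff_zero' (by
      rw [← PowerSeries.coeff_zero_eq_constantCoeff_apply, PowerSeries.coeff_map,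
        coeff_zero_mulSeries, map_zero])
  have hmap : PowerSeries.map (j.comp r) ((mulSeries Φ (δ d : O)).subst (mulSeries Φ (γ d : O)))
      = ((mulSeries Φ (δ d : O)).map (j.comp r)).subst
        ((mulSeries Φ (γ d : O)).map (j.comp r)) := PowerSeries.map_subst hγ _
  rw [mulSeriesAt, mulSeriesAt, Pi.mul_apply, Units.val_mul, mul_comm, mulSeries_mul hO hΦ, hmap,
    PowerSeries.subst_comp_subst_apply hγ' (PowerSeries.HasSubst.X d)]

omit hΦ in
lemma subst_pow_card_pow (a : O) (e : ℕ) {τ : Type*} {x : MvPowerSeries τ k}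
    (hx : PowerSeries.HasSubst x) :
    ((mulSeries Φ a).map (j.comp r)).subst (x ^ q ^ e)
      = ((mulSeries Φ a).map (j.comp r)).subst x ^ q ^ e := by
  have := hO.finite
  have hq : q ≠ 0 := by rw [← hO.card]; exact Nat.card_pos.ne'
  induction e with
  | zero => simp
  | succ e ih =>
    have hx' : PowerSeries.HasSubst (x ^ q ^ e) := by
      have h : IsNilpotent (MvPowerSeries.constantCoeff x ^ q ^ e) :=
        IsNilpotent.pow_of_pos hx (pow_ne_zero _ hq)
      rwa [← map_pow] at h
    have hm : (mulSeries Φ a).map (j.comp r) = ((mulSeries Φ a).map r).map j := by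
      ext n; simp
    have := map_subst_pow_card j ((mulSeries Φ a).map r) hx'
    rw [hO.card] at this
    rw [pow_succ, pow_mul, hm, this, ← hm, ih, ← pow_mul]

-- The reduction of [γ_d] has coefficients in the field with q elements, so raising the variable to
-- a power q^e is the same as raising the series to that power.
omit hΦ in
lemma gammaPS_smul [NeZero q] (γ : D → Oˣ) (n : PhiMon q D) (f : PS k D) :
    gammaPS Φ (j.comp r) γ (n • f) = n • gammaPS Φ (j.comp r) γ f := by
  rw [smul_def, smul_def]
  have h : MvPowerSeries.HasSubst
      (fun d => mulSeriesAt Φ (j.comp r) (γ d : O) d ^ q ^ n.exp d : D → PS k D) :=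
    MvPowerSeries.hasSubst_of_constantCoeff_zero fun d => by
      obtain ⟨g, hg, -⟩ := mulSeriesAt_eq Φ (j.comp r) (γ d : O) d
      rw [hg]
      simp [NeZero.ne q]
  refine (substAlgHom_substAlgHom_eq _ _ h (fun d => ?_) f).trans
    (substAlgHom_substAlgHom_eq _ _ h (fun d => ?_) f).symm
  · refine (map_pow (gammaPS Φ (j.comp r) γ) _ _).trans ?_
    rw [gammaPS_X]
  · rw [mulSeriesAt, substAlgHom_powerSeries_subst (PowerSeries.HasSubst.X d),
      MvPowerSeries.substAlgHom_X, subst_pow_card_pow hO _ _ (PowerSeries.HasSubst.X d)]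

-- The vanishing quadratic coefficient makes the relative error a multiple of t_d² instead of t_d.
-- This is what is needed later, as t_d² and not t_d kills e_∅.
omit [Fintype D] in
lemma exists_mulSeriesAt_eq (h2 : π ^ 2 ∣ PowerSeries.coeff 2 Φ) (a : O) (d : D) :
    ∃ h : PS k D, mulSeriesAt Φ (j.comp r) a d
      = MvPowerSeries.X d * (MvPowerSeries.C (j (r a)) + MvPowerSeries.X d ^ 2 * h) := by
  have hX : PowerSeries.HasSubst (MvPowerSeries.X d : PS k D) := PowerSeries.HasSubst.X d
  obtain ⟨h, hh⟩ : (PowerSeries.X : PowerSeries k) ^ 3 ∣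
      (mulSeries Φ a).map (j.comp r) - PowerSeries.C (j (r a)) * PowerSeries.X := by
    rw [PowerSeries.X_pow_dvd_iff]
    intro m hm
    interval_cases m
    · rw [map_sub, PowerSeries.coeff_map, coeff_zero_mulSeries]
      simp
    · simp [coeff_one_mulSeries]
    · rw [map_sub, PowerSeries.coeff_map, RingHom.comp_apply,
        map_coeff_two_mulSeries hO hΦ h2, map_zero, PowerSeries.coeff_C_mul, PowerSeries.coeff_X,
        if_neg (by decide), mul_zero, sub_zero]
  refine ⟨h.subst (MvPowerSeries.X d : PS k D), ?_⟩
  have e : (PowerSeries.C (j (r a)) : PowerSeries k).subst (MvPowerSeries.X d : PS k D)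
      = MvPowerSeries.C (j (r a)) := PowerSeries.subst_C _
  rw [mulSeriesAt, sub_eq_iff_eq_add.mp hh, PowerSeries.subst_add hX, PowerSeries.subst_mul hX,
    PowerSeries.subst_mul hX, PowerSeries.subst_pow hX, PowerSeries.subst_X hX, e]
  ring

-- The leading factor disappears because γ_d^(q-1) = 1 in the residue field; the error t_d² survives
-- the power. This makes the relation t_d^(q-1) φ_d e_∅ = c_d e_∅ compatible with Γ_•.
omit [Fintype D] in
lemma exists_mulSeriesAt_pow_eq (h2 : π ^ 2 ∣ PowerSeries.coeff 2 Φ) (a : Oˣ) (d : D) :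
    ∃ h : PS k D, mulSeriesAt Φ (j.comp r) (a : O) d ^ (q - 1)
      = MvPowerSeries.X d ^ (q - 1) + MvPowerSeries.X d ^ 2 * h * MvPowerSeries.X d ^ (q - 1) := by
  obtain ⟨g, hg⟩ := exists_mulSeriesAt_eq (k := k) (j := j) hO hΦ h2 (a : O) d
  have hdvd : MvPowerSeries.X d ^ 2 ∣ (MvPowerSeries.C (j (r a)) + MvPowerSeries.X d ^ 2 * g) ^ (q - 1)
      - (MvPowerSeries.C (j (r a)) : PS k D) ^ (q - 1) := by
    refine dvd_trans ⟨g, ?_⟩ (sub_dvd_pow_sub_pow _ _ _)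
    ring
  obtain ⟨h, hh⟩ := hdvd
  have hc : (MvPowerSeries.C (j (r a)) : PS k D) ^ (q - 1) = 1 := by
    have := hO.finite
    have := Fintype.ofFinite κ
    have ha : r a ≠ 0 := (a.isUnit.map r).ne_zero
    rw [← map_pow, ← map_pow, ← hO.card, Nat.card_eq_fintype_card,
      FiniteField.pow_card_sub_one_eq_one _ ha, map_one, map_one]
  refine ⟨h, ?_⟩
  rw [hg, mul_pow, sub_eq_iff_eq_add.mp hh, hc]
  ring

end

end GammaPS

/-! ### Monomials and the standard `ψ`-operator -/

section PsiCan

open MvPowerSeries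

/-- The monomial with exponent `i`. -/
def mon (k : Type*) {D : Type*} [Field k] (i : D →₀ ℕ) : PS k D := monomial i 1

/-! ### Monomials with arbitrary exponent vectors. -/

section Mon

variable {k D : Type*} [Field k]

lemma mon_zero : mon k (0 : D →₀ ℕ) = 1 := monomial_zero_one

lemma mon_add (i j : D →₀ ℕ) : mon k (i + j) = mon k i * mon k j := by
  rw [mon, mon, mon, monomial_mul_monomial, one_mul]

lemma X_pow_eq_mon (d : D) (e : ℕ) : (X d : PS k D) ^ e = mon k (Finsupp.single d e) :=
  MvPowerSeries.X_pow_eq d e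

lemma X_eq_mon (d : D) : (X d : PS k D) = mon k (Finsupp.single d 1) := X_def d

lemma coeff_add_mon_mul (i j : D →₀ ℕ) (f : PS k D) : coeff (i + j) (mon k i * f) = coeff j f := by
  rw [mon, coeff_add_monomial_mul, one_mul]

lemma coeff_mon_mul (i j : D →₀ ℕ) (f : PS k D) :
    coeff i (mon k j * f) = if j ≤ i then coeff (i - j) f else 0 := by
  rw [mon, coeff_monomial_mul]
  simp

lemma mon_ne_zero (i : D →₀ ℕ) : mon k i ≠ 0 := fun h => by
  have := coeff_add_mon_mul i 0 (1 : PS k D)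
  rw [h, zero_mul, map_zero, coeff_zero_one] at this
  exact zero_ne_one this

lemma mon_dvd_iff {i : D →₀ ℕ} {f : PS k D} :
    mon k i ∣ f ↔ ∀ j, ¬ i ≤ j → coeff j f = 0 := by
  constructor
  · rintro ⟨g, rfl⟩ j hj
    rw [coeff_mon_mul, if_neg hj]
  · intro h
    let g : PS k D := fun j => coeff (i + j) f
    have hg : ∀ j, coeff j g = coeff (i + j) f := fun _ => rfl
    refine ⟨g, ?_⟩
    ext j
    rw [coeff_mon_mul]
    split_ifs with hij
    · rw [hg, add_tsub_cancel_of_le hij]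
    · exact h j hij

end Mon

variable {k D : Type*} [Field k] [Fintype D] {q : ℕ}

lemma mon_eq_prod (i : D →₀ ℕ) : mon k i = ∏ d, X d ^ i d := by
  rw [mon, MvPowerSeries.monomial_one_eq, Finsupp.prod_fintype _ _ fun d => pow_zero _]

/-- The map on exponents induced by an element of `PhiMon q D`. -/
def sc (n : PhiMon q D) : (D →₀ ℕ) →+ (D →₀ ℕ) where
  toFun i := Finsupp.equivFunOnFinite.symm fun d => q ^ n.exp d * i d
  map_zero' := by ext; simp
  map_add' i j := by ext; simp [mul_add]

@[simp] lemma sc_apply (n : PhiMon q D) (i : D →₀ ℕ) (d : D) : sc n i d = q ^ n.exp d * i d := rfl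

lemma sc_mul (m n : PhiMon q D) (i : D →₀ ℕ) : sc (m * n) i = sc m (sc n i) := by
  ext d; simp [PhiMon.exp_mul, pow_add, mul_assoc]

lemma sc_one (i : D →₀ ℕ) : sc (1 : PhiMon q D) i = i := by
  ext d; simp [PhiMon.exp_one]

variable [NeZero q]

lemma le_sc (n : PhiMon q D) (i : D →₀ ℕ) : i ≤ sc n i := fun _ =>
  Nat.le_mul_of_pos_left _ (pow_pos (NeZero.pos q) _)

lemma sc_le_sc_iff {n : PhiMon q D} {i j : D →₀ ℕ} : sc n i ≤ sc n j ↔ i ≤ j := by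
  refine forall_congr' fun d => ?_
  exact Nat.mul_le_mul_left_iff (pow_pos (NeZero.pos q) _)

lemma sc_injective (n : PhiMon q D) : Function.Injective (sc n) := fun _ _ h =>
  le_antisymm (sc_le_sc_iff.mp h.le) (sc_le_sc_iff.mp h.ge)

lemma smul_mon (n : PhiMon q D) (i : D →₀ ℕ) : n • mon k i = mon k (sc n i) := by
  rw [mon_eq_prod, mon_eq_prod, smul_def, map_prod]
  refine Finset.prod_congr rfl fun d _ => ?_
  rw [map_pow, frob_X, ← pow_mul, sc_apply]

lemma coeff_smul_eq_finsum (n : PhiMon q D) (f : PS k D) (j : D →₀ ℕ) :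
    coeff j (n • f) = ∑ᶠ i, coeff i f • coeff j (mon k (sc n i)) := by
  rw [smul_def, frob, substAlgHom_apply, coeff_subst (hasSubst_frob n)]
  refine finsum_congr fun i => ?_
  congr 2
  rw [Finsupp.prod_fintype _ _ fun d => pow_zero _, ← smul_mon, mon_eq_prod, smul_def, map_prod]
  exact Finset.prod_congr rfl fun d _ => by rw [map_pow, frob_X]

lemma coeff_sc_smul (n : PhiMon q D) (f : PS k D) (i : D →₀ ℕ) :
    coeff (sc n i) (n • f) = coeff i f := by
  classical
  rw [coeff_smul_eq_finsum, finsum_eq_single _ i]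
  · rw [mon, coeff_monomial_same, smul_eq_mul, mul_one]
  · intro j hj
    rw [mon, coeff_monomial_ne fun h => hj (sc_injective n h).symm, smul_zero]

lemma coeff_smul_eq_zero (n : PhiMon q D) (f : PS k D) (j : D →₀ ℕ) (h : ∀ i, sc n i ≠ j) :
    coeff j (n • f) = 0 := by
  rw [coeff_smul_eq_finsum]
  refine finsum_eq_zero_of_forall_eq_zero fun i => ?_
  rw [mon, coeff_monomial_ne (h i).symm, smul_zero]

/-- The standard left inverse of the operator `n ∈ PhiMon q D` on `k[[t_•]]`. -/
def psiCan (n : PhiMon q D) : PS k D →ₗ[k] PS k D where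
  toFun f := fun i => coeff (sc n i) f
  map_add' f g := by ext; exact map_add _ _ _
  map_smul' a f := by ext; rfl

omit [NeZero q] in
lemma coeff_psiCan (n : PhiMon q D) (f : PS k D) (i : D →₀ ℕ) :
    coeff i (psiCan n f) = coeff (sc n i) f := rfl

omit [NeZero q] in
lemma psiCan_one (f : PS k D) : psiCan (1 : PhiMon q D) f = f := by
  ext i; rw [coeff_psiCan, sc_one]

omit [NeZero q] in
lemma psiCan_mul (m n : PhiMon q D) (f : PS k D) :
    psiCan (m * n) f = psiCan m (psiCan n f) := by
  ext i; rw [coeff_psiCan, coeff_psiCan, coeff_psiCan, mul_comm, sc_mul]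

/-- In the convolution for the coefficient at `sc n i` only exponents u in the image of `sc n`
contribute. The complementary exponent then lies in that image too, so the sum reindexes to the
convolution at i. -/
lemma psiCan_smul_mul (n : PhiMon q D) (a f : PS k D) :
    psiCan n ((n • a) * f) = a * psiCan n f := by
  classical
  ext i
  rw [coeff_psiCan, coeff_mul, coeff_mul]
  symm
  refine Finset.sum_of_injOn (fun p => (sc n p.1, sc n p.2)) ?_ ?_ ?_ ?_
  · rintro ⟨a, b⟩ - ⟨a', b'⟩ - h
    rw [Prod.mk.injEq] at h
    exact Prod.ext (sc_injective n h.1) (sc_injective n h.2)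
  · rintro ⟨a, b⟩ h
    rw [Finset.mem_coe, Finset.HasAntidiagonal.mem_antidiagonal] at h ⊢
    rw [← map_add, h]
  · rintro ⟨u, v⟩ h h'
    rw [Finset.HasAntidiagonal.mem_antidiagonal] at h
    dsimp only at h ⊢
    rw [coeff_smul_eq_zero, zero_mul]
    rintro i' rfl
    refine h' ⟨(i', i - i'), ?_, ?_⟩
    · have : i' ≤ i := sc_le_sc_iff.mp (h ▸ le_self_add)
      rw [Finset.mem_coe, Finset.HasAntidiagonal.mem_antidiagonal, add_tsub_cancel_of_le this]
    · have hle : i' ≤ i := sc_le_sc_iff.mp (h ▸ le_self_add)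
      have : sc n i' + sc n (i - i') = sc n i' + v := by
        rw [← map_add, add_tsub_cancel_of_le hle, h]
      exact Prod.ext rfl (add_left_cancel this)
  · rintro ⟨a, b⟩ -
    rw [coeff_sc_smul, coeff_psiCan]

lemma psiCan_smul (n : PhiMon q D) (f : PS k D) : psiCan n (n • f) = f := by
  ext i; rw [coeff_psiCan, coeff_sc_smul]

lemma psiCan_C (n : PhiMon q D) (a : k) : psiCan n (C a : PS k D) = C a := by
  rw [← smul_C n a, psiCan_smul, smul_C]

/-- Nondegeneracy of the pairing (a, f) ↦ `psiCan n (a * f)`: multiplication by t^(sc n i - i) moves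
the coefficient of f at i to the exponent `sc n i`, where `psiCan n` reads it off. -/
lemma eq_zero_of_psiCan_mul_eq_zero (n : PhiMon q D) {f : PS k D}
    (h : ∀ a, psiCan n (a * f) = 0) : f = 0 := by
  ext i
  have h1 := congrArg (coeff i) (h (mon k (sc n i - i)))
  rw [coeff_psiCan] at h1
  conv_lhs at h1 => rw [← tsub_add_cancel_of_le (le_sc n i), add_tsub_cancel_right]
  rwa [coeff_add_mon_mul] at h1

/-- The scalar `∏ c_d ^ (n_d)`. -/
def cPow (c : D → kˣ) : PhiMon q D →* kˣ where
  toFun n := ∏ d, c d ^ n.exp d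
  map_one' := by simp [PhiMon.exp_one]
  map_mul' m n := by simp [PhiMon.exp_mul, pow_add, Finset.prod_mul_distrib]

omit [NeZero q] in
lemma cPow_phi [DecidableEq D] (c : D → kˣ) (d : D) : cPow c (PhiMon.phi q d) = c d := by
  change ∏ d', c d' ^ (Pi.single d 1 : D → ℕ) d' = c d
  rw [Finset.prod_eq_single d]
  · simp
  · intro d' _ h
    simp [h]
  · simp

omit [Fintype D] [NeZero q] in
lemma PhiMon.exp_phi [DecidableEq D] (d d' : D) :
    (PhiMon.phi q d).exp d' = if d' = d then 1 else 0 := by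
  change (Pi.single d 1 : D → ℕ) d' = _
  rw [Pi.single_apply]

-- Serves as an induction principle: a multiplicative property of monomials in the φ_d need only be
-- checked on the generators.
omit [NeZero q] in
lemma PhiMon.mem_of_phi_mem [DecidableEq D] (S : Submonoid (PhiMon q D))
    (h : ∀ d, PhiMon.phi q d ∈ S) (n : PhiMon q D) : n ∈ S := by
  have : n = ∏ d, PhiMon.phi q d ^ n.exp d := by
    change n.exp = Multiplicative.toAdd (∏ d, (Multiplicative.ofAdd (Pi.single d 1 : D → ℕ)) ^ n.exp d)
    rw [toAdd_prod]
    funext d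
    rw [Finset.sum_apply]
    simp [Pi.single_apply]
  rw [this]
  exact Submonoid.prod_mem _ fun d _ => pow_mem (h d) _

/-- The set of indices where an exponent vanishes. -/
def zeroSet (i : D →₀ ℕ) : Finset D := Finset.univ.filter fun d => i d = 0

omit [NeZero q] in
@[simp] lemma mem_zeroSet {i : D →₀ ℕ} {d : D} : d ∈ zeroSet i ↔ i d = 0 := by simp [zeroSet]

lemma zeroSet_sc (n : PhiMon q D) (i : D →₀ ℕ) : zeroSet (sc n i) = zeroSet i := by
  ext d; simp [NeZero.ne q]

omit [NeZero q] in
lemma zeroSet_subset {i j : D →₀ ℕ} (h : i ≤ j) : zeroSet j ⊆ zeroSet i := fun d hd => by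
  rw [mem_zeroSet] at hd ⊢
  exact Nat.le_zero.mp (hd ▸ h d)

/-- The ideal of all power series in which only those monomials occur whose set of missing
variables does not belong to `𝒟`. -/
def famIdeal (k : Type*) [Field k] (𝒟 : Family D) : Ideal (PS k D) where
  carrier := {f | ∀ i, zeroSet i ∈ 𝒟.carrier → coeff i f = 0}
  zero_mem' i _ := map_zero _
  add_mem' {f g} hf hg i hi := by rw [map_add, hf i hi, hg i hi, add_zero]
  smul_mem' a f hf i hi := by
    classical
    rw [smul_eq_mul, coeff_mul]
    refine Finset.sum_eq_zero fun p hp => ?_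
    rw [Finset.HasAntidiagonal.mem_antidiagonal] at hp
    rw [hf p.2 (𝒟.upper _ hi _ (zeroSet_subset (hp ▸ le_add_self))), mul_zero]

lemma psiCan_mem_famIdeal {𝒟 : Family D} (n : PhiMon q D) {f : PS k D} (hf : f ∈ famIdeal k 𝒟) :
    psiCan n f ∈ famIdeal k 𝒟 := fun i hi => hf _ (by rwa [zeroSet_sc])

lemma smul_mem_famIdeal {𝒟 : Family D} (n : PhiMon q D) {f : PS k D} (hf : f ∈ famIdeal k 𝒟) :
    n • f ∈ famIdeal k 𝒟 := fun i hi => by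
  by_cases h : ∃ j, sc n j = i
  · obtain ⟨j, rfl⟩ := h
    rw [coeff_sc_smul]
    exact hf j (by rwa [zeroSet_sc] at hi)
  · push Not at h
    exact coeff_smul_eq_zero n f i h

omit [NeZero q] in
lemma mon_mem_famIdeal {𝒟 : Family D} {i : D →₀ ℕ} :
    mon k i ∈ famIdeal k 𝒟 ↔ zeroSet i ∉ 𝒟.carrier := by
  classical
  constructor
  · intro h hi
    have := h i hi
    rw [mon, coeff_monomial_same] at this
    exact one_ne_zero this
  · intro h j hj
    rw [mon, coeff_monomial_ne]
    rintro rfl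
    exact h hj

omit [NeZero q] in
lemma famIdeal_bot : famIdeal k (Family.bot D) = ⊤ :=
  eq_top_iff.mpr fun _ _ _ hi => absurd hi (Set.notMem_empty _)

end PsiCan

/-! ### The universal property of `Δ_𝒟` -/

section Lift

open MvPowerSeries

variable {k D : Type*} [Field k] [Fintype D]

/-- A power series acts on an element killed by powers of all the variables through finitely many
coefficients. No topology on W is needed: the variables are removed one at a time. -/
lemma smul_eq_zero_of_coeff_eq_zero {W : Type*} [AddCommGroup W] [Module (PS k D) W] {x : W}
    {i : D →₀ ℕ} (hx : ∀ d, (X d : PS k D) ^ (i d + 1) • x = 0) {f : PS k D}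
    (hf : ∀ a ≤ i, coeff a f = 0) : f • x = 0 := by
  classical
  have key : ∀ (S : Finset D) (f : PS k D), (∀ a : D →₀ ℕ, (∀ d ∈ S, a d ≤ i d) → coeff a f = 0) →
      f • x = 0 := by
    intro S
    induction S using Finset.induction_on with
    | empty =>
      intro f hf
      have : f = 0 := by ext a; exact hf a (by simp)
      rw [this, zero_smul]
    | insert d S hd ih =>
      intro f hf
      -- Split off the part of f of t_d-degree at most i_d. The rest is divisible by t_d^(i_d + 1),
      -- and the induction hypothesis for the smaller set of variables applies to `g`.
      let g : PS k D := fun a => if a d ≤ i d then coeff a f else 0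
      have hg : ∀ a, coeff a g = if a d ≤ i d then coeff a f else 0 := fun _ => rfl
      have h1 : g • x = 0 := ih g fun a ha => by
        rw [hg]
        split_ifs with h
        · exact hf a fun e he => by
            rcases Finset.mem_insert.mp he with rfl | he
            · exact h
            · exact ha e he
        · rfl
      obtain ⟨u, hu⟩ : X d ^ (i d + 1) ∣ f - g := by
        rw [X_pow_dvd_iff]
        intro a ha
        rw [map_sub, hg, if_pos (Nat.lt_succ_iff.mp ha), sub_self]
      rw [← sub_add_cancel f g, add_smul, h1, add_zero, hu, mul_comm, mul_smul, hx, smul_zero]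
  exact key Finset.univ f fun a ha => hf a fun d => ha d (Finset.mem_univ d)

variable [DecidableEq D]

omit [Fintype D] in
lemma BMod.smul_e_empty (f : PS k D) (C : Finset D) :
    (f • BMod.e k (∅ : Finset D)) C = coeff (sqfree C) f := by
  change ∑ S ∈ C.powerset, coeff (sqfree S) f * (Pi.single ∅ (1 : k) : Finset D → k) (C \ S) = _
  rw [Finset.sum_eq_single C]
  · simp
  · intro S hS hne
    rw [Pi.single_apply, if_neg, mul_zero]
    rw [Finset.sdiff_eq_empty_iff_subset]
    exact fun h => hne (subset_antisymm (Finset.mem_powerset.mp hS) h)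
  · simp

omit [Fintype D] in
lemma sqfree_injective : Function.Injective (sqfree : Finset D → D →₀ ℕ) := fun S T h => by
  rw [← support_sqfree S, h, support_sqfree]

omit [Fintype D] in
lemma BMod.mon_smul_e_empty (C : Finset D) :
    mon k (sqfree C) • BMod.e k (∅ : Finset D) = BMod.e k C := by
  funext C'
  rw [BMod.smul_e_empty, mon, coeff_monomial, BMod.e, Pi.single_apply]
  exact if_congr sqfree_injective.eq_iff rfl rfl

omit [Fintype D] in
lemma BMod.exists_smul_e_empty (b : BMod k D) : ∃ f : PS k D, b = f • BMod.e k (∅ : Finset D) := by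
  -- Only the squarefree coefficients of f act on e_∅, so the values at the other exponents are
  -- arbitrary.
  let f : PS k D := fun i => b i.support
  refine ⟨f, ?_⟩
  funext C
  rw [BMod.smul_e_empty]
  change b C = b (sqfree C).support
  rw [support_sqfree]

variable {q : ℕ} [NeZero q] {c : D → kˣ} {𝒟 : Family D}

/-- The projection to `A ⊗_R B` from the tensor product over the integers. -/
def Balanced.mkTensor {A R : Type*} [Ring A] [CommRing R] (ι : R →+* A) (B : Type*)
    [AddCommGroup B] [Module R B] : A ⊗[ℤ] B →ₗ[A] Balanced ι B := (balancedRel ι B).mkQ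

/-- The projection to `Δ_𝒟` from the tensor product over the integers. -/
def Delta.mkTensor (q : ℕ) [NeZero q] (c : D → kˣ) (𝒟 : Family D) :
    Tw q k D ⊗[ℤ] BD k 𝒟 →ₗ[Tw q k D] Delta q c 𝒟 :=
  QuotSpan.mk (A := Tw q k D) (deltaRelation q c 𝒟) ∘ₗ Balanced.mkTensor (Tw.incl q k D) (BD k 𝒟)

lemma Delta.mkTensor_surjective (q : ℕ) [NeZero q] (c : D → kˣ) (𝒟 : Family D) :
    Function.Surjective (Delta.mkTensor q c 𝒟) :=
  Function.Surjective.comp (g := QuotSpan.mk (A := Tw q k D) (deltaRelation q c 𝒟))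
    (Submodule.mkQ_surjective _) (Submodule.mkQ_surjective _)

/-- The class of `a ⊗ b` in `Δ_𝒟`. -/
def Delta.cls (q : ℕ) [NeZero q] (c : D → kˣ) (𝒟 : Family D) (a : Tw q k D) (b : BD k 𝒟) :
    Delta q c 𝒟 := Delta.mkTensor q c 𝒟 (a ⊗ₜ[ℤ] b)

lemma Delta.cls_mul (a a' : Tw q k D) (b : BD k 𝒟) :
    Delta.cls q c 𝒟 (a * a') b = a • Delta.cls q c 𝒟 a' b := rfl

lemma Delta.cls_mul_incl (a : Tw q k D) (f : PS k D) (b : BD k 𝒟) :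
    Delta.cls q c 𝒟 (a * Tw.incl q k D f) b = Delta.cls q c 𝒟 a (f • b) := by
  have h : Balanced.mkTensor (Tw.incl q k D) (BD k 𝒟)
      ((a * Tw.incl q k D f) ⊗ₜ[ℤ] b - a ⊗ₜ[ℤ] (f • b)) = 0 :=
    (Submodule.Quotient.mk_eq_zero _).mpr (Submodule.subset_span ⟨a, f, b, rfl⟩)
  rw [Delta.cls, Delta.cls, ← sub_eq_zero, ← map_sub]
  exact (congrArg (QuotSpan.mk (A := Tw q k D) (deltaRelation q c 𝒟)) h).trans (map_zero _)

lemma Delta.e_eq_cls (C : Finset D) :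
    Delta.e q c 𝒟 C = Delta.cls q c 𝒟 1 (Submodule.Quotient.mk (BMod.e k C)) := rfl

lemma Delta.cls_smul_e_empty (a : Tw q k D) (f : PS k D) :
    Delta.cls q c 𝒟 a (Submodule.Quotient.mk (f • BMod.e k ∅))
      = (a * Tw.incl q k D f) • Delta.e q c 𝒟 ∅ := by
  rw [Delta.e_eq_cls, ← Delta.cls_mul, mul_one, Delta.cls_mul_incl]
  rfl

lemma Delta.e_eq (C : Finset D) : Delta.e q c 𝒟 C = mon k (sqfree C) • Delta.e q c 𝒟 ∅ := by
  rw [Delta.e_eq_cls, ← BMod.mon_smul_e_empty, Delta.cls_smul_e_empty, one_mul, Delta.smul_eq]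

lemma Delta.exists_smul_e (x : Delta q c 𝒟) : ∃ a : Tw q k D, x = a • Delta.e q c 𝒟 ∅ := by
  obtain ⟨z, rfl⟩ := Delta.mkTensor_surjective q c 𝒟 x
  induction z using TensorProduct.induction_on with
  | zero => exact ⟨0, (map_zero _).trans (zero_smul (Tw q k D) (Delta.e q c 𝒟 ∅)).symm⟩
  | tmul a b =>
    obtain ⟨b, rfl⟩ := Submodule.mkQ_surjective _ b
    obtain ⟨f, rfl⟩ := BMod.exists_smul_e_empty b
    exact ⟨_, Delta.cls_smul_e_empty a f⟩
  | add y z hy hz =>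
    obtain ⟨a, ha⟩ := hy
    obtain ⟨b, hb⟩ := hz
    exact ⟨a + b, by rw [map_add, ha, hb, add_smul]⟩

lemma Delta.X_sq_smul_e (d : D) : (X d : PS k D) ^ 2 • Delta.e q c 𝒟 ∅ = 0 := by
  have h : (X d : PS k D) ^ 2 • BMod.e k (∅ : Finset D) = 0 := by
    rw [pow_two, mul_smul, BMod.X_smul_e, if_neg (Finset.notMem_empty d), BMod.X_smul_e,
      if_pos (Finset.mem_insert_self d ∅)]
  have h' := Delta.cls_smul_e_empty (c := c) (𝒟 := 𝒟) (1 : Tw q k D) ((X d : PS k D) ^ 2)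
  rw [one_mul, ← Delta.smul_eq, h] at h'
  rw [← h', Delta.cls, Submodule.Quotient.mk_zero, TensorProduct.tmul_zero, map_zero]

lemma Delta.e_eq_zero {C : Finset D} (hC : C ∈ 𝒟.carrier) : Delta.e q c 𝒟 C = 0 := by
  have h : (Submodule.Quotient.mk (BMod.e k C) : BD k 𝒟) = 0 :=
    (Submodule.Quotient.mk_eq_zero _).mpr (Submodule.subset_span ⟨C, hC, rfl⟩)
  rw [Delta.e_eq_cls, h, Delta.cls, TensorProduct.tmul_zero, map_zero]

lemma Delta.relation (d : D) : (X d : PS k D) ^ (q - 1) • Delta.phi q c 𝒟 d (Delta.e q c 𝒟 ∅)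
    = (c d : k) • Delta.e q c 𝒟 ∅ := by
  have h : QuotSpan.mk (A := Tw q k D) (deltaRelation q c 𝒟) (deltaRelation q c 𝒟 d) = 0 :=
    (Submodule.Quotient.mk_eq_zero _).mpr (Submodule.subset_span ⟨d, rfl⟩)
  rw [deltaRelation, map_sub, sub_eq_zero] at h
  have e : ∀ a : Tw q k D, QuotSpan.mk (A := Tw q k D) (deltaRelation q c 𝒟)
      (IndB.tmulE q 𝒟 a ∅) = a • Delta.e q c 𝒟 ∅ := fun a => by
    rw [Delta.e_eq_cls, ← Delta.cls_mul, mul_one]; rfl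
  rw [e, e, mul_smul] at h
  exact h

/-- Universal property: Δ_𝒟 is the cyclic module on e_∅ presented by t_d² e_∅ = 0, by t^C e_∅ = 0
for C ∈ 𝒟, and by t_d^(q-1) φ_d e_∅ = c_d e_∅. The map is built through the three successive
quotients defining Δ_𝒟. -/
lemma Delta.exists_lift {W : Type*} [AddCommGroup W] [Module (Tw q k D) W] (w : W)
    (h₁ : ∀ d, Tw.incl q k D (X d ^ 2) • w = 0)
    (h₂ : ∀ C ∈ 𝒟.carrier, Tw.incl q k D (mon k (sqfree C)) • w = 0)
    (h₃ : ∀ d, Tw.incl q k D (X d ^ (q - 1)) • Tw.phi q k d • w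
      = Tw.incl q k D (MvPowerSeries.C (c d : k)) • w) :
    ∃ L : Delta q c 𝒟 →ₗ[Tw q k D] W, L (Delta.e q c 𝒟 ∅) = w := by
  let _ : Module (PS k D) W := Module.compHom W (Tw.incl q k D)
  have hsm : ∀ (f : PS k D) (x : W), f • x = Tw.incl q k D f • x := fun _ _ => rfl
  let s := LinearMap.toSpanSingleton (PS k D) (BMod k D) (BMod.e k ∅)
  have hs : Function.Surjective s := fun b => by
    obtain ⟨f, rfl⟩ := BMod.exists_smul_e_empty b
    exact ⟨f, rfl⟩
  -- A series kills e_∅ only if its squarefree coefficients vanish. As t_d² w = 0 for all d, no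
  -- other coefficient can act on w.
  have hker : LinearMap.ker s ≤ LinearMap.ker (LinearMap.toSpanSingleton (PS k D) W w) := by
    intro f hf
    rw [LinearMap.mem_ker] at hf ⊢
    refine smul_eq_zero_of_coeff_eq_zero (i := sqfree Finset.univ) (fun d => ?_) fun a ha => ?_
    · rw [sqfree_apply, if_pos (Finset.mem_univ d)]
      exact h₁ d
    · rw [← sqfree_support_of_le ha, ← BMod.smul_e_empty]
      exact congrFun hf _
  let β₀ : BMod k D →ₗ[PS k D] W := ((LinearMap.ker s).liftQ _ hker) ∘ₗ
    (LinearMap.quotKerEquivOfSurjective s hs).symm.toLinearMap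
  have hβ₀ : ∀ f : PS k D, β₀ (f • BMod.e k ∅) = f • w := by
    intro f
    have : (LinearMap.quotKerEquivOfSurjective s hs).symm (f • BMod.e k ∅)
        = Submodule.Quotient.mk f := by
      rw [LinearEquiv.symm_apply_eq]; rfl
    simp only [β₀, LinearMap.comp_apply, LinearEquiv.coe_coe, this]
    rfl
  let β : BD k 𝒟 →ₗ[PS k D] W := Submodule.liftQ _ β₀ (by
    rw [Submodule.span_le]
    rintro _ ⟨C, hC, rfl⟩
    rw [SetLike.mem_coe, LinearMap.mem_ker, ← BMod.mon_smul_e_empty, hβ₀]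
    exact h₂ C hC)
  have hβ : β (Submodule.Quotient.mk (BMod.e k ∅)) = w := by
    have := hβ₀ 1
    rwa [one_smul, one_smul] at this
  let L₀ : Tw q k D ⊗[ℤ] BD k 𝒟 →+ W := TensorProduct.liftAddHom
    { toFun := fun a => ((smulAddHom (Tw q k D) W) a).comp β.toAddMonoidHom
      map_zero' := by ext; simp
      map_add' := fun a b => by ext; simp }
    (fun n a b => by
      change (n • a) • β b = a • β (n • b)
      rw [map_zsmul, smul_assoc, smul_comm])
  have hL₀ : ∀ a b, L₀ (a ⊗ₜ b) = a • β b := fun _ _ => rfl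
  let L₁ : Tw q k D ⊗[ℤ] BD k 𝒟 →ₗ[Tw q k D] W :=
    { L₀ with
      map_smul' := fun a x => by
        change L₀ (a • x) = a • L₀ x
        induction x using TensorProduct.induction_on with
        | zero => simp
        | tmul b y => rw [TensorProduct.smul_tmul', hL₀, hL₀, smul_eq_mul, mul_smul]
        | add x y hx hy => rw [smul_add, map_add, hx, hy, map_add, smul_add] }
  have hL₁ : ∀ a b, L₁ (a ⊗ₜ b) = a • β b := fun _ _ => rfl
  let L₂ : IndB q k 𝒟 →ₗ[Tw q k D] W := (balancedRel (Tw.incl q k D) (BD k 𝒟)).liftQ L₁ (by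
    rw [balancedRel, Submodule.span_le]
    rintro _ ⟨a, f, b, rfl⟩
    rw [SetLike.mem_coe, LinearMap.mem_ker, map_sub, hL₁, hL₁, map_smul, hsm, mul_smul, sub_self])
  have hL₂ : ∀ a C, L₂ (IndB.tmulE q 𝒟 a C) = a • β (Submodule.Quotient.mk (BMod.e k C)) :=
    fun _ _ => rfl
  let L₃ : Delta q c 𝒟 →ₗ[Tw q k D] W := Submodule.liftQ _ L₂ (by
    rw [Submodule.span_le]
    rintro _ ⟨d, rfl⟩
    rw [SetLike.mem_coe, LinearMap.mem_ker, deltaRelation, map_sub, hL₂, hL₂, hβ, mul_smul, h₃,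
      sub_self])
  exact ⟨L₃, (one_smul _ _).trans hβ⟩

/-- The action is passed as a ring homomorphism so that W may already carry another module
structure. This is used for Δ_𝒟 with scalars twisted by γ. -/
lemma Delta.exists_lift_of_ringHom {W : Type*} [AddCommGroup W]
    (σ : Tw q k D →+* AddMonoid.End W) (w : W)
    (h₁ : ∀ d, σ (Tw.incl q k D (X d ^ 2)) w = 0)
    (h₂ : ∀ C ∈ 𝒟.carrier, σ (Tw.incl q k D (mon k (sqfree C))) w = 0)
    (h₃ : ∀ d, σ (Tw.incl q k D (X d ^ (q - 1))) (σ (Tw.phi q k d) w)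
      = σ (Tw.incl q k D (MvPowerSeries.C (c d : k))) w) :
    ∃ L : Delta q c 𝒟 →+ W, L (Delta.e q c 𝒟 ∅) = w ∧ ∀ a x, L (a • x) = σ a (L x) := by
  let _ : Module (Tw q k D) W := Module.compHom W σ
  obtain ⟨L, hL⟩ := Delta.exists_lift (q := q) (c := c) (𝒟 := 𝒟) w h₁ h₂ h₃
  exact ⟨L.toAddMonoidHom, hL, fun a x => map_smul L a x⟩

/-- A ring homomorphism from `k[[t_•]][φ_•]` to an endomorphism ring, from its values on
`k[[t_•]]` and on the monomials in the `φ_d`. -/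
def Tw.lift {W : Type*} [AddCommGroup W] (f : PS k D →+* AddMonoid.End W)
    (g : PhiMon q D →* AddMonoid.End W) (h : ∀ x n, f (n • x) * g n = g n * f x) :
    Tw q k D →+* AddMonoid.End W :=
  SkewMonoidAlgebra.liftNCRingHom f g fun {x n} => h x n

omit [DecidableEq D] in
lemma Tw.lift_incl {W : Type*} [AddCommGroup W] (f : PS k D →+* AddMonoid.End W)
    (g : PhiMon q D →* AddMonoid.End W) (h : ∀ x n, f (n • x) * g n = g n * f x) (x : PS k D) :
    Tw.lift f g h (Tw.incl q k D x) = f x := by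
  refine (SkewMonoidAlgebra.liftNC_single _ _ _ _).trans ?_
  rw [map_one, mul_one]; rfl

omit [DecidableEq D] in
lemma Tw.lift_single {W : Type*} [AddCommGroup W] (f : PS k D →+* AddMonoid.End W)
    (g : PhiMon q D →* AddMonoid.End W) (h : ∀ x n, f (n • x) * g n = g n * f x)
    (n : PhiMon q D) : Tw.lift f g h (SkewMonoidAlgebra.single n 1) = g n := by
  refine (SkewMonoidAlgebra.liftNC_single _ _ _ _).trans ?_
  change f 1 * g n = g n
  rw [map_one, one_mul]

end Lift

/-! ### The monomial basis of `Δ_𝒟` -/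

section Basis

open MvPowerSeries

variable {k D : Type*} [Field k] [Fintype D] [DecidableEq D] {q : ℕ} [NeZero q] {c : D → kˣ}
  {𝒟 : Family D}

instance : IsScalarTower k (PS k D) (Delta q c 𝒟) where
  smul_assoc a f x := by
    rw [MvPowerSeries.smul_eq_C_mul, mul_smul, Delta.smul_eq']

/-- The action of the monomials in the `φ_d` on `Δ_𝒟`. -/
def Delta.phiEnd (q : ℕ) [NeZero q] (c : D → kˣ) (𝒟 : Family D) :
    PhiMon q D →* AddMonoid.End (Delta q c 𝒟) :=
  ((Module.toAddMonoidEnd (Tw q k D) (Delta q c 𝒟)) : Tw q k D →* _).comp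
    (SkewMonoidAlgebra.of (PS k D) (PhiMon q D))

lemma Delta.phiEnd_apply (n : PhiMon q D) (x : Delta q c 𝒟) :
    Delta.phiEnd q c 𝒟 n x = (SkewMonoidAlgebra.single n 1 : Tw q k D) • x := rfl

lemma Delta.phiEnd_mul (m n : PhiMon q D) (x : Delta q c 𝒟) :
    Delta.phiEnd q c 𝒟 (m * n) x = Delta.phiEnd q c 𝒟 m (Delta.phiEnd q c 𝒟 n x) := by
  rw [map_mul]; rfl

lemma Delta.phiEnd_phi (d : D) (x : Delta q c 𝒟) :
    Delta.phiEnd q c 𝒟 (PhiMon.phi q d) x = Delta.phi q c 𝒟 d x := rfl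

lemma Delta.phiEnd_smul (n : PhiMon q D) (f : PS k D) (x : Delta q c 𝒟) :
    Delta.phiEnd q c 𝒟 n (f • x) = (n • f) • Delta.phiEnd q c 𝒟 n x := by
  rw [Delta.phiEnd_apply, Delta.phiEnd_apply, Delta.smul_eq, Delta.smul_eq, ← mul_smul, ← mul_smul]
  congr 1
  simp [Tw.incl, SkewMonoidAlgebra.single_mul_single]

lemma Delta.phiEnd_smul_k (n : PhiMon q D) (a : k) (x : Delta q c 𝒟) :
    Delta.phiEnd q c 𝒟 n (a • x) = a • Delta.phiEnd q c 𝒟 n x := by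
  rw [Delta.smul_eq', Delta.phiEnd_smul, smul_C, Delta.smul_eq']

lemma Delta.induction {p : Delta q c 𝒟 → Prop}
    (h : ∀ (f : PS k D) (n : PhiMon q D), p (f • Delta.phiEnd q c 𝒟 n (Delta.e q c 𝒟 ∅)))
    (hadd : ∀ x y, p x → p y → p (x + y)) (x : Delta q c 𝒟) : p x := by
  obtain ⟨a, rfl⟩ := Delta.exists_smul_e x
  induction a using SkewMonoidAlgebra.induction_on with
  | zero =>
    have := h 0 1
    rwa [zero_smul, ← zero_smul (Tw q k D) (Delta.e q c 𝒟 ∅)] at this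
  | single n f =>
    have := h f n
    rw [Delta.phiEnd_apply, Delta.smul_eq, ← mul_smul] at this
    simpa [Tw.incl, SkewMonoidAlgebra.single_mul_single] using this
  | add a b ha hb => rw [add_smul]; exact hadd _ _ ha hb

/-- The exponent `(1, …, 1)`. -/
abbrev ones (D : Type*) [Fintype D] [DecidableEq D] : D →₀ ℕ := sqfree Finset.univ

lemma ones_apply (d : D) : ones D d = 1 := by simp [sqfree_apply]

lemma sqfree_le_ones (C : Finset D) : sqfree C ≤ ones D := fun d => by
  rw [ones_apply, sqfree_apply]; split_ifs <;> simp

lemma zeroSet_ones_sub (C : Finset D) : zeroSet (ones D - sqfree C) = C := by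
  ext d
  rw [mem_zeroSet, Finsupp.tsub_apply, ones_apply, sqfree_apply]
  split_ifs with h <;> simp [h]

omit [DecidableEq D] in
lemma sc_tsub {n : PhiMon q D} {i j : D →₀ ℕ} (h : j ≤ i) : sc n (i - j) = sc n i - sc n j := by
  rw [eq_tsub_iff_add_eq_of_le (sc_le_sc_iff.mpr h), ← map_add, tsub_add_cancel_of_le h]

lemma sc_mul_ones (m n : PhiMon q D) :
    sc (m * n) (ones D) = sc m (ones D) + sc m (sc n (ones D) - ones D) := by
  rw [sc_mul, ← map_add, add_tsub_cancel_of_le (le_sc n (ones D))]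

omit [NeZero q] in
lemma sc_phi_ones_sub (d : D) :
    sc (PhiMon.phi q d) (ones D) - ones D = Finsupp.single d (q - 1) := by
  ext d'
  rw [Finsupp.tsub_apply, sc_apply, ones_apply, PhiMon.exp_phi, mul_one]
  by_cases h : d' = d
  · subst h; simp
  · rw [Finsupp.single_eq_of_ne h, if_neg h, pow_zero, tsub_self]

/-- The exponents q^(n_d) - 1 satisfy the cocycle rule `sc_mul_ones`, so the relation for the
generators φ_d propagates to all monomials in them. -/
lemma Delta.mon_smul_phiEnd_e (n : PhiMon q D) :
    mon k (sc n (ones D) - ones D) • Delta.phiEnd q c 𝒟 n (Delta.e q c 𝒟 ∅)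
      = (cPow c n : k) • Delta.e q c 𝒟 ∅ := by
  let S : Submonoid (PhiMon q D) :=
    { carrier := {n | mon k (sc n (ones D) - ones D) • Delta.phiEnd q c 𝒟 n (Delta.e q c 𝒟 ∅)
        = (cPow c n : k) • Delta.e q c 𝒟 ∅}
      one_mem' := by
        change _ • _ = _ • _
        rw [sc_one, tsub_self, mon_zero, one_smul, map_one, map_one, Units.val_one, one_smul]
        rfl
      mul_mem' := fun {m n} hm hn => by
        change _ • _ = _ • _ at hm hn ⊢
        rw [sc_mul_ones, ← tsub_add_eq_add_tsub (le_sc m (ones D)), mon_add, mul_smul,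
          Delta.phiEnd_mul, ← smul_mon, ← Delta.phiEnd_smul, hn, Delta.phiEnd_smul_k,
          smul_comm, hm, smul_smul, map_mul, Units.val_mul, mul_comm] }
  refine PhiMon.mem_of_phi_mem S (fun d => ?_) n
  change _ • _ = _ • _
  rw [sc_phi_ones_sub, ← X_pow_eq_mon, Delta.phiEnd_phi, Delta.relation, cPow_phi]

/-- The exponents of a monomial as the exponents of an element of `PhiMon q D`. -/
def PhiMon.ofFinsupp (q : ℕ) (i : D →₀ ℕ) : PhiMon q D := Multiplicative.ofAdd ⇑i

/-- The basis element of `Δ_𝒟` with index `i` (it vanishes if the set of zeros of `i` belongs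
to `𝒟`). -/
def Delta.x (q : ℕ) [NeZero q] (c : D → kˣ) (𝒟 : Family D) (i : D →₀ ℕ) : Delta q c 𝒟 :=
  ((cPow c (PhiMon.ofFinsupp q i))⁻¹ : kˣ).val • mon k (sc (PhiMon.ofFinsupp q i) (ones D) - i)
    • Delta.phiEnd q c 𝒟 (PhiMon.ofFinsupp q i) (Delta.e q c 𝒟 ∅)

/-- Enlarging n does not change c^(-n) t^(q^n - i) φ^n e_∅: the additional factor is φ^n applied to
t^(q^m - 1) φ^m e_∅ = c^m e_∅. Hence x_i may be computed with any sufficiently large n. -/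
lemma Delta.smul_phiEnd_mul {n : PhiMon q D} {i : D →₀ ℕ} (h : i ≤ sc n (ones D))
    (m : PhiMon q D) :
    ((cPow c (n * m))⁻¹ : kˣ).val • mon k (sc (n * m) (ones D) - i)
      • Delta.phiEnd q c 𝒟 (n * m) (Delta.e q c 𝒟 ∅)
    = ((cPow c n)⁻¹ : kˣ).val • mon k (sc n (ones D) - i)
      • Delta.phiEnd q c 𝒟 n (Delta.e q c 𝒟 ∅) := by
  rw [sc_mul_ones, ← tsub_add_eq_add_tsub h, mon_add, mul_smul,
    Delta.phiEnd_mul, ← smul_mon, ← Delta.phiEnd_smul, Delta.mon_smul_phiEnd_e,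
    Delta.phiEnd_smul_k, smul_comm (mon k (sc n (ones D) - i)), smul_smul, map_mul, mul_inv,
    Units.val_mul, mul_assoc, ← Units.val_mul, inv_mul_cancel, Units.val_one, mul_one]

-- The crude choice n_d = i_d in the definition of x_i is large enough because a < q^a.
omit [NeZero q] in
lemma le_sc_ofFinsupp (hq : 1 < q) (i : D →₀ ℕ) : i ≤ sc (PhiMon.ofFinsupp q i) (ones D) :=
  fun d => by
    rw [sc_apply, ones_apply, mul_one]
    exact (Nat.lt_pow_self hq).le

lemma Delta.x_eq (hq : 1 < q) {n : PhiMon q D} {i : D →₀ ℕ} (h : i ≤ sc n (ones D)) :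
    Delta.x q c 𝒟 i = ((cPow c n)⁻¹ : kˣ).val • mon k (sc n (ones D) - i)
      • Delta.phiEnd q c 𝒟 n (Delta.e q c 𝒟 ∅) := by
  rw [Delta.x, ← Delta.smul_phiEnd_mul (le_sc_ofFinsupp hq i) n, mul_comm,
    Delta.smul_phiEnd_mul h]

lemma Delta.mon_smul_x (hq : 1 < q) {i j : D →₀ ℕ} (h : j ≤ i) :
    mon k j • Delta.x q c 𝒟 i = Delta.x q c 𝒟 (i - j) := by
  have hi := le_sc_ofFinsupp hq i
  rw [Delta.x, Delta.x_eq hq (tsub_le_self.trans hi), smul_comm, ← mul_smul, ← mon_add,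
    tsub_tsub_assoc hi h, add_comm]

lemma Delta.phiEnd_x (hq : 1 < q) (n : PhiMon q D) (i : D →₀ ℕ) :
    Delta.phiEnd q c 𝒟 n (Delta.x q c 𝒟 i) = (cPow c n : k) • Delta.x q c 𝒟 (sc n i) := by
  have hi := le_sc_ofFinsupp hq i
  have hi' : sc n i ≤ sc (n * PhiMon.ofFinsupp q i) (ones D) := by
    rw [sc_mul]; exact sc_le_sc_iff.mpr hi
  rw [Delta.x, Delta.x_eq hq hi', Delta.phiEnd_smul_k, Delta.phiEnd_smul, smul_mon, sc_tsub hi,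
    Delta.phiEnd_mul, sc_mul, smul_smul, map_mul, mul_inv, ← Units.val_mul,
    mul_inv_cancel_left]

lemma Delta.e_empty_eq_x (hq : 1 < q) : Delta.e q c 𝒟 ∅ = Delta.x q c 𝒟 (ones D) := by
  have h : ones D ≤ sc (1 : PhiMon q D) (ones D) := (sc_one _).ge
  rw [Delta.x_eq hq h, sc_one, tsub_self, mon_zero, one_smul, map_one, map_one, inv_one,
    Units.val_one, one_smul]
  rfl

lemma Delta.e_eq_x (hq : 1 < q) (C : Finset D) :
    Delta.e q c 𝒟 C = Delta.x q c 𝒟 (ones D - sqfree C) := by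
  rw [Delta.e_eq, Delta.e_empty_eq_x hq, Delta.mon_smul_x hq (sqfree_le_ones C)]

/-- As e_C = x_(1-C), the operator φ^n takes it to a multiple of the x with exponent 0 on C and
q^(n_d) elsewhere. For n = i this exponent dominates i, and multiplication by a monomial lowers it
to i. -/
lemma Delta.exists_x_eq (hq : 1 < q) {i : D →₀ ℕ} {C : Finset D} (hC : C ⊆ zeroSet i) :
    ∃ f : PS k D, Delta.x q c 𝒟 i
      = f • Delta.phiEnd q c 𝒟 (PhiMon.ofFinsupp q i) (Delta.e q c 𝒟 C) := by
  have hi : i ≤ sc (PhiMon.ofFinsupp q i) (ones D - sqfree C) := fun d => by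
    rw [sc_apply, Finsupp.tsub_apply, ones_apply, sqfree_apply]
    split_ifs with h
    · have := mem_zeroSet.mp (hC h)
      rw [this]; exact Nat.zero_le _
    · rw [tsub_zero, mul_one]
      exact (Nat.lt_pow_self hq).le
  refine ⟨mon k (sc (PhiMon.ofFinsupp q i) (ones D - sqfree C) - i)
    * MvPowerSeries.C ((cPow c (PhiMon.ofFinsupp q i))⁻¹ : kˣ).val, ?_⟩
  rw [Delta.e_eq_x hq, Delta.phiEnd_x hq, mul_smul, ← Delta.smul_eq', smul_smul, ← Units.val_mul,
    inv_mul_cancel, Units.val_one, one_smul, Delta.mon_smul_x hq tsub_le_self,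
    tsub_tsub_cancel_of_le hi]

lemma Delta.x_eq_zero (hq : 1 < q) {i : D →₀ ℕ} (hi : zeroSet i ∈ 𝒟.carrier) :
    Delta.x q c 𝒟 i = 0 := by
  obtain ⟨f, hf⟩ := Delta.exists_x_eq (k := k) (c := c) (𝒟 := 𝒟) hq (subset_refl (zeroSet i))
  rw [hf, Delta.e_eq_zero hi, map_zero, smul_zero]

/-- Since i_d = 0, the operator φ^i commutes with t_d, and t_d kills e_{d} because t_d² e_∅ = 0. -/
lemma Delta.X_smul_x_eq_zero (hq : 1 < q) {i : D →₀ ℕ} {d : D} (hd : i d = 0) :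
    (X d : PS k D) • Delta.x q c 𝒟 i = 0 := by
  obtain ⟨f, hf⟩ := Delta.exists_x_eq (k := k) (c := c) (𝒟 := 𝒟) hq
    (Finset.singleton_subset_iff.mpr (mem_zeroSet.mpr hd))
  have h1 : PhiMon.ofFinsupp q i • (X d : PS k D) = X d := by
    rw [smul_X]
    change X d ^ q ^ i d = _
    rw [hd, pow_zero, pow_one]
  have h2 : (X d : PS k D) • Delta.e q c 𝒟 {d} = 0 := by
    have : sqfree {d} = Finsupp.single d 1 := by
      ext d'; simp [sqfree_apply, Finsupp.single_apply, eq_comm]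
    rw [Delta.e_eq, this, ← X_eq_mon, smul_smul, ← pow_two, Delta.X_sq_smul_e]
  rw [hf, smul_comm]
  conv_lhs => rw [← h1]
  rw [← Delta.phiEnd_smul, h2, map_zero, smul_zero]

lemma Delta.X_pow_smul_x_eq_zero (hq : 1 < q) (i : D →₀ ℕ) (d : D) :
    (X d : PS k D) ^ (i d + 1) • Delta.x q c 𝒟 i = 0 := by
  have h : Finsupp.single d (i d) ≤ i := Finsupp.single_le_iff.mpr le_rfl
  rw [pow_succ', mul_smul, X_pow_eq_mon, Delta.mon_smul_x hq h, Delta.X_smul_x_eq_zero hq]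
  simp

/-- Since t_d^(i_d + 1) x_i = 0, f may be replaced by its polynomial truncation `T` at exponents ≤
i. The resulting convolution is dual to multiplication of power series. -/
lemma Delta.smul_x (hq : 1 < q) (f : PS k D) (i : D →₀ ℕ) :
    f • Delta.x q c 𝒟 i
      = ∑ p ∈ Finset.HasAntidiagonal.antidiagonal i, coeff p.1 f • Delta.x q c 𝒟 p.2 := by
  let T : PS k D := ∑ p ∈ Finset.HasAntidiagonal.antidiagonal i, coeff p.1 f • mon k p.1
  have h1 : (f - T) • Delta.x q c 𝒟 i = 0 := by
    refine smul_eq_zero_of_coeff_eq_zero (Delta.X_pow_smul_x_eq_zero hq i) fun a ha => ?_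
    rw [map_sub, sub_eq_zero, map_sum, Finset.sum_eq_single (a, i - a)]
    · rw [map_smul, mon, coeff_monomial_same, smul_eq_mul, mul_one]
    · rintro ⟨u, v⟩ hp hne
      rw [Finset.HasAntidiagonal.mem_antidiagonal] at hp
      dsimp only at hp ⊢
      rw [map_smul, mon, coeff_monomial_ne, smul_zero]
      rintro rfl
      refine hne (Prod.ext rfl ?_)
      rw [← hp]
      exact (add_tsub_cancel_left _ _).symm
    · intro h
      exact absurd (Finset.HasAntidiagonal.mem_antidiagonal.mpr (add_tsub_cancel_of_le ha)) h
  rw [sub_smul, sub_eq_zero] at h1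
  rw [h1, Finset.sum_smul]
  refine Finset.sum_congr rfl fun p hp => ?_
  rw [Finset.HasAntidiagonal.mem_antidiagonal] at hp
  rw [smul_assoc, Delta.mon_smul_x hq (hp ▸ le_self_add), ← hp, add_tsub_cancel_left]

lemma Delta.span_x (hq : 1 < q) : Submodule.span k (Set.range (Delta.x q c 𝒟)) = ⊤ := by
  rw [eq_top_iff]
  rintro y -
  refine Delta.induction (fun f n => ?_) (fun _ _ => add_mem) y
  rw [Delta.e_empty_eq_x hq, Delta.phiEnd_x hq, smul_comm, Delta.smul_x hq]
  exact Submodule.smul_mem _ _ (Submodule.sum_mem _ fun p _ =>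
    Submodule.smul_mem _ _ (Submodule.subset_span ⟨_, rfl⟩))

/-- The pairing between `Δ_𝒟` and the ideal attached to `𝒟`. -/
lemma Delta.exists_dual (hq : 1 < q) {g : PS k D} (hg : g ∈ famIdeal k 𝒟) :
    ∃ l : Delta q c 𝒟 →ₗ[k] k, ∀ i, l (Delta.x q c 𝒟 i) = coeff i g := by
  let I := famIdeal k 𝒟
  -- The target of the lift is the space of linear forms on the ideal, on which operators act by
  -- precomposition, hence the opposite ring.
  let pre : (Module.End k I)ᵐᵒᵖ →+* AddMonoid.End (I →ₗ[k] k) :=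
    { toFun := fun E =>
        { toFun := fun L => L ∘ₗ E.unop
          map_zero' := rfl
          map_add' := fun _ _ => rfl }
      map_one' := rfl
      map_mul' := fun _ _ => rfl
      map_zero' := by ext L x; exact map_zero L
      map_add' := fun E E' => by ext L x; exact map_add L _ _ }
  let f : PS k D →+* AddMonoid.End (I →ₗ[k] k) := pre.comp
    ((Algebra.lsmul k k I : PS k D →ₐ[k] Module.End k I).toRingHom.toOpposite
      fun a b => Commute.map (Commute.all a b) _)
  have hf : ∀ a L x, f a L x = L (a • x) := fun _ _ _ => rfl
  -- φ^n is to act on linear forms as the transpose of c^n times the standard ψ-operator, which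
  -- preserves the ideal.
  let ψ : PhiMon q D → Module.End k I := fun n =>
    { toFun := fun x => ⟨(cPow c n : k) • psiCan n x.1,
        Submodule.smul_of_tower_mem I _ (psiCan_mem_famIdeal n x.2)⟩
      map_add' := fun x y => Subtype.ext (by simp)
      map_smul' := fun a x => Subtype.ext (by
        change (cPow c n : k) • psiCan n (a • x.1) = a • (cPow c n : k) • psiCan n x.1
        rw [map_smul, smul_comm]) }
  have hψ : ∀ n x, (ψ n x).1 = (cPow c n : k) • psiCan n x.1 := fun _ _ => rfl
  let φ : PhiMon q D →* AddMonoid.End (I →ₗ[k] k) :=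
    { toFun := fun n => pre (MulOpposite.op (ψ n))
      map_one' := by
        rw [← map_one pre]
        congr 1
        apply MulOpposite.unop_injective
        ext x
        change coeff _ (ψ 1 x).1 = coeff _ x.1
        rw [hψ, map_one, Units.val_one, one_smul, psiCan_one]
      map_mul' := fun m n => by
        rw [← map_mul pre]
        congr 1
        apply MulOpposite.unop_injective
        ext x
        change coeff _ (ψ (m * n) x).1 = coeff _ (ψ n (ψ m x)).1
        rw [hψ, hψ, hψ, map_mul, LinearMap.map_smul (psiCan n), mul_comm m n, psiCan_mul, smul_smul,
          Units.val_mul, mul_comm] }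
  have hφ : ∀ n L x, φ n L x = L (ψ n x) := fun _ _ _ => rfl
  have hcomm : ∀ a n, f (n • a) * φ n = φ n * f a := fun a n => by
    ext L x
    change L (ψ n ((n • a) • x)) = L (a • ψ n x)
    congr 1
    refine Subtype.ext ?_
    change (cPow c n : k) • psiCan n ((n • a) * x.1) = a * ((cPow c n : k) • psiCan n x.1)
    rw [psiCan_smul_mul, mul_smul_comm]
  -- As e_∅ is x_(1,…,1), its image must be the coefficient at (1,…,1).
  let w : I →ₗ[k] k := (coeff (ones D)) ∘ₗ I.subtype.restrictScalars k
  have hw : ∀ x, w x = coeff (ones D) x.1 := fun _ => rfl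
  obtain ⟨L, hL₁, hL₂⟩ := Delta.exists_lift_of_ringHom (c := c) (𝒟 := 𝒟) (Tw.lift f φ hcomm) w
    (fun d => by
      ext x
      rw [Tw.lift_incl, hf, hw, X_pow_eq_mon]
      change coeff (ones D) (mon k _ * x.1) = 0
      rw [coeff_mon_mul, if_neg]
      rw [Finsupp.single_le_iff, ones_apply]
      decide)
    -- This composite reads the coefficient at 1 - C, whose set of zeros is C ∈ 𝒟; it vanishes on
    -- the ideal.
    (fun C hC => by
      ext x
      rw [Tw.lift_incl, hf, hw]
      change coeff (ones D) (mon k _ * x.1) = 0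
      rw [coeff_mon_mul, if_pos (sqfree_le_ones C)]
      exact x.2 _ (by rwa [zeroSet_ones_sub]))
    (fun d => by
      ext x
      rw [Tw.lift_incl, Tw.lift_incl, Tw.phi, Tw.lift_single, hf, hf, hφ, hw, hw, hψ, cPow_phi,
        map_smul, coeff_psiCan, X_pow_eq_mon, ← sc_phi_ones_sub]
      change (c d : k) • coeff _ (mon k _ * x.1) = coeff _ (MvPowerSeries.C (c d : k) * x.1)
      rw [coeff_mon_mul, if_pos tsub_le_self, tsub_tsub_cancel_of_le (le_sc _ _), coeff_C_mul,
        smul_eq_mul])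
  have hL₃ : ∀ (a : PS k D) y (x : I), L (a • y) x = L y (a • x) := fun a y x => by
    rw [Delta.smul_eq, hL₂, Tw.lift_incl, hf]
  refine ⟨{ toFun := fun y => L y ⟨g, hg⟩
            map_add' := fun y z => by rw [map_add]; rfl
            map_smul' := fun a y => ?_ }, fun i => ?_⟩
  · rw [Delta.smul_eq', hL₃, RingHom.id_apply, ← map_smul]
    congr 1
    refine Subtype.ext ?_
    exact (MvPowerSeries.smul_eq_C_mul _ _).symm
  · change L (Delta.x q c 𝒟 i) ⟨g, hg⟩ = _
    have hi := le_sc_ofFinsupp hq i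
    rw [Delta.x, Delta.smul_eq', hL₃, hL₃, Delta.phiEnd_apply, hL₂, Tw.lift_single, hφ, hL₁, hw, hψ,
      map_smul, coeff_psiCan]
    change _ • coeff _ (mon k _ * (MvPowerSeries.C _ * g)) = _
    rw [coeff_mon_mul, if_pos tsub_le_self, tsub_tsub_cancel_of_le hi, coeff_C_mul, smul_eq_mul,
      ← mul_assoc, ← Units.val_mul, mul_inv_cancel, Units.val_one, one_mul]

end Basis

/-! ### Finiteness properties of `Δ_𝒟` -/

section Finiteness

open MvPowerSeries

variable {k D : Type*} [Field k] [Fintype D] [DecidableEq D] {q : ℕ} [NeZero q] {c : D → kˣ}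
  {𝒟 : Family D}

lemma Delta.moduleFinite : Module.Finite (Tw q k D) (Delta q c 𝒟) := by
  refine ⟨⟨{Delta.e q c 𝒟 ∅}, ?_⟩⟩
  rw [eq_top_iff]
  rintro x -
  obtain ⟨a, rfl⟩ := Delta.exists_smul_e x
  exact Submodule.smul_mem _ _ (Submodule.subset_span (by simp))

lemma Delta.induction_x (hq : 1 < q) {p : Delta q c 𝒟 → Prop} (h : ∀ i, p (Delta.x q c 𝒟 i))
    (hadd : ∀ x y, p x → p y → p (x + y)) (hsmul : ∀ (a : k) x, p x → p (a • x))
    (x : Delta q c 𝒟) : p x := by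
  have hx : x ∈ Submodule.span k (Set.range (Delta.x q c 𝒟)) := by
    rw [Delta.span_x hq]; trivial
  induction hx using Submodule.span_induction with
  | mem x hx => obtain ⟨i, rfl⟩ := hx; exact h i
  | zero => simpa using hsmul 0 _ (h 0)
  | add x y _ _ hx hy => exact hadd x y hx hy
  | smul a x _ hx => exact hsmul a x hx

lemma Delta.exists_X_pow_smul_eq_zero (hq : 1 < q) (d : D) (x : Delta q c 𝒟) :
    ∃ N, (X d : PS k D) ^ N • x = 0 := by
  induction x using Delta.induction_x hq with
  | h i => exact ⟨_, Delta.X_pow_smul_x_eq_zero hq i d⟩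
  | hadd x y hx hy =>
    obtain ⟨M, hM⟩ := hx
    obtain ⟨N, hN⟩ := hy
    refine ⟨M + N, ?_⟩
    rw [smul_add, pow_add, mul_smul, mul_smul, hN, smul_zero, smul_comm, hM, smul_zero, add_zero]
  | hsmul a x hx =>
    obtain ⟨N, hN⟩ := hx
    exact ⟨N, by rw [smul_comm, hN, smul_zero]⟩

/-- Expand x in the x_i. Terms with i ≤ (1,…,1) are the e_C. A term with i_d ≥ 2 and x_i ≠ 0 would
survive multiplication by t_d, as a linear form dual to x_(i - 1_d) detects. -/
lemma Delta.mem_span_e (hq : 1 < q) {x : Delta q c 𝒟} (hx : ∀ d, (X d : PS k D) • x = 0) :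
    x ∈ Submodule.span k (Set.range (Delta.e q c 𝒟)) := by
  have h := (Delta.span_x (c := c) (𝒟 := 𝒟) hq).ge (Submodule.mem_top (x := x))
  rw [Finsupp.mem_span_range_iff_exists_finsupp] at h
  obtain ⟨a, rfl⟩ := h
  refine Submodule.sum_mem _ fun i hi => Submodule.smul_mem _ _ ?_
  by_cases hZ : zeroSet i ∈ 𝒟.carrier
  · rw [Delta.x_eq_zero hq hZ]; exact zero_mem _
  by_cases hle : i ≤ ones D
  · have : i = ones D - sqfree (zeroSet i) := by
      ext d
      have := hle d
      rw [ones_apply] at this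
      rw [Finsupp.tsub_apply, ones_apply, sqfree_apply]
      simp only [mem_zeroSet]
      split_ifs <;> omega
    rw [this, ← Delta.e_eq_x hq]
    exact Submodule.subset_span ⟨_, rfl⟩
  exfalso
  obtain ⟨d, hd⟩ : ∃ d, 1 < i d := by
    by_contra! h
    exact hle fun d => by rw [ones_apply]; exact h d
  have hdi : Finsupp.single d 1 ≤ i := Finsupp.single_le_iff.mpr hd.le
  -- Since i_d > 1, lowering i_d by one creates no new zero exponent.
  have hg : mon k (i - Finsupp.single d 1) ∈ famIdeal k 𝒟 := by
    rw [mon_mem_famIdeal]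
    refine fun h => hZ (𝒟.upper _ h _ fun e he => ?_)
    rw [mem_zeroSet, Finsupp.tsub_apply] at he
    rw [mem_zeroSet]
    by_cases hed : e = d
    · subst hed
      rw [Finsupp.single_eq_same] at he
      omega
    · rwa [Finsupp.single_eq_of_ne hed] at he
  obtain ⟨l, hl⟩ := Delta.exists_dual (c := c) hq hg
  have h1 := congrArg l (hx d)
  rw [Finsupp.sum, Finset.smul_sum, map_sum, map_zero, Finset.sum_eq_single i] at h1
  · rw [smul_comm, map_smul, X_eq_mon, Delta.mon_smul_x hq hdi, hl, mon, coeff_monomial_same,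
      smul_eq_mul, mul_one] at h1
    exact Finsupp.mem_support_iff.mp hi h1
  · intro j _ hj
    rw [smul_comm, map_smul]
    by_cases hjd : j d = 0
    · rw [Delta.X_smul_x_eq_zero hq hjd, map_zero, smul_zero]
    · have hdj : Finsupp.single d 1 ≤ j :=
        Finsupp.single_le_iff.mpr (Nat.one_le_iff_ne_zero.mpr hjd)
      rw [X_eq_mon, Delta.mon_smul_x hq hdj, hl, mon, coeff_monomial_ne, smul_zero]
      intro h
      refine hj ?_
      rw [← tsub_add_cancel_of_le hdj, h, tsub_add_cancel_of_le hdi]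
  · intro h
    exact absurd hi h

lemma Delta.isAdmissible (hq : 1 < q) : IsAdmissible k D (Delta q c 𝒟) where
  torsion d x := by
    obtain ⟨N, hN⟩ := Delta.exists_X_pow_smul_eq_zero hq d x
    refine ⟨PowerSeries.X ^ N, pow_ne_zero _ PowerSeries.X_ne_zero, ?_⟩
    rw [PowerSeries.subst_pow (PowerSeries.HasSubst.X d), PowerSeries.subst_X
      (PowerSeries.HasSubst.X d), hN]
  finite := ⟨Submodule.span k (Set.range (Delta.e q c 𝒟)),
    FiniteDimensional.span_of_finite k (Set.finite_range _), fun _ => Delta.mem_span_e hq⟩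

lemma Delta.span_range_phi (hq : 1 < q) (d : D) :
    Submodule.span (PS k D) (Set.range (Delta.phi q c 𝒟 d)) = ⊤ := by
  rw [eq_top_iff]
  rintro x -
  induction x using Delta.induction_x hq with
  | h i =>
    have h1 := Delta.phiEnd_x (c := c) (𝒟 := 𝒟) hq (PhiMon.phi q d) i
    have h2 : Delta.x q c 𝒟 i = (MvPowerSeries.C ((c d)⁻¹ : kˣ).val
        * mon k (sc (PhiMon.phi q d) i - i)) • Delta.phi q c 𝒟 d (Delta.x q c 𝒟 i) := by
      rw [← Delta.phiEnd_phi, h1, cPow_phi, mul_smul, smul_comm (mon k _), ← Delta.smul_eq',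
        smul_smul, ← Units.val_mul, inv_mul_cancel, Units.val_one, one_smul,
        Delta.mon_smul_x hq tsub_le_self, tsub_tsub_cancel_of_le (le_sc _ _)]
    rw [h2]
    exact Submodule.smul_mem _ _ (Submodule.subset_span ⟨_, rfl⟩)
  | hadd x y hx hy => exact add_mem hx hy
  | hsmul a x hx => rw [Delta.smul_eq']; exact Submodule.smul_mem _ _ hx

end Finiteness

/-! ### The action of `Γ_•` on `Δ_𝒟` -/

section GammaDelta

open MvPowerSeries

variable {O κ k D : Type*} [CommRing O] [Field κ] [Field k] [Fintype D] [DecidableEq D] {q : ℕ}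
  [NeZero q] {π : O} {r : O →+* κ} {Φ : PowerSeries O} {j : κ →+* k} {c : D → kˣ} {𝒟 : Family D}

lemma IsGammaAction.phiEnd {red : O →+* k} {m : D → ZMod (q - 1)}
    {ρ : (D → Oˣ) →* Module.End k (Delta q c 𝒟)} (hρ : IsGammaAction q c 𝒟 Φ red m ρ) (γ : D → Oˣ)
    (n : PhiMon q D) (x : Delta q c 𝒟) :
    ρ γ (Delta.phiEnd q c 𝒟 n x) = Delta.phiEnd q c 𝒟 n (ρ γ x) := by
  let S : Submonoid (PhiMon q D) :=
    { carrier := {n | ∀ x, ρ γ (Delta.phiEnd q c 𝒟 n x) = Delta.phiEnd q c 𝒟 n (ρ γ x)}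
      one_mem' := fun x => by rw [map_one]; rfl
      mul_mem' := fun {m n} hm hn x => by
        rw [Delta.phiEnd_mul, hm, hn, Delta.phiEnd_mul] }
  exact PhiMon.mem_of_phi_mem S (fun d x => hρ.phi γ d x) n x

lemma Delta.gamma_unique {red : O →+* k} {m : D → ZMod (q - 1)}
    {ρ ρ' : (D → Oˣ) →* Module.End k (Delta q c 𝒟)} (hρ : IsGammaAction q c 𝒟 Φ red m ρ)
    (hρ' : IsGammaAction q c 𝒟 Φ red m ρ') : ρ = ρ' := by
  ext γ x
  induction x using Delta.induction with
  | h f n => rw [hρ.smul, hρ'.smul, hρ.phiEnd, hρ'.phiEnd, hρ.e, hρ'.e]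
  | hadd x y hx hy => rw [map_add, map_add, hx, hy]

omit [DecidableEq D] [NeZero q] in
lemma gammaScalar_mul [DecidableEq D] (red : O →+* k) (m : D → ZMod (q - 1)) (γ δ : D → Oˣ)
    (C : Finset D) :
    gammaScalar q red m (γ * δ) C = gammaScalar q red m γ C * gammaScalar q red m δ C := by
  simp [gammaScalar, mul_pow, Finset.prod_mul_distrib]

omit [NeZero q] in
lemma gammaScalar_one (red : O →+* k) (m : D → ZMod (q - 1)) (C : Finset D) :
    gammaScalar q red m (1 : D → Oˣ) C = 1 := by
  simp [gammaScalar]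

omit [NeZero q] in
lemma gammaScalar_eq (red : O →+* k) (m : D → ZMod (q - 1)) (γ : D → Oˣ) (C : Finset D) :
    gammaScalar q red m γ C = gammaScalar q red m γ ∅ * ∏ d ∈ C, red (γ d : O) := by
  simp only [gammaScalar, pow_add, Finset.prod_mul_distrib, Finset.notMem_empty, if_false, pow_zero,
    mul_one]
  congr 1
  simp [pow_ite, Finset.prod_ite_mem]

lemma mon_sqfree (C : Finset D) : mon k (sqfree C) = ∏ d ∈ C, X d := by
  rw [mon_eq_prod, ← Finset.prod_subset (Finset.subset_univ C)]
  · exact Finset.prod_congr rfl fun d hd => by rw [sqfree_apply, if_pos hd, pow_one]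
  · intro d _ hd
    rw [sqfree_apply, if_neg hd, pow_zero]

section

variable (hO : IsLubinTateBase q π r) (hΦ : IsLubinTate q π Φ) (h2 : π ^ 2 ∣ PowerSeries.coeff 2 Φ)
include hO hΦ h2

/-- Each factor γ(t_d) is γ_d t_d plus a multiple of t_d², and the latter kills e_∅. -/
lemma gammaPS_mon_smul_e (γ : D → Oˣ) (C : Finset D) :
    gammaPS Φ (j.comp r) γ (mon k (sqfree C)) • Delta.e q c 𝒟 ∅
      = (∏ d ∈ C, j.comp r (γ d : O)) • Delta.e q c 𝒟 C := by
  rw [mon_sqfree, Delta.e_eq C, mon_sqfree, map_prod]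
  induction C using Finset.induction_on with
  | empty => simp
  | insert d C hd ih =>
    obtain ⟨h, hh⟩ := exists_mulSeriesAt_eq (k := k) (j := j) hO hΦ h2 (γ d : O) d
    rw [Finset.prod_insert hd, Finset.prod_insert hd, Finset.prod_insert hd, mul_smul, ih,
      gammaPS_X, hh]
    rw [smul_comm _ (∏ d ∈ C, j.comp r (γ d : O)), smul_smul,
      show X d * (MvPowerSeries.C (j (r (γ d))) + X d ^ 2 * h) * ∏ d ∈ C, X d
        = (X d * ∏ d ∈ C, X d) * MvPowerSeries.C (j (r (γ d))) + (X d * h * ∏ d ∈ C, X d) * X d ^ 2 by ring,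
      add_smul, mul_smul _ (X d ^ 2), Delta.X_sq_smul_e, smul_zero, add_zero, mul_smul _ (MvPowerSeries.C _),
      ← Delta.smul_eq', smul_comm _ (j (r (γ d : O))), smul_smul, mul_comm]
    rfl

/-- Apply the universal property to Δ_𝒟 with k[[t_•]] acting through γ. This twisted action is
compatible with the φ_d because γ commutes with them on power series. -/
lemma Delta.exists_gammaMap (m : D → ZMod (q - 1)) (γ : D → Oˣ) :
    ∃ L : Delta q c 𝒟 →ₗ[k] Delta q c 𝒟,
      (∀ f x, L (f • x) = gammaPS Φ (j.comp r) γ f • L x) ∧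
      (∀ n x, L (Delta.phiEnd q c 𝒟 n x) = Delta.phiEnd q c 𝒟 n (L x)) ∧
      L (Delta.e q c 𝒟 ∅) = gammaScalar q (j.comp r) m γ ∅ • Delta.e q c 𝒟 ∅ := by
  let f : PS k D →+* AddMonoid.End (Delta q c 𝒟) :=
    (Module.toAddMonoidEnd (PS k D) (Delta q c 𝒟)).comp (gammaPS Φ (j.comp r) γ).toRingHom
  have hf : ∀ a x, f a x = gammaPS Φ (j.comp r) γ a • x := fun _ _ => rfl
  have hcomm : ∀ a n, f (n • a) * Delta.phiEnd q c 𝒟 n = Delta.phiEnd q c 𝒟 n * f a := by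
    intro a n
    ext x
    change f (n • a) (Delta.phiEnd q c 𝒟 n x) = Delta.phiEnd q c 𝒟 n (f a x)
    rw [hf, hf, Delta.phiEnd_smul, gammaPS_smul hO]
  obtain ⟨L, hL₁, hL₂⟩ := Delta.exists_lift_of_ringHom (c := c) (𝒟 := 𝒟)
    (Tw.lift f (Delta.phiEnd q c 𝒟) hcomm) (gammaScalar q (j.comp r) m γ ∅ • Delta.e q c 𝒟 ∅)
    (fun d => by
      obtain ⟨h, hh⟩ := exists_mulSeriesAt_eq (k := k) (j := j) hO hΦ h2 (γ d : O) d
      rw [Tw.lift_incl, hf, map_pow, gammaPS_X, hh, smul_comm, mul_pow, mul_comm, mul_smul,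
        Delta.X_sq_smul_e, smul_zero, smul_zero])
    (fun C hC => by
      rw [Tw.lift_incl, hf, smul_comm, gammaPS_mon_smul_e hO hΦ h2, Delta.e_eq_zero hC, smul_zero,
        smul_zero])
    -- The error in γ(t_d)^(q-1) is t_d² h t_d^(q-1). After the relation has turned t_d^(q-1) φ_d
    -- e_∅ into c_d e_∅, the factor t_d² annihilates it.
    (fun d => by
      obtain ⟨h, hh⟩ := exists_mulSeriesAt_pow_eq (k := k) (j := j) hO hΦ h2 (γ d) d
      rw [Tw.lift_incl, Tw.lift_incl, Tw.phi, Tw.lift_single, hf, hf, map_pow, gammaPS_X, hh,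
        gammaPS_C, Delta.phiEnd_smul_k, smul_comm, Delta.phiEnd_phi, add_smul, mul_smul,
        Delta.relation, mul_comm, mul_smul, smul_comm (X d ^ 2), Delta.X_sq_smul_e, smul_zero,
        smul_zero, add_zero, ← Delta.smul_eq', smul_comm])
  have hL₃ : ∀ f x, L (f • x) = gammaPS Φ (j.comp r) γ f • L x := fun f x => by
    rw [Delta.smul_eq, hL₂, Tw.lift_incl, hf]
  refine ⟨{ L with map_smul' := fun a x => ?_ }, hL₃, fun n x => ?_, hL₁⟩
  · change L (a • x) = a • L x
    rw [Delta.smul_eq', hL₃, gammaPS_C, Delta.smul_eq']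
  · change L (Delta.phiEnd q c 𝒟 n x) = Delta.phiEnd q c 𝒟 n (L x)
    rw [Delta.phiEnd_apply, hL₂, Tw.lift_single]

lemma Delta.exists_isGammaAction (m : D → ZMod (q - 1)) :
    ∃ ρ : (D → Oˣ) →* Module.End k (Delta q c 𝒟), IsGammaAction q c 𝒟 Φ (j.comp r) m ρ := by
  choose L hL₁ hL₂ hL₃ using
    fun γ => Delta.exists_gammaMap (j := j) (c := c) (𝒟 := 𝒟) hO hΦ h2 m γ
  refine ⟨{ toFun := L, map_one' := ?_, map_mul' := fun γ δ => ?_ }, fun γ => hL₁ γ,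
    fun γ d x => hL₂ γ (PhiMon.phi q d) x, fun γ C => ?_⟩
  · ext x
    induction x using Delta.induction with
    | h f n => rw [hL₁, hL₂, hL₃, gammaPS_one hO hΦ, gammaScalar_one, one_smul]; rfl
    | hadd x y hx hy => rw [map_add, map_add, hx, hy]
  · ext x
    induction x using Delta.induction with
    | h f n =>
      rw [Module.End.mul_apply, hL₁, hL₂, hL₃, hL₁, hL₁, hL₂, hL₂, hL₃,
        LinearMap.map_smul (L γ), hL₃, gammaPS_mul hO hΦ, gammaScalar_mul, smul_smul,
        mul_comm (gammaScalar q _ m δ ∅)]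
    | hadd x y hx hy => rw [map_add, map_add, hx, hy]
  · change L γ (Delta.e q c 𝒟 C) = _
    rw [Delta.e_eq, hL₁, hL₃, smul_comm, gammaPS_mon_smul_e hO hΦ h2, smul_smul, gammaScalar_eq _ _ _ C,
      Delta.e_eq]

end

end GammaDelta

/-! ### The dual of `Δ_𝒟` as an ideal of power series -/

section Theta

open MvPowerSeries

variable {k D : Type*} [Field k] [Fintype D] [DecidableEq D] {q : ℕ} [NeZero q] {c : D → kˣ}
  {𝒟 𝒟' : Family D}

omit [DecidableEq D] in
lemma algebraMap_LS_injective : Function.Injective (algebraMap (PS k D) (LS k D)) :=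
  IsLocalization.injective (M := Submonoid.powers (tD k D)) _
    (powers_le_nonZeroDivisors_of_noZeroDivisors (tD_ne_zero k D))

lemma tD_eq_mon : tD k D = mon k (ones D) := by
  rw [mon_sqfree]; rfl

/-- The monomial t_D misses no variable and ∅ ∉ 𝒟. Consequently all the ideals coincide after
inverting t_D. -/
lemma tD_mul_mem_famIdeal (g : PS k D) : tD k D * g ∈ famIdeal k 𝒟 := by
  refine Ideal.mul_mem_right _ _ ?_
  rw [tD_eq_mon, mon_mem_famIdeal]
  have h : zeroSet (ones D) = ∅ := by ext d; simp [sqfree_apply]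
  rw [h]
  exact 𝒟.empty_notMem

/-- The power series attached to a linear form on `Δ_𝒟`. -/
def DeltaDual.theta (hq : 1 < q) : DeltaDual q c 𝒟 →ₗ[PS k D] PS k D where
  toFun l := fun i => l.toDual (Delta.x q c 𝒟 i)
  map_add' l l' := rfl
  map_smul' f l := by
    let g : PS k D := fun i => l.toDual (Delta.x q c 𝒟 i)
    ext i
    change l.toDual (f • Delta.x q c 𝒟 i) = coeff i (f * g)
    rw [coeff_mul, Delta.smul_x hq, map_sum]
    exact Finset.sum_congr rfl fun p _ => map_smul l.toDual _ _

lemma DeltaDual.coeff_theta (hq : 1 < q) (l : DeltaDual q c 𝒟) (i : D →₀ ℕ) :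
    coeff i (l.theta hq) = l.toDual (Delta.x q c 𝒟 i) := rfl

lemma DeltaDual.theta_injective (hq : 1 < q) :
    Function.Injective (DeltaDual.theta hq : DeltaDual q c 𝒟 →ₗ[PS k D] PS k D) := by
  intro l l' h
  refine LinearMap.ext fun x => ?_
  change l.toDual x = l'.toDual x
  induction x using Delta.induction_x hq with
  | h i => rw [← DeltaDual.coeff_theta hq, h, DeltaDual.coeff_theta]
  | hadd x y hx hy => rw [map_add, map_add, hx, hy]
  | hsmul a x hx => rw [map_smul, map_smul, hx]

lemma DeltaDual.theta_mem (hq : 1 < q) (l : DeltaDual q c 𝒟) : l.theta hq ∈ famIdeal k 𝒟 :=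
  fun i hi => by rw [DeltaDual.coeff_theta, Delta.x_eq_zero hq hi, map_zero]

lemma DeltaDual.exists_theta_eq (hq : 1 < q) {g : PS k D} (hg : g ∈ famIdeal k 𝒟) :
    ∃ l : DeltaDual q c 𝒟, l.theta hq = g := by
  obtain ⟨l, hl⟩ := Delta.exists_dual (c := c) hq hg
  exact ⟨.ofDual l, by ext i; exact hl i⟩

lemma DeltaDual.theta_comp_phi (hq : 1 < q) (l : DeltaDual q c 𝒟) (d : D) :
    (DeltaDual.ofDual (l.toDual ∘ₗ Delta.phi q c 𝒟 d)).theta hq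
      = (c d : k) • psiCan (PhiMon.phi q d) (l.theta hq) := by
  ext i
  rw [map_smul, coeff_psiCan, DeltaDual.coeff_theta, DeltaDual.coeff_theta]
  change l.toDual (Delta.phi q c 𝒟 d (Delta.x q c 𝒟 i)) = _
  rw [← Delta.phiEnd_phi, Delta.phiEnd_x hq, cPow_phi, map_smul]

lemma Delta.proj_phiEnd (h : 𝒟.carrier ⊆ 𝒟'.carrier) (n : PhiMon q D) (x : Delta q c 𝒟) :
    Delta.proj q c h (Delta.phiEnd q c 𝒟 n x) = Delta.phiEnd q c 𝒟' n (Delta.proj q c h x) :=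
  map_smul (Delta.proj q c h) _ _

lemma Delta.proj_smul (h : 𝒟.carrier ⊆ 𝒟'.carrier) (f : PS k D) (x : Delta q c 𝒟) :
    Delta.proj q c h (f • x) = f • Delta.proj q c h x :=
  map_smul (Delta.proj q c h) _ _

lemma Delta.proj_smul_k (h : 𝒟.carrier ⊆ 𝒟'.carrier) (a : k) (x : Delta q c 𝒟) :
    Delta.proj q c h (a • x) = a • Delta.proj q c h x :=
  map_smul (Delta.proj q c h) _ _

lemma Delta.proj_x (h : 𝒟.carrier ⊆ 𝒟'.carrier) (i : D →₀ ℕ) :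
    Delta.proj q c h (Delta.x q c 𝒟 i) = Delta.x q c 𝒟' i := by
  rw [Delta.x, Delta.x, Delta.proj_smul_k, Delta.proj_smul, Delta.proj_phiEnd, Delta.proj_e]

lemma DeltaDual.theta_incl (hq : 1 < q) (h : 𝒟.carrier ⊆ 𝒟'.carrier) (l : DeltaDual q c 𝒟') :
    (DeltaDual.incl h l).theta hq = l.theta hq := by
  ext i
  rw [DeltaDual.coeff_theta, DeltaDual.coeff_theta, ← Delta.proj_x h]
  rfl

lemma DeltaDual.incl_injective (hq : 1 < q) (h : 𝒟.carrier ⊆ 𝒟'.carrier) :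
    Function.Injective (DeltaDual.incl (q := q) (c := c) h) := fun l l' hl => by
  apply DeltaDual.theta_injective hq
  rw [← DeltaDual.theta_incl hq h, hl, DeltaDual.theta_incl]

/-- The linear extension of `theta` to `D_𝒟`. -/
def DD.thetaMap (hq : 1 < q) : DD q c 𝒟 →ₗ[LS k D] LS k D :=
  (TensorProduct.AlgebraTensorModule.rid (PS k D) (LS k D) (LS k D)).toLinearMap ∘ₗ
    (DeltaDual.theta hq).baseChange (LS k D)

lemma DD.thetaMap_tmul (hq : 1 < q) (a : LS k D) (l : DeltaDual q c 𝒟) :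
    DD.thetaMap hq (a ⊗ₜ l) = l.theta hq • a := rfl

omit [DecidableEq D] in
lemma exists_tD_pow_smul_eq (y : LS k D) : ∃ (n : ℕ) (g : PS k D),
    tD k D ^ n • y = algebraMap (PS k D) (LS k D) g := by
  obtain ⟨n, g, h⟩ := IsLocalization.Away.surj (tD k D) y
  exact ⟨n, g, by rw [Algebra.smul_def, map_pow, mul_comm, h]⟩

omit [DecidableEq D] in
lemma isUnit_algebraMap_tD_pow (n : ℕ) : IsUnit (algebraMap (PS k D) (LS k D) (tD k D ^ n)) := by
  rw [map_pow]
  exact (IsLocalization.Away.algebraMap_isUnit (tD k D)).pow n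

/-- Injectivity is flatness of the localization. Surjectivity holds because the image of `theta`
contains all multiples of t_D, which is invertible in k((t_•)). -/
lemma DD.thetaMap_bijective (hq : 1 < q) :
    Function.Bijective (DD.thetaMap hq : DD q c 𝒟 →ₗ[LS k D] LS k D) := by
  constructor
  · have : Module.Flat (PS k D) (LS k D) := IsLocalization.flat _ (Submonoid.powers (tD k D))
    have h := Module.Flat.lTensor_preserves_injective_linearMap (M := LS k D)
      (DeltaDual.theta hq : DeltaDual q c 𝒟 →ₗ[PS k D] PS k D) (DeltaDual.theta_injective hq)
    exact (LinearEquiv.injective (TensorProduct.AlgebraTensorModule.rid (PS k D) (LS k D)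
      (LS k D))).comp h
  · rw [← LinearMap.range_eq_top, eq_top_iff]
    rintro y -
    obtain ⟨n, g, h⟩ := exists_tD_pow_smul_eq y
    obtain ⟨l, hl⟩ := DeltaDual.exists_theta_eq (c := c) hq (tD_mul_mem_famIdeal (𝒟 := 𝒟) g)
    obtain ⟨u, hu⟩ := isUnit_algebraMap_tD_pow (k := k) (D := D) (n + 1)
    refine ⟨(↑u⁻¹ : LS k D) • (1 : LS k D) ⊗ₜ l, ?_⟩
    rw [map_smul, DD.thetaMap_tmul, hl, mul_smul, Algebra.smul_def g, mul_one, ← h, smul_smul,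
      ← pow_succ']
    change (↑u⁻¹ : LS k D) * _ = _
    rw [Algebra.smul_def, ← hu, ← mul_assoc, Units.inv_mul, one_mul]

/-- The isomorphism of `D_𝒟` with `k((t_•))`. -/
def DD.equiv (hq : 1 < q) : DD q c 𝒟 ≃ₗ[LS k D] LS k D :=
  LinearEquiv.ofBijective (DD.thetaMap hq) (DD.thetaMap_bijective hq)

lemma DD.equiv_of (hq : 1 < q) (l : DeltaDual q c 𝒟) :
    DD.equiv hq (DD.of q c 𝒟 l) = algebraMap (PS k D) (LS k D) (l.theta hq) := by
  refine (DD.thetaMap_tmul hq 1 l).trans ?_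
  rw [Algebra.smul_def, mul_one]

lemma DD.of_injective (hq : 1 < q) : Function.Injective (DD.of q c 𝒟) := fun l l' h => by
  have h' := congrArg (DD.equiv hq) h
  rw [DD.equiv_of, DD.equiv_of] at h'
  exact DeltaDual.theta_injective hq (algebraMap_LS_injective h')

lemma DD.equiv_map (hq : 1 < q) (h : 𝒟.carrier ⊆ 𝒟'.carrier) (x : DD q c 𝒟') :
    DD.equiv hq (DD.map q c h x) = DD.equiv hq x := by
  induction x using TensorProduct.induction_on with
  | zero => simp
  | tmul a l =>
    change DD.thetaMap hq (a ⊗ₜ DeltaDual.incl h l) = DD.thetaMap hq (a ⊗ₜ l)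
    rw [DD.thetaMap_tmul, DD.thetaMap_tmul, DeltaDual.theta_incl]
  | add x y hx hy => rw [map_add, map_add, map_add, hx, hy]

lemma DD.map_bijective (hq : 1 < q) (h : 𝒟.carrier ⊆ 𝒟'.carrier) :
    Function.Bijective (DD.map q c h) := by
  have : (DD.map q c h : DD q c 𝒟' → DD q c 𝒟) = (DD.equiv hq).symm ∘ DD.equiv hq := by
    funext x
    rw [Function.comp_apply, LinearEquiv.eq_symm_apply, DD.equiv_map]
  rw [this]
  exact (LinearEquiv.bijective _).comp (LinearEquiv.bijective _)

end Theta

/-! ### Comparison of a `ψ`-operator with the standard one -/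

section Compare

open MvPowerSeries

variable {k D : Type*} [Field k] [Fintype D] [DecidableEq D] {q : ℕ} [NeZero q]

lemma phi_smul_X (d d' : D) :
    PhiMon.phi q d • (X d' : PS k D) = if d' = d then X d' ^ q else X d' := by
  rw [smul_X, PhiMon.exp_phi]
  split_ifs <;> simp

lemma psiCan_phi_X_pow (d : D) (n : ℕ) :
    psiCan (PhiMon.phi q d) (X d ^ n : PS k D) = if q ∣ n then X d ^ (n / q) else 0 := by
  split_ifs with h
  · obtain ⟨m, rfl⟩ := h
    rw [Nat.mul_div_cancel_left _ (NeZero.pos q), pow_mul]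
    have h1 : (X d ^ q : PS k D) ^ m = PhiMon.phi q d • (X d ^ m) := by
      rw [smul_pow', phi_smul_X, if_pos rfl]
    rw [h1, psiCan_smul]
  · ext i
    rw [coeff_psiCan, X_pow_eq_mon, mon, coeff_monomial_ne, map_zero]
    intro hi
    apply h
    have := DFunLike.congr_fun hi d
    rw [sc_apply, Finsupp.single_eq_same, PhiMon.exp_phi, if_pos rfl, pow_one] at this
    exact ⟨_, this.symm⟩

/-- Division with remainder by q of the exponents of t_d: k[[t_•]] is generated over φ_d(k[[t_•]])
by 1, t_d, …, t_d^(q-1). -/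
lemma exists_phi_decomposition (d : D) (f : PS k D) :
    ∃ g : ℕ → PS k D, f = ∑ j ∈ Finset.range q, X d ^ j * (PhiMon.phi q d • g j) := by
  let g : ℕ → PS k D := fun j i => coeff (sc (PhiMon.phi q d) i + Finsupp.single d j) f
  have hg : ∀ j i, coeff i (g j) = coeff (sc (PhiMon.phi q d) i + Finsupp.single d j) f :=
    fun _ _ => rfl
  refine ⟨g, ?_⟩
  ext i
  have hmod : Finsupp.single d (i d % q) ≤ i := by
    rw [Finsupp.single_le_iff]; exact Nat.mod_le _ _
  obtain ⟨i', hi'⟩ : ∃ i', sc (PhiMon.phi q d) i' = i - Finsupp.single d (i d % q) := by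
    refine ⟨Finsupp.update i d (i d / q), ?_⟩
    ext d'
    rw [sc_apply, PhiMon.exp_phi, Finsupp.coe_tsub, Pi.sub_apply]
    by_cases h : d' = d
    · subst h
      simp only [if_true, pow_one, Finsupp.coe_update, Function.update_self,
        Finsupp.single_eq_same]
      have := Nat.div_add_mod (i d') q
      omega
    · simp [h, Finsupp.single_eq_of_ne h]
  rw [map_sum, Finset.sum_eq_single (i d % q)]
  · rw [X_pow_eq_mon, coeff_mon_mul, if_pos hmod, ← hi', coeff_sc_smul, hg, hi',
      tsub_add_cancel_of_le hmod]
  · intro j hj hne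
    rw [X_pow_eq_mon, coeff_mon_mul]
    split_ifs with hle
    · refine coeff_smul_eq_zero _ _ _ fun l hl => hne ?_
      have := DFunLike.congr_fun hl d
      rw [sc_apply, PhiMon.exp_phi, if_pos rfl, pow_one, Finsupp.coe_tsub, Pi.sub_apply,
        Finsupp.single_eq_same] at this
      rw [Finsupp.single_le_iff] at hle
      have h2 : i d = j + q * l d := by omega
      rw [h2, Nat.add_mul_mod_self_left, Nat.mod_eq_of_lt (Finset.mem_range.mp hj)]
    · rfl
  · intro h
    exact absurd (Finset.mem_range.mpr (Nat.mod_lt _ (NeZero.pos q))) h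

variable {O : Type*} [CommRing O] {Φ : PowerSeries O} {red : O →+* k}

/-- The power series that compares `ψ_d` with the standard `ψ`-operator. -/
def PsiOperator.ratio (Ψ : PsiOperator k D q Φ red) (d : D) : PS k D :=
  ∑ j ∈ Finset.range q, X d ^ (q - 1 - j) * (PhiMon.phi q d • Ψ.psi d (X d ^ j))

/-- By semilinearity only x = t_d^l with l < q matters. Multiplying the j-th term of `ratio` by t_d
· t_d^l gives the exponent q - j + l, strictly between 0 and 2q; the standard operator keeps it only
if it equals q, that is j = l. The extra factor t_d produces this exponent q. -/
lemma PsiOperator.X_mul_psi (Ψ : PsiOperator k D q Φ red) (d : D) (x : PS k D) :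
    X d * Ψ.psi d x = psiCan (PhiMon.phi q d) (X d * Ψ.ratio d * x) := by
  obtain ⟨g, hg⟩ := exists_phi_decomposition (q := q) d x
  have h1 : Ψ.psi d x = ∑ l ∈ Finset.range q, g l * Ψ.psi d (X d ^ l) := by
    conv_lhs => rw [hg]
    rw [map_sum]
    exact Finset.sum_congr rfl fun l _ => by rw [mul_comm, Ψ.psi_phi_mul]
  have h2 : X d * Ψ.ratio d * x = ∑ l ∈ Finset.range q, ∑ j ∈ Finset.range q,
      (PhiMon.phi q d • (g l * Ψ.psi d (X d ^ j))) * X d ^ (q - j + l) := by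
    conv_lhs => rw [hg]
    rw [Finset.mul_sum]
    refine Finset.sum_congr rfl fun l _ => ?_
    rw [PsiOperator.ratio, Finset.mul_sum, Finset.sum_mul]
    refine Finset.sum_congr rfl fun j hj => ?_
    have hj' := Finset.mem_range.mp hj
    rw [smul_mul', show q - j + l = 1 + (q - 1 - j) + l by omega, pow_add, pow_add, pow_one]
    ring
  rw [h1, h2, map_sum, Finset.mul_sum]
  refine Finset.sum_congr rfl fun l hl => ?_
  have hl' := Finset.mem_range.mp hl
  rw [map_sum, Finset.sum_eq_single l]
  · rw [psiCan_smul_mul, psiCan_phi_X_pow, Nat.sub_add_cancel hl'.le, if_pos dvd_rfl,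
      Nat.div_self (NeZero.pos q), pow_one, mul_comm]
  · intro j hj hne
    have hj' := Finset.mem_range.mp hj
    rw [psiCan_smul_mul, psiCan_phi_X_pow, if_neg, mul_zero]
    rintro ⟨m, hm⟩
    have h0 : m ≠ 0 := by rintro rfl; omega
    have h3 : m < 2 := by
      by_contra h3
      have : q * 2 ≤ q * m := Nat.mul_le_mul_left _ (by omega)
      omega
    obtain rfl : m = 1 := by omega
    omega
  · exact fun h => absurd hl h

lemma PsiOperator.phi_smul_ratio (Ψ : PsiOperator k D q Φ red) {d d' : D} (h : d ≠ d') :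
    PhiMon.phi q d' • Ψ.ratio d = Ψ.ratio d := by
  have hX : ∀ n, PhiMon.phi q d' • (X d ^ n : PS k D) = X d ^ n := fun n => by
    rw [smul_pow', phi_smul_X, if_neg h]
  rw [PsiOperator.ratio, Finset.smul_sum]
  refine Finset.sum_congr rfl fun j _ => ?_
  rw [smul_mul', hX, smul_smul, mul_comm (PhiMon.phi q d'), ← smul_smul, ← Ψ.psi_phi d d' _ h, hX]

lemma PsiOperator.ratio_ne_zero (Ψ : PsiOperator k D q Φ red) (d : D)
    (hΨ : Function.Surjective (Ψ.psi d)) : Ψ.ratio d ≠ 0 := fun h => by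
  obtain ⟨x, hx⟩ := hΨ 1
  have := Ψ.X_mul_psi d x
  rw [h, hx, mul_zero, zero_mul, map_zero, mul_one] at this
  rw [X_eq_mon] at this
  exact mon_ne_zero _ this

/-- Descent on i_d: the coefficient at i is zero if i is not in the image of φ_d on exponents, and
otherwise equals the coefficient at an exponent with i_d divided by q. -/
lemma coeff_eq_zero_of_phi_smul_eq (hq : 1 < q) {d : D} {f : PS k D}
    (hf : PhiMon.phi q d • f = f) : ∀ i : D →₀ ℕ, i d ≠ 0 → coeff i f = 0 := by
  suffices h : ∀ n, ∀ i : D →₀ ℕ, i d = n → i d ≠ 0 → coeff i f = 0 from fun i => h _ i rfl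
  intro n
  induction n using Nat.strong_induction_on with
  | _ n ih =>
    intro i hi h0
    by_cases h : ∃ j, sc (PhiMon.phi q d) j = i
    · obtain ⟨j, rfl⟩ := h
      rw [← hf, coeff_sc_smul]
      rw [sc_apply, PhiMon.exp_phi, if_pos rfl, pow_one] at hi h0
      have hj : j d ≠ 0 := fun h => h0 (by rw [h, mul_zero])
      refine ih (j d) ?_ j rfl hj
      rw [← hi]
      exact lt_mul_left (Nat.pos_of_ne_zero hj) hq
    · push Not at h
      rw [← hf]
      exact coeff_smul_eq_zero _ _ _ h

/-- Invariance under the other operators leaves a nonzero power series in t_d alone, which is a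
power of t_d times a unit. -/
lemma exists_eq_X_pow_mul_unit (hq : 1 < q) {d : D} {f : PS k D} (h0 : f ≠ 0)
    (hf : ∀ d', d ≠ d' → PhiMon.phi q d' • f = f) :
    ∃ (n : ℕ) (w : (PS k D)ˣ), f = X d ^ n * (w : PS k D) := by
  have hc : ∀ i : D →₀ ℕ, i ≠ Finsupp.single d (i d) → coeff i f = 0 := by
    intro i hi
    obtain ⟨d', hd'⟩ : ∃ d', i d' ≠ Finsupp.single d (i d) d' := by
      by_contra! h
      exact hi (Finsupp.ext h)
    have hne : d' ≠ d := by rintro rfl; simp at hd'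
    rw [Finsupp.single_eq_of_ne hne] at hd'
    exact coeff_eq_zero_of_phi_smul_eq hq (hf d' hne.symm) i hd'
  have hex : ∃ n, coeff (Finsupp.single d n) f ≠ 0 := by
    by_contra! h
    refine h0 (MvPowerSeries.ext fun i => ?_)
    by_cases hi : i = Finsupp.single d (i d)
    · rw [hi, h, map_zero]
    · rw [hc i hi, map_zero]
  classical
  obtain ⟨w, hw⟩ : mon k (Finsupp.single d (Nat.find hex)) ∣ f := by
    rw [mon_dvd_iff]
    intro j hj
    rw [Finsupp.single_le_iff, not_le] at hj
    by_cases hi : j = Finsupp.single d (j d)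
    · rw [hi]
      exact not_not.mp (Nat.find_min hex hj)
    · exact hc j hi
  have hwu : IsUnit w := by
    rw [isUnit_iff_constantCoeff, isUnit_iff_ne_zero, ← coeff_zero_eq_constantCoeff_apply,
      ← coeff_add_mon_mul (Finsupp.single d (Nat.find hex)), ← hw, add_zero]
    exact Nat.find_spec hex
  exact ⟨Nat.find hex, hwu.unit, by rw [X_pow_eq_mon, hwu.unit_spec, ← hw]⟩

omit [DecidableEq D] in
lemma isUnit_algebraMap_X (d : D) : IsUnit (algebraMap (PS k D) (LS k D) (X d)) :=
  isUnit_of_dvd_unit (map_dvd _ (Finset.dvd_prod_of_mem _ (Finset.mem_univ d)))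
    (IsLocalization.Away.algebraMap_isUnit (tD k D))

lemma PsiOperator.linLS_phiLS_mul (Ψ : PsiOperator k D q Φ red) (d : D) (a b : LS k D) :
    Ψ.linLS d (toPhiLS k q d (phiLS k q d a * b)) = a * Ψ.linLS d (toPhiLS k q d b) :=
  (Ψ.linLS d).map_smul a (toPhiLS k q d b)

/-- Up to a unit that is invariant under the other `φ_{d'}`, every surjective `ψ_d` is a multiple
of the standard one. -/
lemma PsiOperator.exists_unit (hq : 1 < q) (Ψ : PsiOperator k D q Φ red) (d : D)
    (hΨ : Function.Surjective (Ψ.psi d)) (c : kˣ) :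
    ∃ u : (LS k D)ˣ, (∀ d', d ≠ d' → phiLS k q d' u = u) ∧ ∀ f : PS k D,
      Ψ.linLS d (toPhiLS k q d (algebraMap (PS k D) (LS k D) f * ↑u⁻¹))
        = algebraMap (PS k D) (LS k D) ((c : k) • psiCan (PhiMon.phi q d) f) := by
  obtain ⟨n, w, hw⟩ := exists_eq_X_pow_mul_unit hq (Ψ.ratio_ne_zero d hΨ)
    fun d' h => Ψ.phi_smul_ratio h
  obtain ⟨x, hx⟩ := isUnit_algebraMap_X (k := k) d
  let y : (LS k D)ˣ := Units.map (algebraMap (PS k D) (LS k D) : PS k D →* LS k D) (Units.map (C : k →+* PS k D).toMonoidHom c)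
  have hy : (y : LS k D) = algebraMap (PS k D) (LS k D) (C (c : k)) := rfl
  let z : (LS k D)ˣ := Units.map (algebraMap (PS k D) (LS k D) : PS k D →* LS k D) w
  have hz : (z : LS k D) = algebraMap (PS k D) (LS k D) (w : PS k D) := rfl
  have hr : algebraMap (PS k D) (LS k D) (Ψ.ratio d) = x ^ n * z := by rw [hw, map_mul, map_pow, hz, hx]
  -- With r = `ratio`, the choice u = r / (c t_d^(q-1)) gives t_d ψ_d(f/u) = psiCan(c t_d^q f) = t_d
  -- · c psiCan(f).
  obtain ⟨u, hu⟩ : ∃ u : (LS k D)ˣ, (u : LS k D) * (y * x ^ (q - 1)) = algebraMap (PS k D) (LS k D) (Ψ.ratio d) := by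
    refine ⟨x ^ n * z * (y * x ^ (q - 1))⁻¹, ?_⟩
    rw [hr, Units.val_mul, mul_assoc, ← Units.val_pow_eq_pow_val, ← Units.val_mul y,
      Units.inv_mul, mul_one, Units.val_mul, Units.val_pow_eq_pow_val]
  refine ⟨u, fun d' hd' => ?_, fun f => ?_⟩
  · have hX : PhiMon.phi q d' • (X d : PS k D) = X d := by rw [phi_smul_X, if_neg hd']
    have h1 : phiLS k q d' (y * x ^ (q - 1)) = y * x ^ (q - 1) := by
      rw [map_mul, map_pow, hy, hx, phiLS_algebraMap, phiLS_algebraMap, smul_C, hX]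
    have h2 := congrArg (phiLS k q d') hu
    rw [map_mul, h1, phiLS_algebraMap, Ψ.phi_smul_ratio hd'] at h2
    refine (y * x ^ (q - 1)).isUnit.mul_right_cancel ?_
    rw [Units.val_mul, Units.val_pow_eq_pow_val, hu]
    exact h2
  -- f/u may have a pole along t_d. Multiplying it by φ_d(t_d^n) = t_d^(qn) yields the integral
  -- element `g`, the exponent being qn + (q - 1) - n = (q - 1)(n + 1).
  · let g : PS k D := C (c : k) * ((↑w⁻¹ : PS k D) * X d ^ ((q - 1) * (n + 1)) * f)
    have hg : phiLS k q d (x ^ n) * (algebraMap (PS k D) (LS k D) f * ↑u⁻¹) = algebraMap (PS k D) (LS k D) g := by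
      refine u.isUnit.mul_right_cancel ?_
      have hwz : algebraMap (PS k D) (LS k D) (↑w⁻¹ : PS k D) * z = 1 := by rw [hz, ← map_mul, Units.inv_mul, map_one]
      have hpow : q * n + (q - 1) = (q - 1) * (n + 1) + n := by
        obtain ⟨p, rfl⟩ := Nat.exists_eq_add_of_lt hq
        simp only [Nat.add_sub_cancel]
        ring
      rw [mul_assoc, mul_assoc, Units.inv_mul, mul_one]
      refine (y * x ^ (q - 1)).isUnit.mul_right_cancel ?_
      rw [Units.val_mul, Units.val_pow_eq_pow_val, mul_assoc (algebraMap (PS k D) (LS k D) g), hu, hr, map_pow, hx,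
        phiLS_algebraMap, phi_smul_X, if_pos rfl, map_pow, ← hx]
      change _ = algebraMap (PS k D) (LS k D) (C (c : k) * ((↑w⁻¹ : PS k D) * X d ^ ((q - 1) * (n + 1)) * f)) * _
      rw [map_mul, map_mul, map_mul, map_pow, ← hx, ← hy]
      calc ((x : LS k D) ^ q) ^ n * algebraMap (PS k D) (LS k D) f * (y * x ^ (q - 1))
          = y * algebraMap (PS k D) (LS k D) f * (x : LS k D) ^ (q * n + (q - 1)) := by rw [pow_add, pow_mul]; ring
        _ = y * algebraMap (PS k D) (LS k D) f * (x : LS k D) ^ ((q - 1) * (n + 1) + n) * (algebraMap (PS k D) (LS k D) (↑w⁻¹ : PS k D) * z) := by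
            rw [hpow, hwz, mul_one]
        _ = _ := by rw [pow_add]; ring
    have hpsi : Ψ.psi d g = X d ^ n * ((c : k) • psiCan (PhiMon.phi q d) f) := by
      have hX0 : (X d : PS k D) ≠ 0 := by rw [X_eq_mon]; exact mon_ne_zero _
      refine mul_left_cancel₀ hX0 ?_
      have hpow : (X d : PS k D) * X d ^ n * X d ^ ((q - 1) * (n + 1))
          = PhiMon.phi q d • (X d ^ (n + 1)) := by
        rw [smul_pow', phi_smul_X, if_pos rfl, ← pow_mul, ← pow_succ', ← pow_add]
        congr 1
        obtain ⟨p, rfl⟩ := Nat.exists_eq_add_of_lt hq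
        simp only [Nat.add_sub_cancel]
        ring
      have hval : X d * Ψ.ratio d * g = (PhiMon.phi q d • (X d ^ (n + 1))) * ((c : k) • f) := by
        rw [hw, ← hpow, MvPowerSeries.smul_eq_C_mul]
        change X d * (X d ^ n * (w : PS k D)) * (C (c : k) * ((↑w⁻¹ : PS k D) * X d ^ ((q - 1) * (n + 1)) * f)) = _
        calc _ = ((w : PS k D) * (↑w⁻¹ : PS k D)) * (X d * X d ^ n * X d ^ ((q - 1) * (n + 1))
              * (C (c : k) * f)) := by ring
          _ = _ := by rw [Units.mul_inv, one_mul]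
      rw [Ψ.X_mul_psi, hval, psiCan_smul_mul, map_smul, pow_succ', mul_assoc]
    refine (x ^ n).isUnit.mul_left_cancel ?_
    rw [Units.val_pow_eq_pow_val, ← Ψ.linLS_phiLS_mul, hg, Ψ.linLS_algebraMap, hpsi, map_mul,
      map_pow, ← hx]

end Compare

/-! ### Étale modules of rank one -/

namespace EtalePhiGamma

variable {O k D : Type*} [CommRing O] [Field k] [Fintype D] [DecidableEq D]
  {q : ℕ} [NeZero q] {Φ : PowerSeries O} {red : O →+* k}
  {M N : Type*} [AddCommGroup M] [Module (LS k D) M] [AddCommGroup N] [Module (LS k D) N]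

@[elab_as_elim]
lemma induction_phi (P : EtalePhiGamma D q Φ red M) (d : D) {p : M → Prop} (x : M)
    (zero : p 0) (smul : ∀ (a : LS k D) y, p (a • P.phi d y))
    (add : ∀ y z, p y → p z → p (y + z)) : p x := by
  obtain ⟨t, rfl⟩ := (P.etale d).2 x
  induction t using TensorProduct.induction_on with
  | zero => rw [map_zero]; exact zero
  | tmul a y => exact smul a y
  | add s t hs ht => rw [map_add]; exact add _ _ hs ht

lemma psi_phiLS_smul (P : EtalePhiGamma D q Φ red M) (Ψ : PsiOperator k D q Φ red) (d : D)
    (a : LS k D) (x : M) : P.psi Ψ d (phiLS k q d a • x) = a • P.psi Ψ d x := by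
  induction x using P.induction_phi d with
  | zero => simp
  | smul b y => rw [smul_smul, psi_smul_phi, psi_smul_phi, Ψ.linLS_phiLS_mul, mul_smul]
  | add y z hy hz => rw [smul_add, map_add, map_add, smul_add, hy, hz]

/-- Transport of the structure of an étale module along a linear isomorphism. -/
def transport (P : EtalePhiGamma D q Φ red N) (e : M ≃ₗ[LS k D] N) :
    EtalePhiGamma D q Φ red M where
  phi d :=
    { toFun := fun x => e.symm (P.phi d (e x))
      map_add' := fun x y => by simp
      map_smul' := fun a x => by simp }
  gam :=
    { toFun := fun γ =>
        { toFun := fun x => e.symm (P.gam γ (e x))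
          map_zero' := by simp
          map_add' := fun x y => by simp }
      map_one' := by
        ext x
        change e.symm (P.gam 1 (e x)) = x
        rw [map_one P.gam, AddMonoid.End.one_apply, e.symm_apply_apply]
      map_mul' := fun γ δ => by
        ext x
        change e.symm (P.gam (γ * δ) (e x)) = e.symm (P.gam γ (e (e.symm (P.gam δ (e x)))))
        rw [map_mul P.gam, e.apply_symm_apply]
        rfl }
  phi_comm d d' x := by
    change e.symm (P.phi d (e (e.symm (P.phi d' (e x)))))
      = e.symm (P.phi d' (e (e.symm (P.phi d (e x)))))
    rw [e.apply_symm_apply, e.apply_symm_apply, P.phi_comm]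
  phi_gam d γ x := by
    change e.symm (P.phi d (e (e.symm (P.gam γ (e x)))))
      = e.symm (P.gam γ (e (e.symm (P.phi d (e x)))))
    rw [e.apply_symm_apply, e.apply_symm_apply, P.phi_gam]
  gam_smul γ a x := by
    change e.symm (P.gam γ (e (a • x))) = gammaLS Φ red γ a • e.symm (P.gam γ (e x))
    rw [map_smul, P.gam_smul, map_smul]
  finite := by
    have := P.finite
    exact Module.Finite.equiv e.symm
  etale d := by
    have h : ⇑(linearization q d ({
        toFun := fun x => e.symm (P.phi d (e x))
        map_add' := fun x y => by simp
        map_smul' := fun a x => by simp } : M →ₛₗ[phiLS k q d] M))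
        = e.symm ∘ linearization q d (P.phi d) ∘ (LinearEquiv.lTensor (PhiLS k q d) e) := by
      funext t
      induction t using TensorProduct.induction_on with
      | zero => simp
      | tmul a y => exact (map_smul e.symm ((toPhiLS k q d).symm a) (P.phi d (e y))).symm
      | add s t hs ht => rw [map_add, hs, ht]; simp
    rw [h]
    exact e.symm.bijective.comp ((P.etale d).comp (LinearEquiv.bijective _))

lemma transport_phi (P : EtalePhiGamma D q Φ red N) (e : M ≃ₗ[LS k D] N) (d : D) (x : M) :
    (P.transport e).phi d x = e.symm (P.phi d (e x)) := rfl

lemma transport_gam (P : EtalePhiGamma D q Φ red N) (e : M ≃ₗ[LS k D] N) (γ : D → Oˣ) (x : M) :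
    (P.transport e).gam γ x = e.symm (P.gam γ (e x)) := rfl

lemma transport_psi (P : EtalePhiGamma D q Φ red N) (e : M ≃ₗ[LS k D] N)
    (Ψ : PsiOperator k D q Φ red) (d : D) (x : M) :
    (P.transport e).psi Ψ d x = e.symm (P.psi Ψ d (e x)) := by
  induction x using (P.transport e).induction_phi d with
  | zero => simp
  | smul a y =>
    rw [psi_smul_phi, transport_phi, map_smul, e.apply_symm_apply, psi_smul_phi, map_smul,
      e.symm_apply_apply]
  | add y z hy hz => rw [map_add, map_add, map_add, map_add, hy, hz]

end EtalePhiGamma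

/-! ### The module k((t_•)) with operators φ_d twisted by units. -/

section Rank1

open MvPowerSeries

variable {O κ k D : Type*} [CommRing O] [Field κ] [Field k] [Fintype D]
  {q : ℕ} {π : O} {Φ : PowerSeries O} {r : O →+* κ} {j : κ →+* k}

lemma gammaLS_algebraMap (Φ : PowerSeries O) (red : O →+* k) (γ : D → Oˣ) (f : PS k D) :
    gammaLS Φ red γ (algebraMap (PS k D) (LS k D) f)
      = algebraMap (PS k D) (LS k D) (gammaPS Φ red γ f) :=
  IsLocalization.Away.lift_eq _ _ _

lemma LS_ringHom_ext {R : Type*} [CommRing R] {f g : LS k D →+* R}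
    (h : ∀ a : PS k D, f (algebraMap _ _ a) = g (algebraMap _ _ a)) (x : LS k D) : f x = g x :=
  RingHom.congr_fun (IsLocalization.ringHom_ext (Submonoid.powers (tD k D))
    (RingHom.ext h)) x

section

variable (hO : IsLubinTateBase q π r) (hΦ : IsLubinTate q π Φ)
include hO hΦ

lemma gammaLS_one (x : LS k D) : gammaLS Φ (j.comp r) 1 x = x :=
  LS_ringHom_ext (f := gammaLS Φ (j.comp r) 1) (g := RingHom.id _) (fun a => by
    rw [gammaLS_algebraMap, gammaPS_one hO hΦ, RingHom.id_apply]) x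

lemma gammaLS_mul (γ δ : D → Oˣ) (x : LS k D) :
    gammaLS Φ (j.comp r) (γ * δ) x = gammaLS Φ (j.comp r) γ (gammaLS Φ (j.comp r) δ x) :=
  LS_ringHom_ext (f := gammaLS Φ (j.comp r) (γ * δ))
    (g := (gammaLS Φ (j.comp r) γ).comp (gammaLS Φ (j.comp r) δ)) (fun a => by
    rw [RingHom.comp_apply, gammaLS_algebraMap, gammaLS_algebraMap, gammaLS_algebraMap,
      gammaPS_mul hO hΦ]) x

end

variable [DecidableEq D] [NeZero q]

lemma phiLS_comm (d d' : D) (x : LS k D) :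
    phiLS k q d (phiLS k q d' x) = phiLS k q d' (phiLS k q d x) :=
  LS_ringHom_ext (f := (phiLS k q d).comp (phiLS k q d'))
    (g := (phiLS k q d').comp (phiLS k q d)) (fun a => by
    rw [RingHom.comp_apply, RingHom.comp_apply, phiLS_algebraMap, phiLS_algebraMap,
      phiLS_algebraMap, phiLS_algebraMap, smul_smul, smul_smul, mul_comm]) x

lemma gammaLS_phiLS (hO : IsLubinTateBase q π r) (γ : D → Oˣ) (d : D) (x : LS k D) :
    gammaLS Φ (j.comp r) γ (phiLS k q d x) = phiLS k q d (gammaLS Φ (j.comp r) γ x) :=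
  LS_ringHom_ext (f := (gammaLS Φ (j.comp r) γ).comp (phiLS k q d))
    (g := (phiLS k q d).comp (gammaLS Φ (j.comp r) γ)) (fun a => by
    rw [RingHom.comp_apply, RingHom.comp_apply, phiLS_algebraMap, gammaLS_algebraMap,
      gammaLS_algebraMap, phiLS_algebraMap, gammaPS_smul hO]) x

/-- Every element of `k((t_•))` becomes integral after multiplication by `φ_d(s)` for a
power `s` of `t_D`. -/
lemma exists_phiLS_mul_eq (q : ℕ) [NeZero q] (d : D) (x : LS k D) : ∃ (s : (LS k D)ˣ) (g : PS k D),
    phiLS k q d s * x = algebraMap (PS k D) (LS k D) g := by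
  obtain ⟨n, g, h⟩ := exists_tD_pow_smul_eq x
  obtain ⟨s, hs⟩ := isUnit_algebraMap_tD_pow (k := k) (D := D) n
  obtain ⟨b, hb⟩ := tD_pow_dvd k q d n
  refine ⟨s, b * g, ?_⟩
  rw [hs, phiLS_algebraMap, hb, map_mul, map_mul, ← h, Algebra.smul_def]
  ring

lemma exists_eq_phiLS_mul (q : ℕ) [NeZero q] (d : D) (x : LS k D) : ∃ (a : LS k D) (g : PS k D),
    x = phiLS k q d a * algebraMap (PS k D) (LS k D) g := by
  obtain ⟨s, g, h⟩ := exists_phiLS_mul_eq q d x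
  refine ⟨↑s⁻¹, g, ?_⟩
  rw [← h, ← mul_assoc, ← map_mul, Units.inv_mul, map_one, one_mul]

lemma PsiOperator.linLS_gammaLS (hO : IsLubinTateBase q π r) (Ψ : PsiOperator k D q Φ (j.comp r))
    (d : D) (γ : D → Oˣ) (x : LS k D) :
    Ψ.linLS d (toPhiLS k q d (gammaLS Φ (j.comp r) γ x))
      = gammaLS Φ (j.comp r) γ (Ψ.linLS d (toPhiLS k q d x)) := by
  obtain ⟨a, g, rfl⟩ := exists_eq_phiLS_mul q d x
  rw [map_mul, gammaLS_phiLS hO, Ψ.linLS_phiLS_mul, Ψ.linLS_phiLS_mul, gammaLS_algebraMap,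
    Ψ.linLS_algebraMap, Ψ.linLS_algebraMap, Ψ.psi_gamma, map_mul, gammaLS_algebraMap]

/-- The étale module of rank one on which `ψ_d` is `c_d` times the standard `ψ`-operator. -/
lemma exists_etale (hO : IsLubinTateBase q π r) (hΦ : IsLubinTate q π Φ) (hq : 1 < q)
    (Ψ : PsiOperator k D q Φ (j.comp r)) (hΨ : ∀ d, Function.Surjective (Ψ.psi d)) (c : D → kˣ)
    (G : (D → Oˣ) →* AddMonoid.End (PS k D))
    (hG : ∀ γ a f, G γ (a * f) = gammaPS Φ (j.comp r) γ a * G γ f)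
    (hGψ : ∀ γ d f, G γ (psiCan (PhiMon.phi q d) f) = psiCan (PhiMon.phi q d) (G γ f)) :
    ∃ P : EtalePhiGamma D q Φ (j.comp r) (LS k D),
      (∀ γ f, P.gam γ (algebraMap (PS k D) (LS k D) f) = algebraMap (PS k D) (LS k D) (G γ f)) ∧
      ∀ d f, P.psi Ψ d (algebraMap (PS k D) (LS k D) f)
        = algebraMap (PS k D) (LS k D) ((c d : k) • psiCan (PhiMon.phi q d) f) := by
  choose u huφ huψ using fun d => Ψ.exists_unit hq d (hΨ d) (c d)
  have hG1 : ∀ γ f, G γ f = gammaPS Φ (j.comp r) γ f * G γ 1 := fun γ f => by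
    rw [← hG, mul_one]
  have hGc : ∀ γ (a : k) f, G γ (a • f) = a • G γ f := fun γ a f => by
    rw [MvPowerSeries.smul_eq_C_mul, hG, gammaPS_C, ← MvPowerSeries.smul_eq_C_mul]
  -- This is the commutation of φ_d with γ on the generator 1. Only commutation with ψ_d is given,
  -- so the difference `z` is shown to vanish by pairing it with all integral b under ψ_d.
  have key : ∀ d γ, phiLS k q d (algebraMap _ _ (G γ 1)) * u d
      = gammaLS Φ (j.comp r) γ (u d) * algebraMap _ _ (G γ 1) := by
    intro d γ
    let z : LS k D := algebraMap _ _ (G γ 1) * ↑(u d)⁻¹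
      - gammaLS Φ (j.comp r) γ ↑(u d)⁻¹ * phiLS k q d (algebraMap _ _ (G γ 1))
    have h1 : ∀ b : PS k D, Ψ.linLS d (toPhiLS k q d (algebraMap _ _ b * z)) = 0 := by
      intro b
      obtain ⟨b, rfl⟩ : ∃ b', gammaPS Φ (j.comp r) γ b' = b :=
        ⟨gammaPS Φ (j.comp r) γ⁻¹ b, by
          rw [← gammaPS_mul hO hΦ, mul_inv_cancel, gammaPS_one hO hΦ]⟩
      have e1 : Ψ.linLS d (toPhiLS k q d (algebraMap _ _ (gammaPS Φ (j.comp r) γ b)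
          * (algebraMap _ _ (G γ 1) * ↑(u d)⁻¹)))
          = algebraMap _ _ (G γ ((c d : k) • psiCan (PhiMon.phi q d) b)) := by
        rw [← mul_assoc, ← map_mul, ← hG1, huψ, hGc, hGψ]
      have e2 : Ψ.linLS d (toPhiLS k q d (algebraMap _ _ (gammaPS Φ (j.comp r) γ b)
          * (gammaLS Φ (j.comp r) γ ↑(u d)⁻¹ * phiLS k q d (algebraMap _ _ (G γ 1)))))
          = algebraMap _ _ (G γ ((c d : k) • psiCan (PhiMon.phi q d) b)) := by
        rw [← mul_assoc, ← gammaLS_algebraMap, ← map_mul, mul_comm, Ψ.linLS_phiLS_mul,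
          Ψ.linLS_gammaLS hO, huψ, gammaLS_algebraMap, ← map_mul, mul_comm, ← hG1]
      rw [mul_sub, map_sub, map_sub, e1, e2, sub_self]
    have hz : z = 0 := by
      -- Clear denominators with φ_d(s), which ψ_d lets through as s; nondegeneracy of the standard
      -- operator then applies to `g`.
      obtain ⟨s, g, hg⟩ := exists_phiLS_mul_eq q d ((u d).val * z)
      have hg0 : g = 0 := by
        refine eq_zero_of_psiCan_mul_eq_zero (PhiMon.phi q d) fun a => ?_
        have h2 := huψ d (a * g)
        have h3 : algebraMap (PS k D) (LS k D) (a * g) * ↑(u d)⁻¹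
            = phiLS k q d s * (algebraMap (PS k D) (LS k D) a * z) := by
          rw [map_mul, ← hg]
          calc _ = phiLS k q d s * (algebraMap (PS k D) (LS k D) a * z)
                * ((u d : LS k D) * ↑(u d)⁻¹) := by ring
            _ = _ := by rw [Units.mul_inv, mul_one]
        rw [h3, Ψ.linLS_phiLS_mul, h1, mul_zero] at h2
        have h4 := algebraMap_LS_injective (h2.symm.trans (map_zero _).symm)
        exact (smul_eq_zero.mp h4).resolve_left (c d).ne_zero
      rw [hg0, map_zero] at hg
      have h5 := ((s.isUnit.map (phiLS k q d)).mul_right_eq_zero).mp hg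
      exact ((u d).isUnit.mul_right_eq_zero).mp h5
    have hz' := sub_eq_zero.mp hz
    have hγ : gammaLS Φ (j.comp r) γ (u d) * gammaLS Φ (j.comp r) γ ↑(u d)⁻¹ = 1 := by
      rw [← map_mul, Units.mul_inv, map_one]
    calc phiLS k q d (algebraMap _ _ (G γ 1)) * u d
        = (gammaLS Φ (j.comp r) γ (u d) * gammaLS Φ (j.comp r) γ ↑(u d)⁻¹)
          * phiLS k q d (algebraMap _ _ (G γ 1)) * u d := by rw [hγ, one_mul]
      _ = gammaLS Φ (j.comp r) γ (u d) * (gammaLS Φ (j.comp r) γ ↑(u d)⁻¹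
          * phiLS k q d (algebraMap _ _ (G γ 1))) * u d := by ring
      _ = gammaLS Φ (j.comp r) γ (u d) * algebraMap _ _ (G γ 1) * (↑(u d)⁻¹ * u d) := by
          rw [← hz']; ring
      _ = _ := by rw [Units.inv_mul, mul_one]
  -- Sending 1 to u_d gives ψ_d(f) = ψ_d(f u_d⁻¹ · φ_d(1)) = ψ_d(f u_d⁻¹), which is c_d times the
  -- standard operator by the choice of u_d.
  let φ : ∀ d : D, LS k D →ₛₗ[phiLS k q d] LS k D := fun d =>
    { toFun := fun x => phiLS k q d x * u d
      map_add' := fun x y => by rw [map_add, add_mul]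
      map_smul' := fun a x => by rw [smul_eq_mul, map_mul, smul_eq_mul, mul_assoc] }
  have hφ : ∀ d x, φ d x = phiLS k q d x * u d := fun _ _ => rfl
  let P : EtalePhiGamma D q Φ (j.comp r) (LS k D) :=
    { phi := φ
      gam :=
        { toFun := fun γ =>
            { toFun := fun x => gammaLS Φ (j.comp r) γ x * algebraMap _ _ (G γ 1)
              map_zero' := by rw [map_zero, zero_mul]
              map_add' := fun x y => by rw [map_add, add_mul] }
          map_one' := by
            ext x
            change gammaLS Φ (j.comp r) 1 x * algebraMap _ _ (G 1 1) = x
            rw [gammaLS_one hO hΦ, map_one G, AddMonoid.End.one_apply, map_one, mul_one]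
          map_mul' := fun γ δ => by
            ext x
            change gammaLS Φ (j.comp r) (γ * δ) x * algebraMap _ _ (G (γ * δ) 1)
              = gammaLS Φ (j.comp r) γ (gammaLS Φ (j.comp r) δ x * algebraMap _ _ (G δ 1))
                * algebraMap _ _ (G γ 1)
            have e : G (γ * δ) 1 = G γ (G δ 1) := by rw [map_mul G]; rfl
            rw [e, hG1 γ (G δ 1), gammaLS_mul hO hΦ, map_mul,
              map_mul, gammaLS_algebraMap, mul_assoc] }
      phi_comm := fun d d' x => by
        by_cases h : d = d'
        · rw [h]
        · rw [hφ, hφ, hφ, hφ, map_mul, map_mul, huφ d' d (Ne.symm h), huφ d d' h, phiLS_comm]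
          ring
      phi_gam := fun d γ x => by
        change phiLS k q d (gammaLS Φ (j.comp r) γ x * algebraMap _ _ (G γ 1)) * u d
          = gammaLS Φ (j.comp r) γ (phiLS k q d x * u d) * algebraMap _ _ (G γ 1)
        rw [map_mul, map_mul, mul_assoc, key, gammaLS_phiLS hO, mul_assoc]
      gam_smul := fun γ a x => by
        change gammaLS Φ (j.comp r) γ (a * x) * _ = gammaLS Φ (j.comp r) γ a * (_ * _)
        rw [map_mul, mul_assoc]
      finite := inferInstance
      etale := fun d => by
        have h : ⇑(linearization q d (φ d)) = (fun x : LS k D => x * u d) ∘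
            (toPhiLS k q d).symm ∘ (TensorProduct.rid (LS k D) (PhiLS k q d)) := by
          funext t
          induction t using TensorProduct.induction_on with
          | zero => simp
          | tmul a y =>
            change (toPhiLS k q d).symm a * (phiLS k q d y * u d)
              = (phiLS k q d y * (toPhiLS k q d).symm a) * u d
            ring
          | add s t hs ht => rw [map_add, hs, ht]; simp [add_mul]
        rw [h]
        exact ((u d).mulRight_bijective).comp
          ((RingEquiv.bijective _).comp (LinearEquiv.bijective _)) }
  refine ⟨P, fun γ f => ?_, fun d f => ?_⟩
  · change gammaLS Φ (j.comp r) γ (algebraMap _ _ f) * algebraMap _ _ (G γ 1) = _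
    rw [gammaLS_algebraMap, ← map_mul, ← hG1]
  · have h : algebraMap (PS k D) (LS k D) f
        = (algebraMap (PS k D) (LS k D) f * ↑(u d)⁻¹) • P.phi d 1 := by
      change _ = _ * (phiLS k q d 1 * u d)
      rw [map_one, one_mul, mul_assoc, Units.inv_mul, mul_one]
    rw [h, EtalePhiGamma.psi_smul_phi, huψ, smul_eq_mul, mul_one]

end Rank1

/-! ### The étale module attached to `Δ_𝒟` -/

section Attached

open MvPowerSeries

variable {O κ k D : Type*} [CommRing O] [Field κ] [Field k] [Fintype D] [DecidableEq D]
  {q : ℕ} [NeZero q] {π : O} {Φ : PowerSeries O} {r : O →+* κ} {j : κ →+* k} {red : O →+* k}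
  {c : D → kˣ} {𝒟 𝒟' : Family D} {m : D → ZMod (q - 1)}

omit [Fintype D] [DecidableEq D] in
lemma Family.bot_subset (𝒟 : Family D) : (Family.bot D).carrier ⊆ 𝒟.carrier :=
  Set.empty_subset _

lemma DD.exists_smul_eq_of (hq : 1 < q) (x : DD q c 𝒟) :
    ∃ (s : (LS k D)ˣ) (l : DeltaDual q c 𝒟), (s : LS k D) • x = DD.of q c 𝒟 l := by
  obtain ⟨n, g, h⟩ := exists_tD_pow_smul_eq (DD.equiv hq x)
  obtain ⟨l, hl⟩ := DeltaDual.exists_theta_eq (c := c) hq (tD_mul_mem_famIdeal (𝒟 := 𝒟) g)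
  obtain ⟨s, hs⟩ := isUnit_algebraMap_tD_pow (k := k) (D := D) (n + 1)
  refine ⟨s, l, (DD.equiv hq).injective ?_⟩
  rw [map_smul, DD.equiv_of, hl, hs, map_mul, ← h, pow_succ', map_mul, smul_eq_mul,
    Algebra.smul_def (tD k D ^ n), mul_assoc]

lemma DD.of_smul (f : PS k D) (l : DeltaDual q c 𝒟) :
    DD.of q c 𝒟 (f • l) = algebraMap (PS k D) (LS k D) f • DD.of q c 𝒟 l := by
  rw [map_smul, algebraMap_smul]

lemma DD.tmul_eq (a : LS k D) (l : DeltaDual q c 𝒟) : a ⊗ₜ[PS k D] l = a • DD.of q c 𝒟 l := by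
  change _ = a • ((1 : LS k D) ⊗ₜ[PS k D] l)
  rw [TensorProduct.smul_tmul', smul_eq_mul, mul_one]

/-- After clearing denominators z comes from a linear form, on whose power series ψ_d is c_d times
the standard operator; nondegeneracy of the latter gives the claim. -/
lemma DD.eq_zero_of_psi_smul_eq_zero (hq : 1 < q) {Ψ : PsiOperator k D q Φ red}
    {ρ : (D → Oˣ) →* Module.End k (Delta q c 𝒟)} {P : EtalePhiGamma D q Φ red (DD q c 𝒟)}
    (hP : IsAttached Ψ ρ P) (d : D) {z : DD q c 𝒟}
    (h : ∀ a : LS k D, P.psi Ψ d (a • z) = 0) : z = 0 := by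
  obtain ⟨s, l, hs⟩ := DD.exists_smul_eq_of hq z
  have hl : l.theta hq = 0 := by
    refine eq_zero_of_psiCan_mul_eq_zero (PhiMon.phi q d) fun b => ?_
    have h1 := h (algebraMap (PS k D) (LS k D) b * s)
    rw [mul_smul, hs, ← DD.of_smul, hP.psi] at h1
    have h2 := congrArg (DeltaDual.theta hq) (DD.of_injective hq (h1.trans (map_zero _).symm))
    rw [DeltaDual.theta_comp_phi, map_zero, map_smul, smul_eq_mul] at h2
    exact (smul_eq_zero.mp h2).resolve_left (c d).ne_zero
  have hl0 : l = 0 := DeltaDual.theta_injective hq (hl.trans (map_zero _).symm)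
  rw [hl0, map_zero] at hs
  have h3 := congrArg (fun x => (↑s⁻¹ : LS k D) • x) hs
  simpa [smul_smul] using h3

/-- ψ_d is determined on Δ_𝒟^* and hence everywhere by semilinearity. It in turn determines φ_d,
since ψ_d(a φ_d(y)) = ψ_d(a) y for all a and the pairing is nondegenerate. -/
lemma IsAttached.unique (hq : 1 < q) {Ψ : PsiOperator k D q Φ red}
    {ρ : (D → Oˣ) →* Module.End k (Delta q c 𝒟)} {P P' : EtalePhiGamma D q Φ red (DD q c 𝒟)}
    (hP : IsAttached Ψ ρ P) (hP' : IsAttached Ψ ρ P') : P' = P := by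
  have hpsi : ∀ d x, P'.psi Ψ d x = P.psi Ψ d x := by
    intro d x
    induction x using TensorProduct.induction_on with
    | zero => simp
    | tmul a l =>
      obtain ⟨b, g, rfl⟩ := exists_eq_phiLS_mul q d a
      rw [DD.tmul_eq, mul_smul, ← DD.of_smul, EtalePhiGamma.psi_phiLS_smul,
        EtalePhiGamma.psi_phiLS_smul, hP.psi, hP'.psi]
    | add x y hx hy => rw [map_add, map_add, hx, hy]
  refine EtalePhiGamma.ext ?_ ?_
  · funext d
    ext y : 1
    rw [← sub_eq_zero]
    refine DD.eq_zero_of_psi_smul_eq_zero hq hP d fun a => ?_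
    rw [smul_sub, map_sub, ← hpsi, EtalePhiGamma.psi_smul_phi, EtalePhiGamma.psi_smul_phi,
      sub_self]
  · ext γ x
    induction x using TensorProduct.induction_on with
    | zero => simp
    | tmul a l => rw [DD.tmul_eq, P.gam_smul, P'.gam_smul, hP.gam, hP'.gam]
    | add x y hx hy => rw [map_add, map_add, hx, hy]

/-- The contragredient action on linear forms. -/
def DeltaDual.gam (ρ : (D → Oˣ) →* Module.End k (Delta q c 𝒟)) (γ : D → Oˣ)
    (l : DeltaDual q c 𝒟) : DeltaDual q c 𝒟 := .ofDual (l.toDual ∘ₗ ρ γ⁻¹)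

lemma Delta.proj_gamma (h : 𝒟.carrier ⊆ 𝒟'.carrier)
    {ρ : (D → Oˣ) →* Module.End k (Delta q c 𝒟)} {ρ' : (D → Oˣ) →* Module.End k (Delta q c 𝒟')}
    (hρ : IsGammaAction q c 𝒟 Φ red m ρ) (hρ' : IsGammaAction q c 𝒟' Φ red m ρ')
    (γ : D → Oˣ) (x : Delta q c 𝒟) :
    Delta.proj q c h (ρ γ x) = ρ' γ (Delta.proj q c h x) := by
  induction x using Delta.induction with
  | h f n =>
    rw [hρ.smul, hρ.phiEnd, hρ.e, Delta.proj_smul, Delta.proj_phiEnd, Delta.proj_smul_k,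
      Delta.proj_e, Delta.proj_smul, Delta.proj_phiEnd, Delta.proj_e, hρ'.smul, hρ'.phiEnd, hρ'.e]
  | hadd x y hx hy => rw [map_add, map_add, map_add, map_add, hx, hy]

lemma DeltaDual.incl_gam (h : 𝒟.carrier ⊆ 𝒟'.carrier)
    {ρ : (D → Oˣ) →* Module.End k (Delta q c 𝒟)} {ρ' : (D → Oˣ) →* Module.End k (Delta q c 𝒟')}
    (hρ : IsGammaAction q c 𝒟 Φ red m ρ) (hρ' : IsGammaAction q c 𝒟' Φ red m ρ')
    (γ : D → Oˣ) (l : DeltaDual q c 𝒟') :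
    (DeltaDual.incl h l).gam ρ γ = DeltaDual.incl h (l.gam ρ' γ) :=
  LinearMap.ext fun x => congrArg l.toDual (Delta.proj_gamma h hρ hρ' γ⁻¹ x)

/-- `Δ_∅^*` is free of rank one. -/
def DeltaDual.thetaEquiv (hq : 1 < q) : DeltaDual q c (Family.bot D) ≃ₗ[PS k D] PS k D :=
  LinearEquiv.ofBijective (DeltaDual.theta hq) ⟨DeltaDual.theta_injective hq, fun g =>
    DeltaDual.exists_theta_eq hq (by rw [famIdeal_bot]; trivial)⟩

lemma DeltaDual.theta_thetaEquiv_symm (hq : 1 < q) (f : PS k D) :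
    ((DeltaDual.thetaEquiv (c := c) hq).symm f).theta hq = f :=
  (DeltaDual.thetaEquiv hq).apply_symm_apply f

lemma DeltaDual.thetaEquiv_symm_theta (hq : 1 < q) (l : DeltaDual q c (Family.bot D)) :
    (DeltaDual.thetaEquiv hq).symm (l.theta hq) = l :=
  (DeltaDual.thetaEquiv hq).symm_apply_apply l

lemma DeltaDual.gam_smul (hO : IsLubinTateBase q π r) (hΦ : IsLubinTate q π Φ)
    {ρ : (D → Oˣ) →* Module.End k (Delta q c 𝒟)}
    (hρ : IsGammaAction q c 𝒟 Φ (j.comp r) m ρ) (γ : D → Oˣ) (f : PS k D)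
    (l : DeltaDual q c 𝒟) : (f • l).gam ρ γ = gammaPS Φ (j.comp r) γ f • l.gam ρ γ := by
  refine LinearMap.ext fun x => congrArg l.toDual ?_
  change f • ρ γ⁻¹ x = ρ γ⁻¹ (gammaPS Φ (j.comp r) γ f • x)
  rw [hρ.smul, ← gammaPS_mul hO hΦ, inv_mul_cancel, gammaPS_one hO hΦ]

/-- The action of `Γ_•` on power series obtained from the action on `Δ_∅^*`. -/
def DeltaDual.gammaEnd (hq : 1 < q) (ρ : (D → Oˣ) →* Module.End k (Delta q c (Family.bot D))) :
    (D → Oˣ) →* AddMonoid.End (PS k D) where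
  toFun γ :=
    { toFun := fun f => (((DeltaDual.thetaEquiv hq).symm f).gam ρ γ).theta hq
      map_zero' := by
        rw [map_zero]
        exact map_zero (DeltaDual.theta hq)
      map_add' := fun f g => by
        rw [map_add, ← map_add (DeltaDual.theta hq)]
        rfl }
  map_one' := by
    ext1 f
    change (((DeltaDual.thetaEquiv hq).symm f).gam ρ 1).theta hq = f
    have h : ∀ l : DeltaDual q c (Family.bot D), l.gam ρ 1 = l := fun l =>
      LinearMap.ext fun x => congrArg l.toDual (by rw [inv_one, map_one]; rfl)
    rw [h, DeltaDual.theta_thetaEquiv_symm]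
  map_mul' γ δ := by
    ext1 f
    change (((DeltaDual.thetaEquiv hq).symm f).gam ρ (γ * δ)).theta hq
      = (((DeltaDual.thetaEquiv hq).symm
          ((((DeltaDual.thetaEquiv hq).symm f).gam ρ δ).theta hq)).gam ρ γ).theta hq
    rw [DeltaDual.thetaEquiv_symm_theta]
    congr 1
    refine LinearMap.ext fun x => congrArg ((DeltaDual.thetaEquiv hq).symm f).toDual ?_
    rw [mul_inv_rev, map_mul]
    rfl

lemma DeltaDual.gammaEnd_theta (hq : 1 < q)
    (ρ : (D → Oˣ) →* Module.End k (Delta q c (Family.bot D))) (γ : D → Oˣ)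
    (l : DeltaDual q c (Family.bot D)) :
    DeltaDual.gammaEnd hq ρ γ (l.theta hq) = (l.gam ρ γ).theta hq := by
  change (((DeltaDual.thetaEquiv hq).symm (l.theta hq)).gam ρ γ).theta hq = _
  rw [DeltaDual.thetaEquiv_symm_theta]

variable {ρ : ∀ 𝒟 : Family D, (D → Oˣ) →* Module.End k (Delta q c 𝒟)}

/-- The étale module structures attached to the `Δ_𝒟` come from a single structure on
`k((t_•))`. -/
lemma exists_isAttached (hO : IsLubinTateBase q π r) (hΦ : IsLubinTate q π Φ) (hq : 1 < q)
    (Ψ : PsiOperator k D q Φ (j.comp r)) (hΨ : ∀ d, Function.Surjective (Ψ.psi d))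
    (hρ : ∀ 𝒟, IsGammaAction q c 𝒟 Φ (j.comp r) m (ρ 𝒟)) :
    ∃ P : EtalePhiGamma D q Φ (j.comp r) (LS k D),
      (∀ 𝒟, IsAttached Ψ (ρ 𝒟) (P.transport (DD.equiv hq))) ∧
      ∀ d f, P.psi Ψ d (algebraMap (PS k D) (LS k D) f)
        = algebraMap (PS k D) (LS k D) ((c d : k) • psiCan (PhiMon.phi q d) f) := by
  -- Only the action for 𝒟 = ∅ is used, where the dual is all of k[[t_•]]. The actions for other 𝒟
  -- are compatible with it because Δ_∅ → Δ_𝒟 is equivariant.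
  let G := DeltaDual.gammaEnd hq (ρ (Family.bot D))
  have hG : ∀ γ a f, G γ (a * f) = gammaPS Φ (j.comp r) γ a * G γ f := fun γ a f => by
    obtain ⟨l, rfl⟩ := (DeltaDual.thetaEquiv (c := c) hq).surjective f
    change G γ (a * l.theta hq) = _ * G γ (l.theta hq)
    rw [← smul_eq_mul, ← map_smul, DeltaDual.gammaEnd_theta, DeltaDual.gammaEnd_theta,
      DeltaDual.gam_smul hO hΦ (hρ _), map_smul, smul_eq_mul]
  have hGψ : ∀ γ d f, G γ (psiCan (PhiMon.phi q d) f) = psiCan (PhiMon.phi q d) (G γ f) := by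
    intro γ d f
    obtain ⟨l, rfl⟩ := (DeltaDual.thetaEquiv (c := c) hq).surjective f
    change G γ (psiCan (PhiMon.phi q d) (l.theta hq))
      = psiCan (PhiMon.phi q d) (G γ (l.theta hq))
    -- The dual of φ_d is c_d times the standard operator, so the scalar is inserted before
    -- comparing and cancelled because it is nonzero.
    refine smul_right_injective _ (c d).ne_zero ?_
    have h : (c d : k) • G γ (psiCan (PhiMon.phi q d) (l.theta hq))
        = G γ ((c d : k) • psiCan (PhiMon.phi q d) (l.theta hq)) := by
      rw [MvPowerSeries.smul_eq_C_mul, MvPowerSeries.smul_eq_C_mul, hG, gammaPS_C]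
    dsimp only
    rw [h, ← DeltaDual.theta_comp_phi, DeltaDual.gammaEnd_theta, DeltaDual.gammaEnd_theta,
      ← DeltaDual.theta_comp_phi]
    congr 1
    exact LinearMap.ext fun x => congrArg l.toDual ((hρ _).phi γ⁻¹ d x).symm
  obtain ⟨P, hgam, hpsi⟩ := exists_etale hO hΦ hq Ψ hΨ c G hG hGψ
  refine ⟨P, fun 𝒟 => ⟨fun γ l => ?_, fun d l => ?_⟩, hpsi⟩
  · rw [EtalePhiGamma.transport_gam, LinearEquiv.symm_apply_eq, DD.equiv_of, DD.equiv_of,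
      ← DeltaDual.theta_incl hq (Family.bot_subset 𝒟), hgam,
      DeltaDual.gammaEnd_theta, DeltaDual.incl_gam (Family.bot_subset 𝒟) (hρ _) (hρ _), DeltaDual.theta_incl]
    rfl
  · rw [EtalePhiGamma.transport_psi, LinearEquiv.symm_apply_eq, DD.equiv_of, DD.equiv_of, hpsi,
      DeltaDual.theta_comp_phi]

lemma DD.map_phi (hq : 1 < q) (P : EtalePhiGamma D q Φ red (LS k D))
    (h : 𝒟.carrier ⊆ 𝒟'.carrier) (d : D) (x : DD q c 𝒟') :
    DD.map q c h ((P.transport (DD.equiv hq)).phi d x)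
      = (P.transport (DD.equiv hq)).phi d (DD.map q c h x) := by
  apply (DD.equiv hq).injective
  rw [DD.equiv_map, EtalePhiGamma.transport_phi, EtalePhiGamma.transport_phi, DD.equiv_map,
    LinearEquiv.apply_symm_apply, LinearEquiv.apply_symm_apply]

lemma DD.map_gam (hq : 1 < q) (P : EtalePhiGamma D q Φ red (LS k D))
    (h : 𝒟.carrier ⊆ 𝒟'.carrier) (γ : D → Oˣ) (x : DD q c 𝒟') :
    DD.map q c h ((P.transport (DD.equiv hq)).gam γ x)
      = (P.transport (DD.equiv hq)).gam γ (DD.map q c h x) := by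
  apply (DD.equiv hq).injective
  rw [DD.equiv_map, EtalePhiGamma.transport_gam, EtalePhiGamma.transport_gam, DD.equiv_map,
    LinearEquiv.apply_symm_apply, LinearEquiv.apply_symm_apply]

end Attached

/-! ### Lattices in étale modules of rank one -/

section Lattices

open MvPowerSeries

variable {O k D : Type*} [CommRing O] [Field k] [Fintype D] [DecidableEq D]
  {q : ℕ} [NeZero q] {Φ : PowerSeries O} {red : O →+* k} {c : D → kˣ} {𝒟 𝒟' : Family D}

lemma mem_famIdeal_top {f : PS k D} : f ∈ famIdeal k (Family.top D) ↔ tD k D ∣ f := by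
  rw [tD_eq_mon, mon_dvd_iff]
  refine forall_congr' fun i => imp_congr_left ?_
  change (zeroSet i).Nonempty ↔ _
  constructor
  · rintro ⟨d, hd⟩ h
    have := h d
    rw [ones_apply, mem_zeroSet.mp hd] at this
    exact absurd this (by decide)
  · intro h
    by_contra hne
    refine h fun d => ?_
    rw [ones_apply, Nat.one_le_iff_ne_zero]
    exact fun h0 => hne ⟨d, mem_zeroSet.mpr h0⟩

lemma tD_dvd_psiCan (n : PhiMon q D) {f : PS k D} (h : tD k D ∣ f) : tD k D ∣ psiCan n f :=
  mem_famIdeal_top.mp (psiCan_mem_famIdeal n (mem_famIdeal_top.mpr h))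

/-- The monomial with exponent 1 - C has C as its set of missing variables, so it lies in the ideal
exactly when C ∉ 𝒟. -/
lemma famIdeal_injective : Function.Injective (famIdeal k : Family D → Ideal (PS k D)) :=
  fun 𝒟 𝒟' h => by
    ext C
    have h1 : mon k (ones D - sqfree C) ∈ famIdeal k 𝒟
        ↔ mon k (ones D - sqfree C) ∈ famIdeal k 𝒟' := by rw [h]
    rw [mon_mem_famIdeal, mon_mem_famIdeal, zeroSet_ones_sub] at h1
    exact not_iff_not.mp h1

/-- The element `(∏ φ_d) ^ N`. -/
def PhiMon.const (q : ℕ) (D : Type*) (N : ℕ) : PhiMon q D := Multiplicative.ofAdd fun _ => N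

omit [Fintype D] [DecidableEq D] [NeZero q] in
lemma PhiMon.const_one_pow (N : ℕ) : PhiMon.const q D 1 ^ N = PhiMon.const q D N := by
  change Multiplicative.ofAdd (N • (fun _ => 1 : D → ℕ)) = _
  congr 1
  funext d
  simp

omit [NeZero q] in
lemma PhiMon.prod_phi : ∏ d : D, PhiMon.phi q d = PhiMon.const q D 1 := by
  change ∏ d : D, Multiplicative.ofAdd (Pi.single d 1 : D → ℕ) = Multiplicative.ofAdd _
  rw [← ofAdd_sum]
  congr 1
  funext d
  rw [Finset.sum_apply]
  simp [Pi.single_apply]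

omit [DecidableEq D] in
lemma const_smul_tD (N : ℕ) : PhiMon.const q D N • tD k D = tD k D ^ q ^ N := by
  rw [tD, Finset.smul_prod', ← Finset.prod_pow]
  exact Finset.prod_congr rfl fun d _ => smul_X _ _

variable {M : Type*} [AddCommGroup M] [Module (LS k D) M] [Module (PS k D) M]
  [IsScalarTower (PS k D) (LS k D) M]

/-- The inclusion `k[[t_•]] → M` given by a basis of the rank one module `M`. -/
def iota (e : M ≃ₗ[LS k D] LS k D) : PS k D →ₗ[PS k D] M :=
  (e.symm.toLinearMap.restrictScalars (PS k D)) ∘ₗ Algebra.linearMap (PS k D) (LS k D)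

omit [DecidableEq D] in
lemma iota_apply (e : M ≃ₗ[LS k D] LS k D) (f : PS k D) :
    iota e f = e.symm (algebraMap (PS k D) (LS k D) f) := rfl

omit [DecidableEq D] in
lemma iota_injective (e : M ≃ₗ[LS k D] LS k D) : Function.Injective (iota e) :=
  e.symm.injective.comp algebraMap_LS_injective

omit [DecidableEq D] in
lemma iota_eq_smul (e : M ≃ₗ[LS k D] LS k D) (f : PS k D) : iota e f = f • iota e 1 := by
  rw [← map_smul, smul_eq_mul, mul_one]

omit [DecidableEq D] in
lemma exists_tD_pow_smul_eq_iota (e : M ≃ₗ[LS k D] LS k D) (x : M) :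
    ∃ (N : ℕ) (g : PS k D), tD k D ^ N • x = iota e g := by
  obtain ⟨N, g, h⟩ := exists_tD_pow_smul_eq (e x)
  refine ⟨N, g, ?_⟩
  rw [iota_apply, LinearEquiv.eq_symm_apply, ← h, ← algebraMap_smul (LS k D), map_smul,
    algebraMap_smul]

omit [DecidableEq D] in
lemma tD_pow_smul_injective (N : ℕ) : Function.Injective fun x : M => tD k D ^ N • x := by
  intro x y h
  obtain ⟨s, hs⟩ := isUnit_algebraMap_tD_pow (k := k) (D := D) N
  have h' : (s : LS k D) • x = (s : LS k D) • y := by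
    rw [hs, algebraMap_smul, algebraMap_smul]; exact h
  have h'' := congrArg (fun x => (↑s⁻¹ : LS k D) • x) h'
  simpa [smul_smul] using h''

omit [DecidableEq D] in
lemma isLattice_map_iota (e : M ≃ₗ[LS k D] LS k D) {I : Ideal (PS k D)} (hI : tD k D ∈ I) :
    IsLattice (Submodule.map (iota e) I) where
  fg := (IsNoetherian.noetherian I).map _
  span_eq_top := by
    rw [eq_top_iff]
    rintro x -
    obtain ⟨s, hs⟩ := isUnit_algebraMap_tD_pow (k := k) (D := D) 1
    rw [pow_one] at hs
    have hx : x = (e x * ↑s⁻¹) • iota e (tD k D) := by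
      apply e.injective
      rw [map_smul, iota_apply, e.apply_symm_apply, ← hs, smul_eq_mul, mul_assoc, Units.inv_mul,
        mul_one]
    rw [hx]
    exact Submodule.smul_mem _ _ (Submodule.subset_span ⟨_, hI, rfl⟩)

omit [DecidableEq D] in
lemma IsLattice.exists_tD_pow_smul_mem {E : Submodule (PS k D) M} (hE : IsLattice E) (x : M) :
    ∃ N, tD k D ^ N • x ∈ E := by
  have hx : x ∈ Submodule.span (LS k D) (E : Set M) := by rw [hE.span_eq_top]; trivial
  induction hx using Submodule.span_induction with
  | mem x hx => exact ⟨0, by rwa [pow_zero, one_smul]⟩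
  | zero => exact ⟨0, by rw [smul_zero]; exact zero_mem _⟩
  | add x y _ _ hx hy =>
    obtain ⟨N, hN⟩ := hx
    obtain ⟨N', hN'⟩ := hy
    refine ⟨N + N', ?_⟩
    rw [smul_add, add_comm N, pow_add, mul_smul, mul_smul, smul_comm _ _ y]
    exact add_mem (E.smul_mem _ hN) (E.smul_mem _ hN')
  | smul a x _ hx =>
    obtain ⟨N, hN⟩ := hx
    obtain ⟨n, g, h⟩ := exists_tD_pow_smul_eq a
    refine ⟨N + n, ?_⟩
    rw [pow_add, mul_smul, ← smul_assoc (tD k D ^ n) a x, h, algebraMap_smul, smul_comm]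
    exact E.smul_mem _ hN

-- Finitely many generators have a common bound on their denominators. Together with
-- `IsLattice.exists_tD_pow_smul_mem`, this traps a lattice between two t_D-power multiples of
-- k[[t_•]].
omit [DecidableEq D] in
lemma IsLattice.exists_le_range_iota (e : M ≃ₗ[LS k D] LS k D) {E : Submodule (PS k D) M}
    (hE : IsLattice E) : ∃ N, ∀ x ∈ E, ∃ g, tD k D ^ N • x = iota e g := by
  obtain ⟨s, rfl⟩ := hE.fg
  choose n g h using exists_tD_pow_smul_eq_iota e
  refine ⟨s.sup n, fun x hx => ?_⟩
  induction hx using Submodule.span_induction with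
  | mem x hx =>
    refine ⟨tD k D ^ (s.sup n - n x) * g x, ?_⟩
    rw [← smul_eq_mul, map_smul, ← h, smul_smul, ← pow_add,
      Nat.sub_add_cancel (Finset.le_sup (f := n) hx)]
  | zero => exact ⟨0, by rw [smul_zero, map_zero]⟩
  | add x y _ _ hx hy =>
    obtain ⟨a, ha⟩ := hx
    obtain ⟨b, hb⟩ := hy
    exact ⟨a + b, by rw [smul_add, ha, hb, map_add]⟩
  | smul a x _ hx =>
    obtain ⟨b, hb⟩ := hx
    exact ⟨a * b, by rw [smul_comm, hb, ← smul_eq_mul, map_smul]⟩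

/-! ### Behaviour of ψ_D on lattices; D^♯ and D^♮. -/

section Psi

variable {e : M ≃ₗ[LS k D] LS k D} {P : EtalePhiGamma D q Φ red M} {Ψ : PsiOperator k D q Φ red}
  (hP : ∀ d f, P.psi Ψ d (iota e f) = iota e ((c d : k) • psiCan (PhiMon.phi q d) f))

lemma psi_smul_smul (P : EtalePhiGamma D q Φ red M) (Ψ : PsiOperator k D q Φ red) (d : D)
    (f : PS k D) (x : M) : P.psi Ψ d ((PhiMon.phi q d • f) • x) = f • P.psi Ψ d x := by
  rw [← algebraMap_smul (LS k D), ← phiLS_algebraMap, EtalePhiGamma.psi_phiLS_smul,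
    algebraMap_smul]

include hP in
lemma psiD_pow_spec (N : ℕ) :
    (∀ f, (P.psiD Ψ ^ N) (iota e f)
      = iota e ((cPow c (PhiMon.const q D N) : k) • psiCan (PhiMon.const q D N) f)) ∧
    ∀ (f : PS k D) x, (P.psiD Ψ ^ N) ((PhiMon.const q D N • f) • x) = f • (P.psiD Ψ ^ N) x := by
  -- Pairs of an operator and a φ-monomial for which both formulas hold. They are closed under
  -- products, so commutation of the ψ_d is not needed: the order matters only in the first
  -- component.
  let S : Submonoid (AddMonoid.End M × PhiMon q D) :=
    { carrier := {A | (∀ f, A.1 (iota e f) = iota e ((cPow c A.2 : k) • psiCan A.2 f)) ∧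
        ∀ (f : PS k D) x, A.1 ((A.2 • f) • x) = f • A.1 x}
      one_mem' := ⟨fun f => by
        change iota e f = iota e ((cPow c (1 : PhiMon q D) : k) • psiCan 1 f)
        rw [psiCan_one, map_one, Units.val_one, one_smul], fun f x => by
        change ((1 : PhiMon q D) • f) • x = f • x
        rw [one_smul]⟩
      mul_mem' := fun {A B} hA hB => ⟨fun f => by
        change A.1 (B.1 (iota e f)) = iota e ((cPow c (A.2 * B.2) : k) • psiCan (A.2 * B.2) f)
        rw [hB.1, hA.1, map_smul (psiCan _), smul_smul, map_mul, Units.val_mul, psiCan_mul], fun f x => by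
        change A.1 (B.1 (((A.2 * B.2) • f) • x)) = f • A.1 (B.1 x)
        rw [mul_comm, mul_smul, hB.2, hA.2]⟩ }
  have h1 : (P.psiD Ψ, PhiMon.const q D 1) ∈ S := by
    have h2 : ((Finset.univ : Finset D).toList.map fun d => (P.psi Ψ d, PhiMon.phi q d)).prod
        ∈ S := by
      refine Submonoid.list_prod_mem _ fun A hA => ?_
      obtain ⟨d, -, rfl⟩ := List.mem_map.mp hA
      refine ⟨fun f => ?_, psi_smul_smul P Ψ d⟩
      rw [cPow_phi, hP]
    have h3 : ((Finset.univ : Finset D).toList.map fun d => (P.psi Ψ d, PhiMon.phi q d)).prod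
        = (P.psiD Ψ, PhiMon.const q D 1) := by
      refine Prod.ext ?_ ?_
      · rw [← MonoidHom.coe_fst, map_list_prod, List.map_map]
        rfl
      · rw [← MonoidHom.coe_snd, map_list_prod, List.map_map]
        exact (Finset.prod_map_toList _ _).trans PhiMon.prod_phi
    rwa [h3] at h2
  have h4 := pow_mem h1 N
  rw [Prod.pow_mk, PhiMon.const_one_pow] at h4
  exact h4

include hP

/-- A pole of order at most N disappears after N steps: since N < q^N, t_D^(q^N) x is t_D times an
integral element. Applying ψ_D^N shows that t_D ψ_D^N(x) is integral and still divisible by t_D. -/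
lemma psiD_pow_mem_range (hq : 1 < q) {N : ℕ} {x : M} {g : PS k D}
    (h : tD k D ^ N • x = iota e g) : ∃ g', (P.psiD Ψ ^ N) x = iota e g' := by
  obtain ⟨h1, h2⟩ := psiD_pow_spec hP N
  have hN : N < q ^ N := Nat.lt_pow_self hq
  have h3 : (PhiMon.const q D N • tD k D) • x = iota e (tD k D * (tD k D ^ (q ^ N - N - 1) * g)) := by
    rw [const_smul_tD, ← mul_assoc, ← pow_succ', ← smul_eq_mul, map_smul, ← h, smul_smul,
      ← pow_add]
    congr 2
    omega
  obtain ⟨g', hg'⟩ := tD_dvd_psiCan (PhiMon.const q D N)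
    (Dvd.intro (tD k D ^ (q ^ N - N - 1) * g) rfl : tD k D ∣ _)
  refine ⟨(cPow c (PhiMon.const q D N) : k) • g', tD_pow_smul_injective (k := k) (D := D) 1 ?_⟩
  dsimp only
  rw [pow_one, ← h2, h3, h1, hg', ← map_smul, smul_eq_mul, mul_smul_comm]

lemma isSharpCandidate_range_iota (hq : 1 < q) :
    IsSharpCandidate P Ψ (LinearMap.range (iota e)) where
  isLattice := by
    rw [LinearMap.range_eq_map]
    exact isLattice_map_iota e trivial
  psiD_image := by
    obtain ⟨h1, -⟩ := psiD_pow_spec hP 1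
    rw [pow_one] at h1
    ext y
    constructor
    · rintro ⟨_, ⟨f, rfl⟩, rfl⟩
      rw [h1]
      exact ⟨_, rfl⟩
    · rintro ⟨f, rfl⟩
      refine ⟨_, ⟨(((cPow c (PhiMon.const q D 1))⁻¹ : kˣ) : k) • (PhiMon.const q D 1 • f), rfl⟩, ?_⟩
      rw [h1, map_smul (psiCan _), psiCan_smul, smul_smul, Units.mul_inv, one_smul]
  absorbs x := by
    obtain ⟨N, g, h⟩ := exists_tD_pow_smul_eq_iota e x
    obtain ⟨g', h'⟩ := psiD_pow_mem_range hP hq h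
    exact ⟨N, g', h'.symm⟩

/-- The element 1 is an eigenvector of ψ_D^N with the nonzero eigenvalue c^N. -/
lemma smul_iota_one_mem_of_psiD_pow_mem {E : Submodule (PS k D) M} {N : ℕ} {f : PS k D}
    (h : f • (P.psiD Ψ ^ N) (iota e 1) ∈ E) : f • iota e 1 ∈ E := by
  obtain ⟨h1, -⟩ := psiD_pow_spec hP N
  have hone : psiCan (PhiMon.const q D N) (1 : PS k D) = 1 := by
    rw [← map_one (C : k →+* PS k D), psiCan_C]
  have h2 : (C ((cPow c (PhiMon.const q D N))⁻¹ : kˣ).val : PS k D)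
      • (P.psiD Ψ ^ N) (iota e 1) = iota e 1 := by
    rw [h1, hone, ← map_smul (iota e), smul_eq_mul, ← MvPowerSeries.smul_eq_C_mul, smul_smul,
      Units.inv_mul, one_smul]
  rw [← h2, smul_comm]
  exact E.smul_mem _ h

/-- For another candidate S, the equality S = ψ_D^N(S) with N bounding the poles of S gives S ⊆
k[[t_•]]. Conversely, some ψ_D^n(1) lies in S and is a nonzero scalar multiple of 1. -/
lemma isDSharp_range_iota (hq : 1 < q) : IsDSharp P Ψ (LinearMap.range (iota e)) := by
  refine ⟨isSharpCandidate_range_iota hP hq, fun S hS => le_antisymm ?_ ?_⟩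
  · obtain ⟨N, hN⟩ := hS.isLattice.exists_le_range_iota e
    have himg : ∀ n, ∀ x ∈ S, ∃ y ∈ S, (P.psiD Ψ ^ n) y = x := by
      intro n
      induction n with
      | zero => exact fun x hx => ⟨x, hx, rfl⟩
      | succ n ih =>
        intro x hx
        obtain ⟨y, hy, rfl⟩ := ih x hx
        have hy' : y ∈ P.psiD Ψ '' (S : Set M) := by rw [hS.psiD_image]; exact hy
        obtain ⟨z, hz, rfl⟩ := hy'
        exact ⟨z, hz, by rw [pow_succ]; rfl⟩
    intro x hx
    obtain ⟨y, hy, rfl⟩ := himg N x hx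
    obtain ⟨g, hg⟩ := hN y hy
    obtain ⟨g', hg'⟩ := psiD_pow_mem_range hP hq hg
    exact ⟨g', hg'.symm⟩
  · rintro _ ⟨f, rfl⟩
    obtain ⟨n, hn⟩ := hS.absorbs (iota e 1)
    rw [← one_smul (PS k D) ((P.psiD Ψ ^ n) (iota e 1))] at hn
    have h1 := smul_iota_one_mem_of_psiD_pow_mem hP hn
    rw [one_smul] at h1
    rw [iota_eq_smul]
    exact S.smul_mem _ h1

/-- The ideal is stable under the standard ψ-operator and under φ_d, as both preserve the sets of
missing variables; so c_d⁻¹ φ_d(f) is a preimage of f inside it. -/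
lemma psi_image_map_famIdeal (d : D) :
    P.psi Ψ d '' (Submodule.map (iota e) (famIdeal k 𝒟) : Set M)
      = Submodule.map (iota e) (famIdeal k 𝒟) := by
  ext y
  constructor
  · rintro ⟨_, ⟨f, hf, rfl⟩, rfl⟩
    rw [hP]
    refine ⟨_, ?_, rfl⟩
    rw [SetLike.mem_coe, MvPowerSeries.smul_eq_C_mul]
    exact Ideal.mul_mem_left _ _ (psiCan_mem_famIdeal _ hf)
  · rintro ⟨f, hf, rfl⟩
    refine ⟨_, ⟨(((c d)⁻¹ : kˣ) : k) • (PhiMon.phi q d • f), ?_, rfl⟩, ?_⟩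
    · rw [SetLike.mem_coe, MvPowerSeries.smul_eq_C_mul]
      exact Ideal.mul_mem_left _ _ (smul_mem_famIdeal _ hf)
    · rw [hP, map_smul (psiCan _), psiCan_smul, smul_smul, Units.mul_inv, one_smul]

/-- A ψ-stable lattice E contains t_D^N and hence t_D^(q^N) = φ^N(t_D). Applying ψ_D^N gives t_D up
to a nonzero scalar, so E contains t_D k[[t_•]], which is itself such a lattice. -/
lemma isDNatural_map_iota (hq : 1 < q) :
    IsDNatural P Ψ (Submodule.map (iota e) (famIdeal k (Family.top D))) := by
  refine ⟨_, isDSharp_range_iota hP hq, le_antisymm (le_sInf ?_) (sInf_le ⟨?_, ?_, ?_⟩)⟩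
  · rintro E ⟨hE, -, hψ⟩ _ ⟨f, hf, rfl⟩
    obtain ⟨N, hN⟩ := hE.exists_tD_pow_smul_mem (iota e 1)
    obtain ⟨-, h2⟩ := psiD_pow_spec hP N
    let T : Submonoid (AddMonoid.End M) :=
      { carrier := {A | ∀ x ∈ E, A x ∈ E}
        one_mem' := fun x hx => hx
        mul_mem' := fun {A B} hA hB x hx => hA _ (hB x hx) }
    have hT : P.psiD Ψ ∈ T := by
      refine Submonoid.list_prod_mem _ fun A hA => ?_
      obtain ⟨d, -, rfl⟩ := List.mem_map.mp hA
      exact hψ d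
    have h3 : (PhiMon.const q D N • tD k D) • iota e 1 ∈ E := by
      rw [const_smul_tD, ← Nat.sub_add_cancel (Nat.lt_pow_self hq : N < q ^ N).le, pow_add,
        mul_smul]
      exact E.smul_mem _ hN
    have h4 := pow_mem hT N _ h3
    rw [h2] at h4
    have h5 := smul_iota_one_mem_of_psiD_pow_mem hP h4
    obtain ⟨g, rfl⟩ := mem_famIdeal_top.mp hf
    rw [mul_comm, ← smul_eq_mul, map_smul, iota_eq_smul]
    exact E.smul_mem _ h5
  · exact isLattice_map_iota e (mem_famIdeal_top.mpr dvd_rfl)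
  · rw [LinearMap.range_eq_map]
    exact Submodule.map_mono le_top
  · intro d x hx
    have : P.psi Ψ d x ∈ P.psi Ψ d '' (Submodule.map (iota e) (famIdeal k (Family.top D)) : Set M) :=
      ⟨x, hx, rfl⟩
    rwa [psi_image_map_famIdeal hP] at this

end Psi

lemma DD.lattice_eq (hq : 1 < q) (𝒟 : Family D) :
    DD.lattice q c 𝒟 = Submodule.map (iota (DD.equiv (c := c) hq)) (famIdeal k 𝒟) := by
  have key : ∀ l : DeltaDual q c 𝒟, DD.of q c _ (DeltaDual.incl (Family.bot_subset 𝒟) l)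
      = iota (DD.equiv hq) (l.theta hq) := fun l => by
    rw [iota_apply, LinearEquiv.eq_symm_apply, DD.equiv_of, DeltaDual.theta_incl]
  ext x
  constructor
  · rintro ⟨l, rfl⟩
    exact ⟨_, l.theta_mem hq, (key l).symm⟩
  · rintro ⟨f, hf, rfl⟩
    obtain ⟨l, rfl⟩ := DeltaDual.exists_theta_eq (c := c) hq hf
    exact ⟨l, key l⟩

lemma DD.lattice_injective (hq : 1 < q) : Function.Injective (DD.lattice q c) := fun 𝒟 𝒟' h => by
  rw [DD.lattice_eq hq, DD.lattice_eq hq] at h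
  exact famIdeal_injective (Submodule.map_injective_of_injective (iota_injective _) h)

end Lattices

end

end PsiLattice

/-! ### The main theorem over the ring of integers of F. -/

open ValuativeRel PsiLattice in
theorem mainTheorem4
    {F : Type*} [Field F] [ValuativeRel F] [TopologicalSpace F] [IsNonarchimedeanLocalField F]
    [CharZero F]
    (π : 𝒪[F]) (hπ : Irreducible π)
    (Φ : PowerSeries 𝒪[F]) (hΦ : IsLubinTate (Nat.card 𝓀[F]) π Φ)
    (hΦ₂ : π ^ 2 ∣ PowerSeries.coeff 2 Φ)
    {k : Type*} [Field k] [Finite k] [Algebra 𝓀[F] k]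
    {D : Type*} [Fintype D] [DecidableEq D]
    (Ψ : PsiOperator k D (Nat.card 𝓀[F]) Φ (residueMap F k))
    (hΨ : ∀ d, Function.Surjective (Ψ.psi d))
    (c : D → kˣ) (m : D → ZMod (Nat.card 𝓀[F] - 1)) :
    ∃ (ρ : ∀ 𝒟 : Family D, (D → 𝒪[F]ˣ) →* Module.End k (Delta (Nat.card 𝓀[F]) c 𝒟))
      (P : ∀ 𝒟 : Family D, EtalePhiGamma D (Nat.card 𝓀[F]) Φ (residueMap F k)
        (DD (Nat.card 𝓀[F]) c 𝒟)),
      -- each `Δ_𝒟` carries a unique action of `Γ_•`, is finitely generated and admissible, and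
      -- satisfies `Δ_𝒟 = k[[t_•]] φ_d(Δ_𝒟)`
      (∀ 𝒟, IsGammaAction (Nat.card 𝓀[F]) c 𝒟 Φ (residueMap F k) m (ρ 𝒟) ∧
        (∀ ρ', IsGammaAction (Nat.card 𝓀[F]) c 𝒟 Φ (residueMap F k) m ρ' → ρ' = ρ 𝒟) ∧
        Module.Finite (Tw (Nat.card 𝓀[F]) k D) (Delta (Nat.card 𝓀[F]) c 𝒟) ∧
        IsAdmissible k D (Delta (Nat.card 𝓀[F]) c 𝒟) ∧
        ∀ d, Submodule.span (PS k D) (Set.range (Delta.phi (Nat.card 𝓀[F]) c 𝒟 d)) = ⊤) ∧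
      -- `Δ_𝒟` determines a unique étale module structure on `D_𝒟`, which is of rank one and
      -- contains `Δ_𝒟^*`
      (∀ 𝒟, IsAttached Ψ (ρ 𝒟) (P 𝒟) ∧ (∀ P', IsAttached Ψ (ρ 𝒟) P' → P' = P 𝒟) ∧
        Nonempty (DD (Nat.card 𝓀[F]) c 𝒟 ≃ₗ[LS k D] LS k D) ∧
        Function.Injective (DD.of (Nat.card 𝓀[F]) c 𝒟)) ∧
      -- for `𝒟 ⊆ 𝒟'` the inclusion `Δ_𝒟'^* → Δ_𝒟^*` induces an isomorphism `D_𝒟' ≅ D_𝒟` of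
      -- étale `(φ_•, Γ_•)`-modules
      (∀ (𝒟 𝒟' : Family D) (h : 𝒟.carrier ⊆ 𝒟'.carrier),
        Function.Injective (DeltaDual.incl (q := Nat.card 𝓀[F]) (c := c) h) ∧
        Function.Bijective (DD.map (Nat.card 𝓀[F]) c h) ∧
        (∀ d x, DD.map (Nat.card 𝓀[F]) c h ((P 𝒟').phi d x)
          = (P 𝒟).phi d (DD.map (Nat.card 𝓀[F]) c h x)) ∧
        (∀ γ x, DD.map (Nat.card 𝓀[F]) c h ((P 𝒟').gam γ x)
          = (P 𝒟).gam γ (DD.map (Nat.card 𝓀[F]) c h x))) ∧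
      -- inside `D = D_∅`, the `Δ_𝒟^*` are `Γ_•`-stable lattices with surjective `ψ_d`
      (∀ 𝒟, IsLattice (DD.lattice (Nat.card 𝓀[F]) c 𝒟) ∧
        (∀ γ, ∀ x ∈ DD.lattice (Nat.card 𝓀[F]) c 𝒟,
          (P (Family.bot D)).gam γ x ∈ DD.lattice (Nat.card 𝓀[F]) c 𝒟) ∧
        ∀ d, (P (Family.bot D)).psi Ψ d '' (DD.lattice (Nat.card 𝓀[F]) c 𝒟 : Set _)
          = DD.lattice (Nat.card 𝓀[F]) c 𝒟) ∧
      -- they are pairwise distinct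
      (∀ 𝒟 𝒟' : Family D, 𝒟 ≠ 𝒟' →
        DD.lattice (Nat.card 𝓀[F]) c 𝒟 ≠ DD.lattice (Nat.card 𝓀[F]) c 𝒟') ∧
      -- the extreme cases
      IsDSharp (P (Family.bot D)) Ψ (DD.lattice (Nat.card 𝓀[F]) c (Family.bot D)) ∧
      IsDNatural (P (Family.bot D)) Ψ (DD.lattice (Nat.card 𝓀[F]) c (Family.top D)) := by
  revert Ψ
  -- Unfolding exhibits the reduction as a composite through the residue field with q elements, the
  -- form required by the statements about Γ_•; Ψ is reverted because its type mentions this map.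
  rw [residueMap]
  intro Ψ hΨ
  have hfin : Finite 𝓀[F] := inferInstance
  have hq : 1 < Nat.card 𝓀[F] := Finite.one_lt_card
  have hmem : ∀ x : 𝒪[F], IsLocalRing.residue 𝒪[F] x = 0 ↔ π ∣ x := fun x => by
    rw [IsLocalRing.residue_eq_zero_iff, hπ.maximalIdeal_eq, Ideal.mem_span_singleton]
  have hO : IsLubinTateBase (Nat.card 𝓀[F]) π (IsLocalRing.residue 𝒪[F]) :=
    { isUnit := fun n hn => by
        rw [← IsLocalRing.notMem_maximalIdeal, ← IsLocalRing.residue_eq_zero_iff, map_sub, map_one,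
          map_pow, (hmem π).mpr dvd_rfl, zero_pow hn, sub_zero]
        exact one_ne_zero
      regular := (IsRegular.of_ne_zero hπ.ne_zero).left
      map_eq_zero := hmem
      card := rfl
      finite := hfin }
  choose ρ hρ using fun 𝒟 : Family D =>
    Delta.exists_isGammaAction (j := algebraMap 𝓀[F] k) (c := c) (𝒟 := 𝒟) hO hΦ hΦ₂ m
  obtain ⟨P, hP, hψ⟩ := exists_isAttached hO hΦ hq Ψ hΨ hρ
  -- In the coordinates of `DD.equiv`, ψ_d is c_d times the standard operator. This is the only
  -- input about the étale structure that the lattice statements for D^♯ and D^♮ require.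
  have hι : ∀ d f, (P.transport (DD.equiv hq)).psi Ψ d
      (iota (DD.equiv (c := c) (𝒟 := Family.bot D) hq) f)
      = iota (DD.equiv hq) ((c d : k) • psiCan (PhiMon.phi (Nat.card 𝓀[F]) d) f) := fun d f => by
    rw [EtalePhiGamma.transport_psi, iota_apply, LinearEquiv.apply_symm_apply, hψ, iota_apply]
  refine ⟨ρ, fun 𝒟 => P.transport (DD.equiv hq), fun 𝒟 => ⟨hρ 𝒟,
    fun ρ' hρ' => Delta.gamma_unique hρ' (hρ 𝒟), Delta.moduleFinite, Delta.isAdmissible hq,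
    Delta.span_range_phi hq⟩, fun 𝒟 => ⟨hP 𝒟, fun P' hP' => (hP 𝒟).unique hq hP',
    ⟨DD.equiv hq⟩, DD.of_injective hq⟩, fun 𝒟 𝒟' h => ⟨DeltaDual.incl_injective hq h,
    DD.map_bijective hq h, DD.map_phi hq P h, DD.map_gam hq P h⟩, fun 𝒟 => ⟨?_, ?_, ?_⟩,
    fun 𝒟 𝒟' h h' => h (DD.lattice_injective hq h'), ?_, ?_⟩
  · rw [DD.lattice_eq hq]
    refine isLattice_map_iota _ ?_
    rw [← mul_one (tD k D)]
    exact tD_mul_mem_famIdeal 1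
  · rintro γ _ ⟨l, rfl⟩
    refine ⟨l.gam (ρ 𝒟) γ, ?_⟩
    change DD.of _ c _ (DeltaDual.incl (Family.bot_subset 𝒟) (l.gam (ρ 𝒟) γ))
      = (P.transport (DD.equiv hq)).gam γ
        (DD.of _ c _ (DeltaDual.incl (Family.bot_subset 𝒟) l))
    rw [(hP (Family.bot D)).gam, ← DeltaDual.incl_gam (Family.bot_subset 𝒟) (hρ _) (hρ _)]
    rfl
  · intro d
    rw [DD.lattice_eq hq]
    exact psi_image_map_famIdeal hι d
  · rw [DD.lattice_eq hq, famIdeal_bot, ← LinearMap.range_eq_map]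
    exact isDSharp_range_iota hι hq
  · rw [DD.lattice_eq hq]
    exact isDNatural_map_iota hι hq
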